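/- Let $N=\{1,\dots,n\}$. A function $f\colon 2^{N}\to\mathbb{R}_{\ge 0}$ is symmetric if $f(S)=f(N\setminus S)$ for all $S\subseteq N$, and submodular if $f(A)+f(B)\ge f(A\cup B)+f(A\cap B)$ for all $A,B\subseteq N$. There is a randomized algorithm with the following properties. It receives $n$, an integer $1\le k\le n$ and a non-negative symmetric submodular function $f\colon 2^{N}\to\mathbb{R}_{\ge 0}$, the latter through a value oracle (which returns $f(S)$ for a queried set $S$). It is a single program for a random-access machine with unit-cost arithmetic on real numbers and fair coin flips; it always stops after a number of steps, value queries included, that is at most a polynomial in $n$, and always outputs a set $S\subseteq N$ with $|S|=k$. Moreover, there is a sequence $\varepsilon_n\to 0$ (independent of $k$ and $f$) such that, for all inputs with $1\le k\le n/2$, $$\mathbb{E}[f(S)]\ \ge\ \Bigl(\tfrac12\bigl[1-(1-k/n)^{2n/k}\bigr]-\varepsilon_n\Bigr)\cdot\max\{f(A): A\subseteq N,\ |A|=k\},$$ and, for all inputs with $n/2<k<n$, the same holds with the ratio $\tfrac12\bigl[1-(1-\bar k/n)^{2n/\bar k}\bigr]-\varepsilon_n$, where $\bar k=n-k$. (For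 $k=n$ the set $N$ is the only feasible solution.) -/

import Mathlib

/-! ## Set functions -/

/-- `f` is submodular: `f(A) + f(B) ≥ f(A ∪ B) + f(A ∩ B)` for all `A`, `B`. -/
def IsSubmodular {α : Type*} [DecidableEq α] (f : Finset α → ℝ) : Prop :=
  ∀ A B : Finset α, f (A ∪ B) + f (A ∩ B) ≤ f A + f B

/-- `f` is symmetric: every set and its complement have the same value. -/
def IsSymmetricFn {α : Type*} [Fintype α] [DecidableEq α] (f : Finset α → ℝ) : Prop :=
  ∀ S : Finset α, f Sᶜ = f S

/-! ## Randomized real-RAM programs with a value oracle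

The machine has a memory of natural numbers (counters, addresses, characteristic vectors of sets)
and a memory of real numbers. Either memory is organised in arrays `0, 1, 2, …`, each with cells
`0, 1, 2, …`. Available unit-cost operations: addition and truncated subtraction of naturals; the
four field operations and comparison of reals; indirect addressing; fair coin flips; value queries.
There is neither multiplication of naturals, nor a conversion from reals to naturals (no floor
function), nor any real constant other than the natural numbers. The control structures are
sequencing, branching and loops whose number of iterations is computed at the entry of the loop
(a polynomial-time computation can always be put into this form by clocking it). -/

/-- Expressions of type natural number; `cell a i` is the content of cell `i` of the array `a`. -/
inductive NatExpr : Type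
  | lit (c : ℕ)
  | cell (a : ℕ) (i : NatExpr)
  | add (d e : NatExpr)
  | sub (d e : NatExpr)

/-- Expressions of type real number; `cell a i` is the content of cell `i` of the array `a`. -/
inductive RealExpr : Type
  | ofNat (e : NatExpr)
  | cell (a : ℕ) (i : NatExpr)
  | add (d e : RealExpr)
  | sub (d e : RealExpr)
  | mul (d e : RealExpr)
  | div (d e : RealExpr)

/-- Tests. -/
inductive TestExpr : Type
  | natLe (d e : NatExpr)
  | realLe (d e : RealExpr)
  | not (b : TestExpr)
  | and (b c : TestExpr)

/-- Programs. -/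
inductive Program : Type
  /-- do nothing -/
  | skip
  /-- cell `i` of the natural array `a` becomes the value of `e` -/
  | setNat (a : ℕ) (i e : NatExpr)
  /-- cell `i` of the real array `a` becomes the value of `e` -/
  | setReal (a : ℕ) (i : NatExpr) (e : RealExpr)
  /-- cell `i` of the real array `a` becomes the oracle's value of the set whose characteristic
  vector is stored in the natural array `s` -/
  | query (a : ℕ) (i : NatExpr) (s : ℕ)
  /-- cell `i` of the natural array `a` becomes the outcome, `0` or `1`, of a fresh fair coin -/
  | flip (a : ℕ) (i : NatExpr)
  /-- first `p`, then `q` -/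
  | seq (p q : Program)
  /-- if `b` then `p`, otherwise `q` -/
  | ite (b : TestExpr) (p q : Program)
  /-- evaluate `e` and then run `p` that many times -/
  | loop (e : NatExpr) (p : Program)

/-- A state of the machine: the two memories, and the number of steps made so far (which programs
cannot read). -/
structure MachineState : Type where
  nat : ℕ → ℕ → ℕ
  real : ℕ → ℕ → ℝ
  time : ℕ

namespace MachineState

/-- Count one step. -/
def tick (s : MachineState) : MachineState :=
  { s with time := s.time + 1 }

/-- Write `v` to cell `i` of the natural array `a`. -/
def writeNat (s : MachineState) (a i v : ℕ) : MachineState :=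
  { s with nat := Function.update s.nat a (Function.update (s.nat a) i v) }

/-- Write `v` to cell `i` of the real array `a`. -/
def writeReal (s : MachineState) (a i : ℕ) (v : ℝ) : MachineState :=
  { s with real := Function.update s.real a (Function.update (s.real a) i v) }

/-- The subset of `{0, …, n - 1}` whose characteristic vector is stored in the array `a`. -/
def readSet (s : MachineState) (n a : ℕ) : Finset (Fin n) :=
  Finset.univ.filter fun u => s.nat a u ≠ 0

/-- The initial state for the ground set `{0, …, n - 1}` and the cardinality `k`: these two numbers
are in cell `0` of the natural arrays `0` and `1`, all other cells hold `0`. -/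
def initial (n k : ℕ) : MachineState where
  nat := fun a i => if a = 0 ∧ i = 0 then n else if a = 1 ∧ i = 0 then k else 0
  real := fun _ _ => 0
  time := 0

end MachineState

/-- The value of an expression in a state. -/
def NatExpr.eval (s : MachineState) : NatExpr → ℕ
  | lit c => c
  | cell a i => s.nat a (i.eval s)
  | add d e => d.eval s + e.eval s
  | sub d e => d.eval s - e.eval s

/-- The value of an expression in a state (the quotient by `0` is `0`). -/
noncomputable def RealExpr.eval (s : MachineState) : RealExpr → ℝ
  | ofNat e => (e.eval s : ℝ)
  | cell a i => s.real a (i.eval s)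
  | add d e => d.eval s + e.eval s
  | sub d e => d.eval s - e.eval s
  | mul d e => d.eval s * e.eval s
  | div d e => d.eval s / e.eval s

/-- The truth value of a test in a state. -/
def TestExpr.Holds (s : MachineState) : TestExpr → Prop
  | natLe d e => d.eval s ≤ e.eval s
  | realLe d e => d.eval s ≤ e.eval s
  | not b => ¬ b.Holds s
  | and b c => b.Holds s ∧ c.Holds s

/-- Run `step` `m` times in a row; every iteration counts one step of its own. -/
noncomputable def iterateRun (step : MachineState → PMF MachineState) :
    ℕ → MachineState → PMF MachineState
  | 0, s => PMF.pure s
  | m + 1, s => (step s.tick).bind (iterateRun step m)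

open Classical in
/-- The distribution of the state after running a program from the state `s`, where `f` answers the
value queries. Every instruction that is executed, every evaluation of a test, every loop entry and
every loop iteration counts one step. (The expressions in a program have a fixed size, so this is
the number of elementary operations up to a constant factor that depends on the program only.) -/
noncomputable def Program.run {n : ℕ} (f : Finset (Fin n) → ℝ) :
    Program → MachineState → PMF MachineState
  | skip, s => PMF.pure s.tick
  | setNat a i e, s => PMF.pure (s.tick.writeNat a (i.eval s) (e.eval s))
  | setReal a i e, s => PMF.pure (s.tick.writeReal a (i.eval s) (e.eval s))
  | query a i b, s => PMF.pure (s.tick.writeReal a (i.eval s) (f (s.readSet n b)))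
  | flip a i, s =>
      (PMF.uniformOfFintype Bool).bind fun c => PMF.pure (s.tick.writeNat a (i.eval s) c.toNat)
  | seq p q, s => (p.run f s).bind (q.run f)
  | ite b p q, s => if b.Holds s then p.run f s.tick else q.run f s.tick
  | loop e p, s => iterateRun (p.run f) (e.eval s) s.tick

/-- The distribution of the final state on the input `(f, k)`. -/
noncomputable def Program.finalState (P : Program) {n : ℕ} (f : Finset (Fin n) → ℝ) (k : ℕ) :
    PMF MachineState :=
  P.run f (MachineState.initial n k)

/-- The distribution of the output on the input `(f, k)`: the output is the set whose characteristic
vector is in the natural array `2` at the end. -/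
noncomputable def Program.output (P : Program) {n : ℕ} (f : Finset (Fin n) → ℝ) (k : ℕ) :
    PMF (Finset (Fin n)) :=
  (P.finalState f k).map fun s => s.readSet n 2

/-- The expected value `𝔼[f(S)]` of the output `S` on the input `(f, k)`. -/
noncomputable def Program.expectedValue (P : Program) {n : ℕ} (f : Finset (Fin n) → ℝ) (k : ℕ) :
    ℝ :=
  ∑ S : Finset (Fin n), (P.output f k S).toReal * f S

/-! ## The approximation ratio -/

/-- `½ [1 - (1 - k/n)^(2n/k)]`, a power with a real exponent; used for `1 ≤ k ≤ n/2` only. -/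
noncomputable def symmetricRatio (n k : ℕ) : ℝ :=
  1 / 2 * (1 - (1 - (k : ℝ) / (n : ℝ)) ^ (2 * (n : ℝ) / (k : ℝ)))

/-- The maximum of `f` over the sets of cardinality `k`. -/
noncomputable def maxValue {n : ℕ} (f : Finset (Fin n) → ℝ) (k : ℕ) : ℝ :=
  sSup (f '' {S : Finset (Fin n) | S.card = k})

/-!
By symmetry of `f` a set may be replaced by its complement, so it suffices to solve the problem
for `k ≤ n / 2`. The algorithm keeps a list `u₁, …, u_t` of elements of the ground set and
considers the random set `S` obtained by letting each `u_j`, with probability `ε = 2 ^ (-b)`,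
replace the membership of `u_j` by a fair coin. Equivalently, a random set `T` of *touched*
elements is drawn, every occurrence in the list touching its element with probability `ε`, and `S`
is a uniformly random subset of `T`.

*Growing the list.* Let `O` be an optimal set. Submodularity gives
`∑ u ∈ O, (f (S ∆ {u}) - f S) ≥ f (S ∪ O) + f (S \ O) - 2 * f S`, and symmetry with submodularity
bounds `f (S ∪ O) + f (S \ O)` below by `f O`. Hence some `u` has an expected effect of at least
`(f O - 2 * E f(S)) / k` on toggling, and appending it to the list raises `E f(S)` by `ε / 2` times
that amount. The effects are estimated from polynomially many samples; because `f ≤ 2 (n + 1) f O`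
everywhere, a variance bound makes the estimation error negligible. Iterating,
`E f(S) ≥ f O * (1 - (1 - ε / k) ^ t) / 2` up to a small error (`expect_historyTree`).

*Length of the list.* If `2 k ^ 2 < n`, then `ε = 1` and `t = 2 k`, so never more than `2 k`
elements are touched. Otherwise `ε` is between `1 / (2 n)` and `1 / n`, and `t` is chosen so that
`t * ε` is about `2 k + 2 k ^ 2 / n`; with `p = k / n` this matches
`exp (-2 - 2 p) ≤ (1 - p) ^ (2 / p)`, which yields the ratio of the theorem. The number of touched
elements is a sum of independent indicators. Its mean is at most `2 k + 5` by convexity, and its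
variance is at most its mean, so the expected excess over `2 k` is `O(√k)`
(`expect_excess_le`).

*Rounding.* Let `halfMean f T` be the mean of `f` over the subsets of `T`. For symmetric submodular
`f` it is monotone in `T`, so `T` may be filled up to `2 k` elements. Then `T` is split
into pairs, and instead of one coin per element one coin per pair selects exactly one of its two
elements. By submodularity `f (A ∪ {u}) + f (A ∪ {v}) ≥ f (A ∪ {u, v}) + f A`, so this does not
lower the expectation, and about half of `T` remains. Greedy removal down to `k` elements costs at
most `f O / k` for every element by which `|T|` exceeded `2 k`
(`halfMean_sub_le_expect_roundTree`).

*The program.* Probabilistic computations are represented by finite binary trees of coin flips,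
`CoinTree`. The machine semantics of a program is computed by such a tree, `Program.tree`, and
`Refines` states that a program simulates an abstract tree computation. All loops of the program
run `n` times or a constant number of times, so a bound on the running time that is
polynomial in `n` is obtained by structural recursion on the program (`Clocked`, `cost`).
-/

/-! ### Coin-tossing trees -/

/-- A finite computation that tosses fair coins and returns an element of `α`. -/
inductive CoinTree (α : Type) : Type
  | ret (a : α)
  | flip (l r : CoinTree α)

namespace CoinTree

variable {α β γ δ : Type}

/-- Sequential composition. -/
def bind : CoinTree α → (α → CoinTree β) → CoinTree β
  | ret a, g => g a
  | flip l r, g => flip (l.bind g) (r.bind g)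

/-- The expected value of `φ` at the outcome. -/
noncomputable def expect : CoinTree α → (α → ℝ) → ℝ
  | ret a, φ => φ a
  | flip l r, φ => (l.expect φ + r.expect φ) / 2

/-- Every outcome satisfies `P`. -/
def All (P : α → Prop) : CoinTree α → Prop
  | ret a => P a
  | flip l r => l.All P ∧ r.All P

/-- The two trees toss the same number of coins, and the same tosses lead to outcomes that are
related by `R`. -/
def Refines (R : α → β → Prop) : CoinTree α → CoinTree β → Prop
  | ret a, ret b => R a b
  | flip l r, flip l' r' => Refines R l l' ∧ Refines R r r'
  | _, _ => False

/-- The distribution of the outcome. -/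
noncomputable def toPMF : CoinTree α → PMF α
  | ret a => PMF.pure a
  | flip l r => (PMF.uniformOfFintype Bool).bind fun c => cond c r.toPMF l.toPMF

@[simp] theorem ret_bind (a : α) (g : α → CoinTree β) : (ret a).bind g = g a := rfl

@[simp] theorem flip_bind (l r : CoinTree α) (g : α → CoinTree β) :
    (flip l r).bind g = flip (l.bind g) (r.bind g) := rfl

@[simp] theorem bind_ret (t : CoinTree α) : t.bind ret = t := by
  induction t with
  | ret a => rfl
  | flip l r hl hr => simp [hl, hr]

theorem bind_assoc (t : CoinTree α) (g : α → CoinTree β) (h : β → CoinTree γ) :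
    (t.bind g).bind h = t.bind fun a => (g a).bind h := by
  induction t with
  | ret a => rfl
  | flip l r hl hr => simp [hl, hr]

@[simp] theorem expect_ret (a : α) (φ : α → ℝ) : (ret a).expect φ = φ a := rfl

@[simp] theorem expect_flip (l r : CoinTree α) (φ : α → ℝ) :
    (flip l r).expect φ = (l.expect φ + r.expect φ) / 2 := rfl

theorem expect_bind (t : CoinTree α) (g : α → CoinTree β) (φ : β → ℝ) :
    (t.bind g).expect φ = t.expect fun a => (g a).expect φ := by
  induction t with
  | ret a => rfl
  | flip l r hl hr => simp [hl, hr]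

theorem expect_const (t : CoinTree α) (c : ℝ) : (t.expect fun _ => c) = c := by
  induction t with
  | ret a => rfl
  | flip l r hl hr => simp [hl, hr]

theorem expect_add (t : CoinTree α) (φ ψ : α → ℝ) :
    (t.expect fun a => φ a + ψ a) = t.expect φ + t.expect ψ := by
  induction t with
  | ret a => rfl
  | flip l r hl hr => simp only [expect_flip, hl, hr]; ring

theorem expect_mul (t : CoinTree α) (c : ℝ) (φ : α → ℝ) :
    (t.expect fun a => c * φ a) = c * t.expect φ := by
  induction t with
  | ret a => rfl
  | flip l r hl hr => simp only [expect_flip, hl, hr]; ring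

theorem expect_sub (t : CoinTree α) (φ ψ : α → ℝ) :
    (t.expect fun a => φ a - ψ a) = t.expect φ - t.expect ψ := by
  induction t with
  | ret a => rfl
  | flip l r hl hr => simp only [expect_flip, hl, hr]; ring

theorem expect_sum {ι : Type*} (t : CoinTree α) (s : Finset ι) (φ : ι → α → ℝ) :
    (t.expect fun a => ∑ i ∈ s, φ i a) = ∑ i ∈ s, t.expect (φ i) := by
  induction t with
  | ret a => rfl
  | flip l r hl hr => simp only [expect_flip, hl, hr, ← Finset.sum_add_distrib, Finset.sum_div]

theorem expect_le_of_all {t : CoinTree α} {P : α → Prop} (ht : t.All P) {φ ψ : α → ℝ}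
    (h : ∀ a, P a → φ a ≤ ψ a) : t.expect φ ≤ t.expect ψ := by
  induction t with
  | ret a => exact h a ht
  | flip l r hl hr =>
    have h1 := hl ht.1
    have h2 := hr ht.2
    simp only [expect_flip]
    linarith

theorem expect_mono (t : CoinTree α) {φ ψ : α → ℝ} (h : ∀ a, φ a ≤ ψ a) :
    t.expect φ ≤ t.expect ψ := by
  induction t with
  | ret a => exact h a
  | flip l r hl hr =>
    simp only [expect_flip]
    linarith

theorem All.mono {t : CoinTree α} {P Q : α → Prop} (ht : t.All P) (h : ∀ a, P a → Q a) :
    t.All Q := by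
  induction t with
  | ret a => exact h a ht
  | flip l r hl hr => exact ⟨hl ht.1, hr ht.2⟩

theorem all_of_forall {P : α → Prop} (h : ∀ a, P a) (t : CoinTree α) : t.All P := by
  induction t with
  | ret a => exact h a
  | flip l r hl hr => exact ⟨hl, hr⟩

theorem All.bind {t : CoinTree α} {P : α → Prop} {Q : β → Prop} {g : α → CoinTree β}
    (ht : t.All P) (h : ∀ a, P a → (g a).All Q) : (t.bind g).All Q := by
  induction t with
  | ret a => exact h a ht
  | flip l r hl hr => exact ⟨hl ht.1, hr ht.2⟩

theorem Refines.mono {R Q : α → β → Prop} {t : CoinTree α} {t' : CoinTree β} (h : Refines R t t')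
    (hRQ : ∀ a b, R a b → Q a b) : Refines Q t t' := by
  induction t generalizing t' with
  | ret a =>
    cases t' with
    | ret b => exact hRQ _ _ h
    | flip l r => exact h.elim
  | flip l r hl hr =>
    cases t' with
    | ret b => exact h.elim
    | flip l' r' => exact ⟨hl h.1, hr h.2⟩

theorem Refines.bind {R : α → β → Prop} {Q : γ → δ → Prop} {t : CoinTree α} {t' : CoinTree β}
    {g : α → CoinTree γ} {g' : β → CoinTree δ} (h : Refines R t t')
    (hg : ∀ a b, R a b → Refines Q (g a) (g' b)) : Refines Q (t.bind g) (t'.bind g') := by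
  induction t generalizing t' with
  | ret a =>
    cases t' with
    | ret b => exact hg _ _ h
    | flip l r => exact h.elim
  | flip l r hl hr =>
    cases t' with
    | ret b => exact h.elim
    | flip l' r' => exact ⟨hl h.1, hr h.2⟩

theorem Refines.and_all {R : α → β → Prop} {P : α → Prop} {t : CoinTree α} {t' : CoinTree β}
    (h : Refines R t t') (hP : t.All P) : Refines (fun a b => R a b ∧ P a) t t' := by
  induction t generalizing t' with
  | ret a =>
    cases t' with
    | ret b => exact ⟨h, hP⟩
    | flip l r => exact h.elim
  | flip l r hl hr =>
    cases t' with
    | ret b => exact h.elim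
    | flip l' r' => exact ⟨hl h.1 hP.1, hr h.2 hP.2⟩

theorem Refines.of_bind_ret {R : α → γ → Prop} {t : CoinTree α} {t' : CoinTree β} {g : β → γ}
    (h : Refines R t (t'.bind fun y => ret (g y))) : Refines (fun a y => R a (g y)) t t' := by
  induction t generalizing t' with
  | ret a =>
    cases t' with
    | ret b => exact h
    | flip l r => exact h.elim
  | flip l r hl hr =>
    cases t' with
    | ret b => exact h.elim
    | flip l' r' => exact ⟨hl h.1, hr h.2⟩

theorem Refines.all {R : α → β → Prop} {P : α → Prop} {Q : β → Prop} {t : CoinTree α}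
    {t' : CoinTree β} (h : Refines R t t') (hQ : t'.All Q) (hP : ∀ a b, R a b → Q b → P a) :
    t.All P := by
  induction t generalizing t' with
  | ret a =>
    cases t' with
    | ret b => exact hP _ _ h hQ
    | flip l r => exact h.elim
  | flip l r hl hr =>
    cases t' with
    | ret b => exact h.elim
    | flip l' r' => exact ⟨hl h.1 hQ.1, hr h.2 hQ.2⟩

theorem Refines.expect_eq {R : α → β → Prop} {t : CoinTree α} {t' : CoinTree β} (h : Refines R t t')
    {φ : α → ℝ} {ψ : β → ℝ} (hφ : ∀ a b, R a b → φ a = ψ b) : t.expect φ = t'.expect ψ := by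
  induction t generalizing t' with
  | ret a =>
    cases t' with
    | ret b => exact hφ _ _ h
    | flip l r => exact h.elim
  | flip l r hl hr =>
    cases t' with
    | ret b => exact h.elim
    | flip l' r' => simp only [expect_flip, hl h.1, hr h.2]

theorem toPMF_bind (t : CoinTree α) (g : α → CoinTree β) :
    (t.bind g).toPMF = t.toPMF.bind fun a => (g a).toPMF := by
  induction t with
  | ret a => simp [toPMF]
  | flip l r hl hr =>
    simp only [flip_bind, toPMF, hl, hr, PMF.bind_bind]
    congr 1
    funext c
    cases c <;> rfl

theorem All.of_mem_support {t : CoinTree α} {P : α → Prop} (ht : t.All P) {a : α}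
    (ha : a ∈ t.toPMF.support) : P a := by
  induction t with
  | ret b =>
    simp only [toPMF, PMF.support_pure, Set.mem_singleton_iff] at ha
    exact ha ▸ ht
  | flip l r hl hr =>
    simp only [toPMF, PMF.mem_support_bind_iff] at ha
    obtain ⟨c, -, hc⟩ := ha
    cases c
    · exact hl ht.1 hc
    · exact hr ht.2 hc

theorem sum_toPMF_map_mul [Fintype β] (t : CoinTree α) (g : α → β) (F : β → ℝ) :
    ∑ b, (t.toPMF.map g b).toReal * F b = t.expect fun a => F (g a) := by
  classical
  induction t with
  | ret a =>
    simp only [toPMF, PMF.pure_map, expect_ret, PMF.pure_apply]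
    rw [Finset.sum_eq_single (g a)] <;> simp +contextual
  | flip l r hl hr =>
    have key : ∀ b, ((flip l r).toPMF.map g b).toReal =
        ((l.toPMF.map g b).toReal + (r.toPMF.map g b).toReal) / 2 := by
      intro b
      simp only [toPMF, PMF.map_bind, PMF.bind_apply, tsum_fintype, Fintype.sum_bool,
        PMF.uniformOfFintype_apply, Fintype.card_bool, cond_true, cond_false]
      rw [ENNReal.toReal_add (ENNReal.mul_ne_top (by simp) (PMF.apply_ne_top _ _))
        (ENNReal.mul_ne_top (by simp) (PMF.apply_ne_top _ _))]
      simp only [ENNReal.toReal_mul, ENNReal.toReal_inv, Nat.cast_ofNat, ENNReal.toReal_ofNat]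
      ring
    simp only [expect_flip, ← hl, ← hr, key, ← Finset.sum_add_distrib, Finset.sum_div]
    exact Finset.sum_congr rfl fun b _ => by ring

/-- Run `step` `m` times in a row. -/
def iter (step : α → CoinTree α) : ℕ → α → CoinTree α
  | 0, a => ret a
  | m + 1, a => (step a).bind (iter step m)

theorem iter_succ' (step : α → CoinTree α) (m : ℕ) (a : α) :
    iter step (m + 1) a = (iter step m a).bind step := by
  induction m generalizing a with
  | zero => simp [iter]
  | succ m ih =>
    rw [iter, iter, bind_assoc]
    congr 1
    funext b
    exact ih b

/-- Run `A 0`, …, `A (m - 1)` in a row. -/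
def forTree (A : ℕ → α → CoinTree α) : ℕ → α → CoinTree α
  | 0, a => ret a
  | m + 1, a => (forTree A m a).bind (A m)

theorem forTree_const_mul (A : α → CoinTree α) (l m : ℕ) (a : α) :
    forTree (fun _ => forTree (fun _ => A) l) m a = forTree (fun _ => A) (m * l) a := by
  have add : ∀ p q a, forTree (fun _ => A) (p + q) a =
      (forTree (fun _ => A) p a).bind (forTree (fun _ => A) q) := by
    intro p q a
    induction q with
    | zero =>
      have : forTree (fun _ => A) 0 = ret := by funext b; rfl
      simp [this]
    | succ q ih => rw [← add_assoc, forTree, ih, bind_assoc]; rfl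
  induction m with
  | zero => simp [forTree]
  | succ m ih => rw [forTree, ih, Nat.succ_mul, add]

/-- A counted step that is skipped as soon as the counter reaches `t`. -/
def guarded (A : ℕ → α → CoinTree α) (t : ℕ) (x : ℕ × α) : CoinTree (ℕ × α) :=
  if x.1 < t then (A x.1 x.2).bind fun y => ret (x.1 + 1, y) else ret x

theorem forTree_guarded (A : ℕ → α → CoinTree α) (t N : ℕ) (a : α) :
    forTree (fun _ => guarded A t) N (0, a) =
      (forTree A (min N t) a).bind fun y => ret (min N t, y) := by
  induction N with
  | zero => simp [forTree]
  | succ N ih =>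
    rw [forTree, ih, bind_assoc]
    by_cases h : N < t
    · have h1 : min N t = N := by omega
      have h2 : min (N + 1) t = N + 1 := by omega
      simp [h1, guarded, h, forTree, bind_assoc]
    · have h1 : min N t = t := by omega
      have h2 : min (N + 1) t = t := by omega
      simp [h1, h2, guarded]

theorem refines_iter {R : ℕ → α → β → Prop} {step : α → CoinTree α} {A : ℕ → β → CoinTree β} {m : ℕ}
    {s : α} {x : β} (h0 : R 0 s x)
    (h : ∀ j < m, ∀ s x, R j s x → Refines (R (j + 1)) (step s) (A j x)) :
    Refines (R m) (iter step m s) (forTree A m x) := by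
  induction m with
  | zero => exact h0
  | succ m ih =>
    rw [iter_succ', forTree]
    exact (ih fun j hj => h j (by omega)).bind (h m (by omega))

theorem all_iter {P : ℕ → α → Prop} {step : α → CoinTree α} {m : ℕ} {s : α} (h0 : P 0 s)
    (h : ∀ j < m, ∀ s, P j s → (step s).All (P (j + 1))) : (iter step m s).All (P m) := by
  induction m with
  | zero => exact h0
  | succ m ih =>
    rw [iter_succ']
    exact (ih fun j hj => h j (by omega)).bind (h m (by omega))

theorem all_forTree {P : ℕ → α → Prop} {A : ℕ → α → CoinTree α} {m : ℕ} {s : α} (h0 : P 0 s)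
    (h : ∀ j < m, ∀ s, P j s → (A j s).All (P (j + 1))) : (forTree A m s).All (P m) := by
  induction m with
  | zero => exact h0
  | succ m ih => exact (ih fun j hj => h j (by omega)).bind (h m (by omega))

end CoinTree

/-! ### Programs as coin-tossing trees -/

open Classical in
/-- The tree of all runs of a program. -/
noncomputable def Program.tree {n : ℕ} (f : Finset (Fin n) → ℝ) :
    Program → MachineState → CoinTree MachineState
  | skip, s => .ret s.tick
  | setNat a i e, s => .ret (s.tick.writeNat a (i.eval s) (e.eval s))
  | setReal a i e, s => .ret (s.tick.writeReal a (i.eval s) (e.eval s))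
  | query a i b, s => .ret (s.tick.writeReal a (i.eval s) (f (s.readSet n b)))
  | flip a i, s =>
      .flip (.ret (s.tick.writeNat a (i.eval s) 0)) (.ret (s.tick.writeNat a (i.eval s) 1))
  | seq p q, s => (p.tree f s).bind (q.tree f)
  | ite b p q, s => if b.Holds s then p.tree f s.tick else q.tree f s.tick
  | loop e p, s => CoinTree.iter (fun s => p.tree f s.tick) (e.eval s) s.tick

theorem Program.run_eq_toPMF_tree {n : ℕ} (f : Finset (Fin n) → ℝ) (p : Program)
    (s : MachineState) : p.run f s = (p.tree f s).toPMF := by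
  induction p generalizing s with
  | skip => rfl
  | setNat a i e => rfl
  | setReal a i e => rfl
  | query a i b => rfl
  | flip a i =>
    simp only [run, tree, CoinTree.toPMF]
    congr 1
    funext c
    cases c <;> rfl
  | seq p q hp hq =>
    simp only [run, tree, CoinTree.toPMF_bind, hp]
    congr 1
    funext s
    exact hq s
  | ite b p q hp hq =>
    simp only [run, tree]
    split_ifs
    · exact hp _
    · exact hq _
  | loop e p hp =>
    have key : ∀ m s, iterateRun (p.run f) m s =
        (CoinTree.iter (fun s => p.tree f s.tick) m s).toPMF := by
      intro m
      induction m with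
      | zero => intro s; rfl
      | succ m ih =>
        intro s
        simp only [iterateRun, CoinTree.iter, CoinTree.toPMF_bind, hp]
        congr 1
        funext s
        exact ih s
    exact key _ _

namespace Program

/-- Whether the program contains an instruction that writes to the natural array `a`. -/
def writesNat (a : ℕ) : Program → Bool
  | setNat b _ _ => b == a
  | flip b _ => b == a
  | seq p q => p.writesNat a || q.writesNat a
  | ite _ p q => p.writesNat a || q.writesNat a
  | loop _ p => p.writesNat a
  | _ => false

/-- Whether the program contains an instruction that writes to the real array `a`. -/
def writesReal (a : ℕ) : Program → Bool
  | setReal b _ _ => b == a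
  | query b _ _ => b == a
  | seq p q => p.writesReal a || q.writesReal a
  | ite _ p q => p.writesReal a || q.writesReal a
  | loop _ p => p.writesReal a
  | _ => false

/-- `s'` differs from `s` at most in the arrays to which `p` writes. -/
def Frame (p : Program) (s s' : MachineState) : Prop :=
  (∀ a, p.writesNat a = false → s'.nat a = s.nat a) ∧
    ∀ a, p.writesReal a = false → s'.real a = s.real a

theorem Frame.refl (p : Program) (s : MachineState) : p.Frame s s :=
  ⟨fun _ _ => rfl, fun _ _ => rfl⟩

theorem Frame.trans {p : Program} {s s' s'' : MachineState} (h : p.Frame s s')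
    (h' : p.Frame s' s'') : p.Frame s s'' :=
  ⟨fun a ha => (h'.1 a ha).trans (h.1 a ha), fun a ha => (h'.2 a ha).trans (h.2 a ha)⟩

theorem all_frame {n : ℕ} (f : Finset (Fin n) → ℝ) (p : Program) (s : MachineState) :
    (p.tree f s).All (p.Frame s) := by
  induction p generalizing s with
  | skip => exact ⟨fun a _ => rfl, fun _ _ => rfl⟩
  | setNat a i e =>
    refine ⟨fun c hc => ?_, fun _ _ => rfl⟩
    have : c ≠ a := by rintro rfl; simp [writesNat] at hc
    simp [MachineState.writeNat, MachineState.tick, this]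
  | setReal a i e =>
    refine ⟨fun _ _ => rfl, fun c hc => ?_⟩
    have : c ≠ a := by rintro rfl; simp [writesReal] at hc
    simp [MachineState.writeReal, MachineState.tick, this]
  | query a i b =>
    refine ⟨fun _ _ => rfl, fun c hc => ?_⟩
    have : c ≠ a := by rintro rfl; simp [writesReal] at hc
    simp [MachineState.writeReal, MachineState.tick, this]
  | flip a i =>
    constructor <;>
    · refine ⟨fun c hc => ?_, fun _ _ => rfl⟩
      have : c ≠ a := by rintro rfl; simp [writesNat] at hc
      simp [MachineState.writeNat, MachineState.tick, this]
  | seq p q hp hq =>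
    refine (hp s).bind fun s' h => (hq s').mono fun s'' h' => ?_
    constructor
    · intro a ha
      simp only [writesNat, Bool.or_eq_false_iff] at ha
      rw [h'.1 a ha.2, h.1 a ha.1]
    · intro a ha
      simp only [writesReal, Bool.or_eq_false_iff] at ha
      rw [h'.2 a ha.2, h.2 a ha.1]
  | ite b p q hp hq =>
    simp only [tree]
    split_ifs
    · refine (hp s.tick).mono fun s' h => ⟨fun a ha => ?_, fun a ha => ?_⟩
      · simp only [writesNat, Bool.or_eq_false_iff] at ha
        exact h.1 a ha.1
      · simp only [writesReal, Bool.or_eq_false_iff] at ha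
        exact h.2 a ha.1
    · refine (hq s.tick).mono fun s' h => ⟨fun a ha => ?_, fun a ha => ?_⟩
      · simp only [writesNat, Bool.or_eq_false_iff] at ha
        exact h.1 a ha.2
      · simp only [writesReal, Bool.or_eq_false_iff] at ha
        exact h.2 a ha.2
  | loop e p hp =>
    refine CoinTree.all_iter (P := fun _ s' => (loop e p).Frame s s')
      ⟨fun _ _ => rfl, fun _ _ => rfl⟩ fun j _ s' h => (hp s'.tick).mono fun s'' h' => ?_
    exact h.trans h'

/-- All loops of the program run a constant number of times or `n` times, and the cell that holds
`n` is never overwritten. -/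
def Clocked : Program → Bool
  | setNat b _ _ => b != 0
  | flip b _ => b != 0
  | seq p q => p.Clocked && q.Clocked
  | ite _ p q => p.Clocked && q.Clocked
  | loop (.lit _) p => p.Clocked
  | loop (.cell 0 (.lit 0)) p => p.Clocked
  | loop _ _ => false
  | _ => true

/-- A polynomial in `n` that bounds the number of steps of a clocked program. -/
noncomputable def cost : Program → Polynomial ℕ
  | seq p q => p.cost + q.cost
  | ite _ p q => 1 + (p.cost + q.cost)
  | loop (.lit c) p => 1 + Polynomial.C c * (1 + p.cost)
  | loop _ p => 1 + Polynomial.X * (1 + p.cost)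
  | _ => 1

theorem iter_time_le {n : ℕ} (f : Finset (Fin n) → ℝ) (p : Program) (c m : ℕ)
    (hp : ∀ s : MachineState, s.nat 0 0 = n →
      (p.tree f s).All fun s' => s'.nat 0 0 = n ∧ s'.time ≤ s.time + c)
    (s : MachineState) (hs : s.nat 0 0 = n) :
    (CoinTree.iter (fun s => p.tree f s.tick) m s.tick).All fun s' =>
      s'.nat 0 0 = n ∧ s'.time ≤ s.time + (1 + m * (1 + c)) := by
  refine CoinTree.all_iter
    (P := fun j (s' : MachineState) => s'.nat 0 0 = n ∧ s'.time ≤ s.time + (1 + j * (1 + c))) ?_ ?_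
  · exact ⟨hs, by simp [MachineState.tick]⟩
  · intro j _ s' h
    refine (hp s'.tick h.1).mono fun s'' h'' => ⟨h''.1, h''.2.trans ?_⟩
    have := h.2
    simp only [MachineState.tick]
    nlinarith

theorem time_le {n : ℕ} (f : Finset (Fin n) → ℝ) (p : Program) (h : p.Clocked = true)
    (s : MachineState) (hs : s.nat 0 0 = n) :
    (p.tree f s).All fun s' => s'.nat 0 0 = n ∧ s'.time ≤ s.time + p.cost.eval n := by
  induction p generalizing s with
  | skip => exact ⟨hs, by simp [MachineState.tick, cost]⟩
  | setNat a i e =>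
    have : (0 : ℕ) ≠ a := by rintro rfl; simp [Clocked] at h
    exact ⟨by simp [MachineState.writeNat, MachineState.tick, this, hs],
      by simp [MachineState.writeNat, MachineState.tick, cost]⟩
  | setReal a i e => exact ⟨hs, by simp [MachineState.writeReal, MachineState.tick, cost]⟩
  | query a i b => exact ⟨hs, by simp [MachineState.writeReal, MachineState.tick, cost]⟩
  | flip a i =>
    have : (0 : ℕ) ≠ a := by rintro rfl; simp [Clocked] at h
    constructor <;>
    exact ⟨by simp [MachineState.writeNat, MachineState.tick, this, hs],
      by simp [MachineState.writeNat, MachineState.tick, cost]⟩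
  | seq p q hp hq =>
    simp only [Clocked, Bool.and_eq_true] at h
    refine (hp h.1 s hs).bind fun s' h' => (hq h.2 s' h'.1).mono fun s'' h'' => ⟨h''.1, ?_⟩
    have h1 := h'.2
    have h2 := h''.2
    simp only [cost, Polynomial.eval_add]
    omega
  | ite b p q hp hq =>
    simp only [Clocked, Bool.and_eq_true] at h
    simp only [tree]
    split_ifs
    · refine (hp h.1 s.tick hs).mono fun s'' h'' => ⟨h''.1, h''.2.trans ?_⟩
      simp only [cost, Polynomial.eval_add, MachineState.tick, Polynomial.eval_one]
      omega
    · refine (hq h.2 s.tick hs).mono fun s'' h'' => ⟨h''.1, h''.2.trans ?_⟩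
      simp only [cost, Polynomial.eval_add, MachineState.tick, Polynomial.eval_one]
      omega
  | loop e p hp =>
    simp only [tree]
    match e, h with
    | .lit c, h =>
      refine (iter_time_le f p (p.cost.eval n) c (hp h) s hs).mono fun s' h' => ⟨h'.1, ?_⟩
      simpa [cost] using h'.2
    | .cell 0 (.lit 0), h =>
      have e1 : (NatExpr.cell 0 (.lit 0)).eval s = n := hs
      rw [e1]
      refine (iter_time_le f p (p.cost.eval n) n (hp h) s hs).mono fun s' h' => ⟨h'.1, ?_⟩
      simpa [cost] using h'.2

theorem time_le_of_mem_support {n : ℕ} (f : Finset (Fin n) → ℝ) (k : ℕ) {p : Program}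
    (h : p.Clocked = true) {s : MachineState} (hs : s ∈ (p.finalState f k).support) :
    s.time ≤ p.cost.eval n := by
  rw [finalState, run_eq_toPMF_tree] at hs
  have := (p.time_le f h (MachineState.initial n k)
      (by simp [MachineState.initial])).of_mem_support hs
  simpa [MachineState.initial] using this.2

theorem expectedValue_eq {n : ℕ} (f : Finset (Fin n) → ℝ) (k : ℕ) (p : Program) :
    p.expectedValue f k =
      (p.tree f (MachineState.initial n k)).expect fun s => f (s.readSet n 2) := by
  rw [expectedValue, output, finalState, run_eq_toPMF_tree]
  exact CoinTree.sum_toPMF_map_mul _ _ _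

end Program

open CoinTree

/-! ### The program -/

namespace CardinalityMax

/-- The scalar variable `a`: cell `0` of the natural array `a`. -/
abbrev var (a : ℕ) : NatExpr := .cell a (.lit 0)

/-- The cell of the natural array `a` at the address given by the variable `i`. -/
abbrev entry (a i : ℕ) : NatExpr := .cell a (var i)

/-- Assignment to a scalar variable. -/
def put (a : ℕ) (e : NatExpr) : Program := .setNat a (.lit 0) e

/-- One-armed conditional. -/
def whenever (b : TestExpr) (p : Program) : Program := .ite b p .skip

/-- Run `p` with the variable `i` counting from `0` to `n - 1`. -/
def forEach (i : ℕ) (p : Program) : Program :=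
  .seq (put i (.lit 0)) (.loop (var 0) (.seq p (put i (.add (var i) (.lit 1)))))

/-- Run `p` exactly `n ^ d` times. -/
def powLoop : ℕ → Program → Program
  | 0, p => p
  | d + 1, p => .loop (var 0) (powLoop d p)

/-- Variable `11` becomes `1` with probability `2 ^ (-b)`, and `0` otherwise, where `b` is the
variable `4`. -/
def bernoulli : Program :=
  .seq (put 11 (.lit 1)) (forEach 17 (whenever (.natLe (.add (var 17) (.lit 1)) (var 4))
    (.seq (.flip 12 (.lit 0)) (whenever (.natLe (var 12) (.lit 0)) (put 11 (.lit 0))))))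

/-- Process the entry number `j` (variable `10`) of the history: with probability `2 ^ (-b)` run
`hit`. -/
def touchStep (hit : Program) : Program :=
  .seq bernoulli (.seq (whenever (.natLe (.lit 1) (var 11)) hit)
    (put 10 (.add (var 10) (.lit 1))))

/-- The array `8` becomes the empty set; then every element of the history (array `7`, length in
variable `6`) is processed. -/
def sample (hit : Program) : Program :=
  .seq (forEach 9 (.setNat 8 (var 9) (.lit 0))) (.seq (put 10 (.lit 0))
    (.loop (.lit 4) (powLoop 2
      (whenever (.natLe (.add (var 10) (.lit 1)) (var 6)) (touchStep hit)))))

/-- The membership of the current element of the history becomes a fair coin. -/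
def hitCoin : Program := .flip 8 (entry 7 10)

/-- The current element of the history becomes a member. -/
def hitInsert : Program := .setNat 8 (entry 7 10) (.lit 1)

/-- Toggle the membership of the element in variable `9`. -/
def toggleBit : Program := .setNat 8 (var 9) (.sub (.lit 1) (entry 8 9))

/-- Add `f (S ∆ {u}) - f S` to the cell `u` of the real array `0`, for every `u`. -/
def accumulate : Program :=
  .seq (.query 1 (.lit 0) 8) (forEach 9 (.seq toggleBit (.seq (.query 2 (.lit 0) 8)
    (.seq (.setReal 0 (var 9) (.add (.cell 0 (var 9)) (.sub (.cell 2 (.lit 0)) (.cell 1 (.lit 0)))))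
      toggleBit))))

/-- Variable `13` becomes a position of a maximum of the real array `0`. -/
def findMax : Program :=
  .seq (put 13 (.lit 0)) (forEach 9
    (whenever (.realLe (.cell 0 (var 13)) (.cell 0 (var 9))) (put 13 (var 9))))

/-- Append to the history an element whose estimated effect is largest. The sum over
`n ^ 8` samples makes the standard deviation of the mean effect `O(f_max / n ^ 4)`. -/
def extendHistory : Program :=
  .seq (forEach 9 (.setReal 0 (var 9) (.ofNat (.lit 0))))
    (.seq (powLoop 8 (.seq (sample hitCoin) accumulate))
      (.seq findMax (.seq (.setNat 7 (var 6) (var 13)) (put 6 (.add (var 6) (.lit 1))))))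

/-- Extend the history until its length reaches the limit in the real array `3`. The limit
is at most `4 * n ^ 2`, so that a clocked loop of this length suffices. -/
def buildHistory : Program :=
  .loop (.lit 4) (powLoop 2
    (whenever (.not (.realLe (.cell 3 (.lit 0)) (.ofNat (var 6)))) extendHistory))

/-- Variable `14` becomes the cardinality of the set in the array `8`. -/
def count : Program :=
  .seq (put 14 (.lit 0)) (forEach 17 (put 14 (.add (var 14) (entry 8 17))))

/-- Add elements to the set in the array `8` as long as it has fewer than twice as many elements as
required. -/
def fill : Program :=
  forEach 9 (.seq count (whenever (.natLe (.add (var 14) (.lit 1)) (.add (var 3) (var 3)))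
    (.setNat 8 (var 9) (.lit 1))))

/-- Group the elements of the set in the array `8` into consecutive pairs and keep one random
element of each pair. -/
def choosePairs : Program :=
  .seq (put 15 (.lit 0)) (forEach 9 (whenever (.natLe (.lit 1) (entry 8 9))
    (.ite (.natLe (var 15) (.lit 0))
      (.seq (.flip 12 (.lit 0)) (.seq (put 15 (.lit 1)) (.setNat 8 (var 9) (var 12))))
      (.seq (put 15 (.lit 0)) (.setNat 8 (var 9) (.sub (.lit 1) (var 12)))))))

/-- The cell `u` of the real array `0` becomes `f (S \ {u})` for the members `u` of `S`, and `-1`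
for the other elements. -/
def removalValues : Program :=
  forEach 9 (.ite (.natLe (.lit 1) (entry 8 9))
    (.seq (.setNat 8 (var 9) (.lit 0)) (.seq (.query 0 (var 9) 8) (.setNat 8 (var 9) (.lit 1))))
    (.setReal 0 (var 9) (.sub (.ofNat (.lit 0)) (.ofNat (.lit 1)))))

/-- Remove elements greedily from the set in the array `8` until it has the required cardinality. -/
def trim : Program :=
  .loop (var 0) (.seq count (whenever (.natLe (.add (var 3) (.lit 1)) (var 14))
    (.seq removalValues (.seq findMax (.setNat 8 (var 13) (.lit 0))))))

/-- Write the result to the array `2`, complemented if the variable `16` is set. -/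
def writeOutput : Program :=
  forEach 9 (.ite (.natLe (.lit 1) (var 16))
    (.setNat 2 (var 9) (.sub (.lit 1) (entry 8 9))) (.setNat 2 (var 9) (entry 8 9)))

/-- The required cardinality `k` or `n - k`, whichever is smaller, goes to variable `3`. -/
def chooseSide : Program :=
  .ite (.natLe (.add (var 1) (var 1)) (var 0)) (.seq (put 3 (var 1)) (put 16 (.lit 0)))
    (.seq (put 3 (.sub (var 0) (var 1))) (put 16 (.lit 1)))

/-- Variable `5` becomes a power of two, `2 ^ b` with `b` in variable `4`, that is at least `n`. -/
def findScale : Program :=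
  .seq (put 4 (.lit 0)) (.seq (put 5 (.lit 1))
    (forEach 9 (whenever (.natLe (.add (var 5) (.lit 1)) (var 0))
      (.seq (put 5 (.add (var 5) (var 5))) (put 4 (.add (var 4) (.lit 1)))))))

/-- Twice the required cardinality, as a real number. -/
def twiceCard : RealExpr := .ofNat (.add (var 3) (var 3))

/-- Choose the probability `2 ^ (-b)` and the limit for the length of the history. -/
def chooseLimit : Program :=
  .ite (.realLe (.ofNat (var 0)) (.mul twiceCard (.ofNat (var 3))))
    (.seq findScale (.setReal 3 (.lit 0) (.div (.mul (.ofNat (var 5))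
      (.mul twiceCard (.ofNat (.add (var 0) (var 3))))) (.ofNat (var 0)))))
    (.seq (put 4 (.lit 0)) (.setReal 3 (.lit 0) twiceCard))

/-- The randomized algorithm. -/
def algorithm : Program :=
  .seq chooseSide (.seq chooseLimit (.seq buildHistory (.seq (sample hitInsert)
    (.seq fill (.seq choosePairs (.seq trim writeOutput))))))

theorem algorithm_clocked : algorithm.Clocked = true := rfl

end CardinalityMax

/-! ### Rules for reasoning about programs -/

namespace MachineState

@[simp] theorem tick_nat (s : MachineState) : s.tick.nat = s.nat := rfl

@[simp] theorem tick_real (s : MachineState) : s.tick.real = s.real := rfl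

@[simp] theorem writeNat_real (s : MachineState) (a i v : ℕ) :
    (s.writeNat a i v).real = s.real := rfl

@[simp] theorem writeReal_nat (s : MachineState) (a i : ℕ) (v : ℝ) :
    (s.writeReal a i v).nat = s.nat := rfl

@[simp] theorem writeNat_nat (s : MachineState) (a i v c : ℕ) :
    (s.writeNat a i v).nat c = if c = a then Function.update (s.nat a) i v else s.nat c := by
  by_cases h : c = a
  · subst h; simp [writeNat]
  · simp [writeNat, h]

@[simp] theorem writeReal_real (s : MachineState) (a i c : ℕ) (v : ℝ) :
    (s.writeReal a i v).real c = if c = a then Function.update (s.real a) i v else s.real c := by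
  by_cases h : c = a
  · subst h; simp [writeReal]
  · simp [writeReal, h]

end MachineState

namespace CoinTree

variable {α β γ : Type}

/-- The tree tosses no coins, and its outcome satisfies `Q`. -/
def Det (t : CoinTree α) (Q : α → Prop) : Prop :=
  Refines (fun a (_ : Unit) => Q a) t (ret ())

@[simp] theorem det_ret (a : α) (Q : α → Prop) : (ret a).Det Q ↔ Q a := Iff.rfl

theorem Det.refines_bind {t : CoinTree α} {Q : α → Prop} {R : β → γ → Prop} {g : α → CoinTree β}
    {t' : CoinTree γ} (h : t.Det Q) (hg : ∀ a, Q a → Refines R (g a) t') :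
    Refines R (t.bind g) t' :=
  Refines.bind (g' := fun _ => t') h fun a _ ha => hg a ha

theorem Det.bind {t : CoinTree α} {Q : α → Prop} {P : β → Prop} {g : α → CoinTree β}
    (h : t.Det Q) (hg : ∀ a, Q a → (g a).Det P) : (t.bind g).Det P :=
  h.refines_bind hg

theorem Det.mono {t : CoinTree α} {P Q : α → Prop} (h : t.Det P) (hPQ : ∀ a, P a → Q a) :
    t.Det Q :=
  Refines.mono h fun a _ => hPQ a

theorem Det.refines_ret {t : CoinTree α} {Q : α → Prop} {R : α → β → Prop} {b : β} (h : t.Det Q)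
    (hQ : ∀ a, Q a → R a b) : Refines R t (ret b) := by
  rw [← bind_ret t]
  exact h.refines_bind hQ

theorem Det.and_all {t : CoinTree α} {P Q : α → Prop} (h : t.Det P) (hQ : t.All Q) :
    t.Det fun a => P a ∧ Q a :=
  Refines.and_all h hQ

theorem forTree_ret (m : ℕ) (x : α) : forTree (fun _ a => ret a) m x = ret x := by
  induction m with
  | zero => rfl
  | succ m ih => rw [forTree, ih]; rfl

theorem forTree_congr {A B : ℕ → α → CoinTree α} {m : ℕ} (h : ∀ j < m, A j = B j) (x : α) :
    forTree A m x = forTree B m x := by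
  induction m with
  | zero => rfl
  | succ m ih => rw [forTree, forTree, ih fun j hj => h j (by omega), h m (by omega)]

end CoinTree

namespace CardinalityMax

open Program MachineState

variable {n : ℕ} (f : Finset (Fin n) → ℝ) {β : Type}

@[simp] theorem tree_seq (p q : Program) (s : MachineState) :
    (Program.seq p q).tree f s = (p.tree f s).bind (q.tree f) := rfl

@[simp] theorem tree_put (a : ℕ) (e : NatExpr) (s : MachineState) :
    (put a e).tree f s = .ret (s.tick.writeNat a 0 (e.eval s)) := rfl

@[simp] theorem tree_setNat (a : ℕ) (i e : NatExpr) (s : MachineState) :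
    (Program.setNat a i e).tree f s = .ret (s.tick.writeNat a (i.eval s) (e.eval s)) := rfl

@[simp] theorem tree_setReal (a : ℕ) (i : NatExpr) (e : RealExpr) (s : MachineState) :
    (Program.setReal a i e).tree f s = .ret (s.tick.writeReal a (i.eval s) (e.eval s)) := rfl

@[simp] theorem tree_query (a : ℕ) (i : NatExpr) (b : ℕ) (s : MachineState) :
    (Program.query a i b).tree f s =
      .ret (s.tick.writeReal a (i.eval s) (f (s.readSet n b))) := rfl

@[simp] theorem tree_flip (a : ℕ) (i : NatExpr) (s : MachineState) :
    (Program.flip a i).tree f s = .flip (.ret (s.tick.writeNat a (i.eval s) 0))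
      (.ret (s.tick.writeNat a (i.eval s) 1)) := rfl

theorem tree_ite_pos {b : TestExpr} (p q : Program) {s : MachineState} (h : b.Holds s) :
    (Program.ite b p q).tree f s = p.tree f s.tick := by simp [Program.tree, h]

theorem tree_ite_neg {b : TestExpr} (p q : Program) {s : MachineState} (h : ¬ b.Holds s) :
    (Program.ite b p q).tree f s = q.tree f s.tick := by simp [Program.tree, h]

theorem tree_whenever_pos {b : TestExpr} (p : Program) {s : MachineState} (h : b.Holds s) :
    (whenever b p).tree f s = p.tree f s.tick := tree_ite_pos f p _ h

theorem tree_whenever_neg {b : TestExpr} (p : Program) {s : MachineState} (h : ¬ b.Holds s) :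
    (whenever b p).tree f s = .ret s.tick.tick := tree_ite_neg f p _ h

/-- A property of states and abstract states that ignores the clock and the array `i`. -/
def Ignores (i : ℕ) (R : MachineState → β → Prop) : Prop :=
  ∀ s s' y, (∀ a, a ≠ i → s'.nat a = s.nat a) → s'.real = s.real → R s y → R s' y

/-- Invariant rule for counting loops. -/
theorem refines_forEach {i : ℕ} {p : Program} {R : ℕ → MachineState → β → Prop}
    {A : ℕ → β → CoinTree β} {s₀ : MachineState} {x : β} (hn : s₀.nat 0 0 = n)
    (hi : p.writesNat i = false) (hi0 : i ≠ 0)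
    (hR : ∀ j, Ignores i (R j)) (h0 : R 0 s₀ x)
    (hp : ∀ j < n, ∀ s y, (forEach i p).Frame s₀ s → s.nat i 0 = j → R j s y →
      Refines (R (j + 1)) (p.tree f s) (A j y)) :
    Refines (fun s y => R n s y ∧ (forEach i p).Frame s₀ s) ((forEach i p).tree f s₀)
      (forTree A n x) := by
  refine Refines.and_all ?_ (all_frame f _ _)
  have hF : (forEach i p).Frame s₀ (s₀.tick.writeNat i 0 0).tick := by
    refine ⟨fun a ha => ?_, fun a _ => rfl⟩
    have : a ≠ i := by rintro rfl; simp [forEach, put, writesNat] at ha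
    simp [this]
  rw [forEach, tree_seq, tree_put, ret_bind]
  simp only [Program.tree]
  have e : (var 0).eval (s₀.tick.writeNat i 0 ((NatExpr.lit 0).eval s₀)) = n := by
    simp [NatExpr.eval, hi0.symm, hn]
  rw [e]
  refine Refines.mono (refines_iter
      (R := fun j s y => (forEach i p).Frame s₀ s ∧ s.nat i 0 = j ∧ R j s y)
    ⟨hF, by simp [NatExpr.eval], hR 0 s₀ _ _ (fun a ha => by simp [ha]) rfl h0⟩ ?_)
    fun _ _ h => h.2.2
  rintro j hj s y ⟨hs, hsi, hRs⟩
  have h1 := (hp j hj s.tick y hs hsi (hR j s _ _ (fun _ _ => rfl) rfl hRs)).and_all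
    (all_frame f p s.tick)
  rw [← bind_ret (A j y)]
  refine h1.bind fun s' y' h' => ?_
  have hi' : s'.nat i = s.nat i := h'.2.1 i hi
  refine ⟨?_, ?_, hR _ s' _ _ (fun a ha => by simp [ha]) rfl h'.1⟩
  · refine hs.trans ⟨fun a ha => ?_, fun a ha => ?_⟩
    · have hai : a ≠ i := by rintro rfl; simp [forEach, put, writesNat] at ha
      have : p.writesNat a = false := by simp [forEach, put, writesNat] at ha; exact ha.2.1
      simp [hai, h'.2.1 a this]
    · have : p.writesReal a = false := by simpa [forEach, put, writesReal] using ha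
      simp [h'.2.2 a this]
  · simp [NatExpr.eval, hi', hsi]

/-- Invariant rule for counting loops without coin tosses. -/
theorem det_forEach {i : ℕ} {p : Program} {R : ℕ → MachineState → Prop}
    {s₀ : MachineState} (hn : s₀.nat 0 0 = n)
    (hi : p.writesNat i = false) (hi0 : i ≠ 0)
    (hR : ∀ j s s', (∀ a, a ≠ i → s'.nat a = s.nat a) → s'.real = s.real → R j s → R j s')
    (h0 : R 0 s₀)
    (hp : ∀ j < n, ∀ s, (forEach i p).Frame s₀ s → s.nat i 0 = j → R j s →
      (p.tree f s).Det (R (j + 1))) :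
    ((forEach i p).tree f s₀).Det fun s => R n s ∧ (forEach i p).Frame s₀ s := by
  have h := refines_forEach f (β := Unit) (A := fun _ y => ret y) (x := ())
    (R := fun j s _ => R j s) hn hi hi0 (fun j s s' _ => hR j s s') h0
    (fun j hj s _ hF hs hRs => hp j hj s hF hs hRs)
  rwa [forTree_ret] at h

theorem writesNat_powLoop (d : ℕ) (p : Program) (a : ℕ) :
    (powLoop d p).writesNat a = p.writesNat a := by
  induction d with
  | zero => rfl
  | succ d ih => exact ih

theorem writesReal_powLoop (d : ℕ) (p : Program) (a : ℕ) :
    (powLoop d p).writesReal a = p.writesReal a := by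
  induction d with
  | zero => rfl
  | succ d ih => exact ih

/-- Invariant rule for loops of `n ^ d` iterations. -/
theorem refines_powLoop {p : Program} {R : MachineState → β → Prop} {A : β → CoinTree β}
    {s₀ : MachineState} (h0n : p.writesNat 0 = false) (hn : s₀.nat 0 0 = n)
    (hR : ∀ s y, R s y → R s.tick y)
    (hp : ∀ s y, p.Frame s₀ s → R s y → Refines R (p.tree f s) (A y)) (d : ℕ) :
    ∀ s y, p.Frame s₀ s → R s y →
      Refines R ((powLoop d p).tree f s) (forTree (fun _ => A) (n ^ d) y) := by
  induction d with
  | zero => intro s y hF h; simpa [powLoop, forTree] using hp s y hF h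
  | succ d ih =>
    intro s y hF h
    rw [pow_succ', ← forTree_const_mul]
    have e : (var 0).eval s = n := by
      simp only [NatExpr.eval]; rw [hF.1 0 h0n]; exact hn
    simp only [powLoop, Program.tree]
    rw [e]
    refine Refines.mono (refines_iter (R := fun _ s y => p.Frame s₀ s ∧ R s y) ⟨hF, hR _ _ h⟩ ?_)
      fun _ _ h => h.2
    rintro j - s y ⟨hF, h⟩
    refine Refines.mono ((ih s.tick y hF (hR _ _ h)).and_all (all_frame f _ _))
      fun s' y' h' => ⟨?_, h'.1⟩
    exact hF.trans ⟨fun a ha => h'.2.1 a (by rw [writesNat_powLoop]; exact ha),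
      fun a ha => h'.2.2 a (by rw [writesReal_powLoop]; exact ha)⟩

/-- Invariant rule for loops of `c * n ^ d` iterations. -/
theorem refines_litLoop {p : Program} {R : MachineState → β → Prop} {A : β → CoinTree β}
    {s₀ : MachineState} (h0n : p.writesNat 0 = false) (hn : s₀.nat 0 0 = n)
    (hR : ∀ s y, R s y → R s.tick y)
    (hp : ∀ s y, p.Frame s₀ s → R s y → Refines R (p.tree f s) (A y)) (c d : ℕ) {y : β}
    (h : R s₀ y) :
    Refines R ((Program.loop (.lit c) (powLoop d p)).tree f s₀)
      (forTree (fun _ => A) (c * n ^ d) y) := by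
  rw [← forTree_const_mul]
  simp only [Program.tree, NatExpr.eval]
  refine Refines.mono (refines_iter (R := fun _ s y => p.Frame s₀ s ∧ R s y)
    ⟨Frame.refl p s₀, hR _ _ h⟩ ?_) fun _ _ h => h.2
  rintro j - s y ⟨hF, h⟩
  refine Refines.mono ((refines_powLoop f h0n hn hR hp d s.tick y hF (hR _ _ h)).and_all
    (all_frame f _ _)) fun s' y' h' => ⟨?_, h'.1⟩
  exact hF.trans ⟨fun a ha => h'.2.1 a (by rw [writesNat_powLoop]; exact ha),
    fun a ha => h'.2.2 a (by rw [writesReal_powLoop]; exact ha)⟩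

end CardinalityMax

namespace CardinalityMax

open Program MachineState

/-! ### Sampling -/

/-- The array `8` holds the characteristic vector of `S`. -/
def Bits {n : ℕ} (s : MachineState) (S : Finset (Fin n)) : Prop :=
  ∀ u : Fin n, s.nat 8 u = if u ∈ S then 1 else 0

variable {n : ℕ} (f : Finset (Fin n) → ℝ)

theorem Bits.readSet_eq {s : MachineState} {S : Finset (Fin n)} (h : Bits s S) :
    s.readSet n 8 = S := by
  ext u
  simp [readSet, h u]

theorem Bits.congr {s s' : MachineState} {S : Finset (Fin n)} (h : Bits s S)
    (h8 : s'.nat 8 = s.nat 8) : Bits s' S := by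
  intro u
  rw [h8]
  exact h u

theorem Bits.insert {s s' : MachineState} {S : Finset (Fin n)} (h : Bits s S) (u : Fin n)
    (h8 : s'.nat 8 = Function.update (s.nat 8) u 1) : Bits s' (insert u S) := by
  intro v
  rw [h8, Function.update_apply]
  by_cases hv : v = u
  · simp [hv]
  · have : (v : ℕ) ≠ u := fun h => hv (Fin.ext h)
    simp [hv, this, h v]

theorem Bits.erase {s s' : MachineState} {S : Finset (Fin n)} (h : Bits s S) (u : Fin n)
    (h8 : s'.nat 8 = Function.update (s.nat 8) u 0) : Bits s' (S.erase u) := by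
  intro v
  rw [h8, Function.update_apply]
  by_cases hv : v = u
  · simp [hv]
  · have : (v : ℕ) ≠ u := fun h => hv (Fin.ext h)
    simp [hv, this, h v]

/-- The outcome is `true` if the first `b` of `n` coins show heads. -/
def bernoulliTree (n b : ℕ) : CoinTree Bool :=
  forTree (fun i x => if i < b then flip (ret false) (ret x) else ret x) n true

/-- Apply `hit u` with probability `2 ^ (-b)`. -/
def touch (hit : Fin n → Finset (Fin n) → CoinTree (Finset (Fin n))) (b : ℕ) (u : Fin n)
    (S : Finset (Fin n)) : CoinTree (Finset (Fin n)) :=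
  (bernoulliTree n b).bind fun x => if x then hit u S else ret S

/-- Start with the empty set and process the first `t` elements of the history. -/
def sampleTree (hit : Fin n → Finset (Fin n) → CoinTree (Finset (Fin n))) (b : ℕ)
    (hist : ℕ → Fin n) (t : ℕ) : CoinTree (Finset (Fin n)) :=
  forTree (fun j => touch hit b (hist j)) t ∅

/-- The membership of `u` becomes a fair coin. -/
def coinHit (u : Fin n) (S : Finset (Fin n)) : CoinTree (Finset (Fin n)) :=
  flip (ret (S.erase u)) (ret (insert u S))

/-- The element `u` becomes a member. -/
def insertHit (u : Fin n) (S : Finset (Fin n)) : CoinTree (Finset (Fin n)) :=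
  ret (insert u S)

/-- The program `p` carries out `hit` for the current element of the history. -/
structure Implements (p : Program)
    (hit : Fin n → Finset (Fin n) → CoinTree (Finset (Fin n))) : Prop where
  writesNat_eq : ∀ a, a ≠ 8 → p.writesNat a = false
  rel : ∀ s S (u : Fin n), s.nat 7 (s.nat 10 0) = (u : ℕ) → Bits s S →
    Refines (fun s' S' => Bits s' S') (p.tree f s) (hit u S)

theorem implements_hitCoin : Implements f hitCoin coinHit where
  writesNat_eq a ha := by simpa [hitCoin, writesNat] using ha.symm
  rel s S u hu hS := by
    refine ⟨?_, ?_⟩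
    · exact hS.erase u (by simp [NatExpr.eval, hu])
    · exact hS.insert u (by simp [NatExpr.eval, hu])

theorem implements_hitInsert : Implements f hitInsert insertHit where
  writesNat_eq a ha := by simpa [hitInsert, writesNat] using ha.symm
  rel s S u hu hS := hS.insert u (by simp [NatExpr.eval, hu])

theorem refines_bernoulli {b : ℕ} {s : MachineState} (hn : s.nat 0 0 = n) (hb : s.nat 4 0 = b) :
    Refines (fun s' x => s'.nat 11 0 = x.toNat ∧ bernoulli.Frame s s') (bernoulli.tree f s)
      (bernoulliTree n b) := by
  refine Refines.and_all ?_ (all_frame f _ _)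
  rw [bernoulli, tree_seq, tree_put, ret_bind]
  refine (refines_forEach f (R := fun _ s (x : Bool) => s.nat 11 0 = x.toNat) (by simp [hn]) rfl
    (by decide) (fun _ s s' y h _ hs => by simpa only [h 11 (by decide)] using hs)
    (by simp [NatExpr.eval]) ?_).mono fun _ _ h => h.1
  intro j hj s' x hF hj' hx
  have hb' : s'.nat 4 0 = b := by rw [hF.1 4 rfl]; simpa using hb
  by_cases hjb : j < b
  · rw [tree_whenever_pos f _ (by simp only [TestExpr.Holds, NatExpr.eval]; omega), if_pos hjb,
      tree_seq, tree_flip]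
    simp only [flip_bind, ret_bind]
    constructor
    · rw [tree_whenever_pos f _ (by simp [TestExpr.Holds, NatExpr.eval])]
      simp [Refines, NatExpr.eval]
    · rw [tree_whenever_neg f _ (by simp [TestExpr.Holds, NatExpr.eval])]
      simp [Refines, hx]
  · rw [tree_whenever_neg f _ (by simp only [TestExpr.Holds, NatExpr.eval]; omega), if_neg hjb]
    simp [Refines, hx]

theorem refines_touchStep {p : Program} {hit : Fin n → Finset (Fin n) → CoinTree (Finset (Fin n))}
    (hp : Implements f p hit) {b j : ℕ} {u : Fin n} {S : Finset (Fin n)} {s : MachineState}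
    (hn : s.nat 0 0 = n) (hb : s.nat 4 0 = b) (hj : s.nat 10 0 = j) (hu : s.nat 7 j = u)
    (hS : Bits s S) :
    Refines (fun s' S' => s'.nat 10 0 = j + 1 ∧ Bits s' S') ((touchStep p).tree f s)
      (touch hit b u S) := by
  rw [touchStep, tree_seq, touch]
  refine (refines_bernoulli f hn hb).bind fun s1 x h1 => ?_
  have hj1 : s1.nat 10 0 = j := by rw [h1.2.1 10 rfl]; exact hj
  have hu1 : s1.nat 7 j = u := by rw [h1.2.1 7 rfl]; exact hu
  have hS1 : Bits s1 S := hS.congr (h1.2.1 8 rfl)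
  rw [tree_seq]
  cases x with
  | true =>
    rw [tree_whenever_pos f _ (by simp [TestExpr.Holds, NatExpr.eval, h1.1]), if_pos rfl,
      ← bind_ret (hit u S)]
    refine ((hp.rel s1.tick S u (by simp [hj1, hu1]) hS1).and_all (all_frame f _ _)).bind
      fun s2 S2 h2 => ⟨?_, ?_⟩
    · simp [NatExpr.eval, h2.2.1 10 (hp.writesNat_eq 10 (by decide)), hj1]
    · exact h2.1.congr (by simp)
  | false =>
    rw [tree_whenever_neg f _ (by simp [TestExpr.Holds, NatExpr.eval, h1.1])]
    exact ⟨by simp [NatExpr.eval, hj1], hS1.congr (by simp)⟩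

theorem det_clear {s : MachineState} (hn : s.nat 0 0 = n) :
    ((forEach 9 (.setNat 8 (var 9) (.lit 0))).tree f s).Det fun s' =>
      Bits s' (∅ : Finset (Fin n)) := by
  refine (det_forEach f (R := fun j s => ∀ u < j, s.nat 8 u = 0) hn rfl (by decide)
    (fun j s s' h _ hs => by rw [h 8 (by decide)]; exact hs) (by simp) ?_).mono
    fun s' h u => by simpa using h.1 u u.2
  intro j hj s' _ hj' hs
  simp only [tree_setNat, det_ret]
  intro u hu
  by_cases h : u = j
  · simp [NatExpr.eval, hj', h]
  · simp [NatExpr.eval, hj', h, hs u (by omega)]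

theorem Implements.sample_writesNat {p : Program}
    {hit : Fin n → Finset (Fin n) → CoinTree (Finset (Fin n))}
    (hp : Implements f p hit) {a : ℕ} (ha : a < 8 ∨ a = 16) : (sample p).writesNat a = false := by
  have h8 : p.writesNat a = false := hp.writesNat_eq a (by omega)
  have h : ∀ c, 8 ≤ c → c ≠ 16 → (c == a) = false := fun c hc hc' => by simp; omega
  simp [sample, writesNat, powLoop, touchStep, bernoulli, forEach, put, whenever, h8, h]

theorem refines_sample {p : Program} {hit : Fin n → Finset (Fin n) → CoinTree (Finset (Fin n))}
    (hp : Implements f p hit) {b t : ℕ} {hist : ℕ → Fin n} (ht : t ≤ 4 * n ^ 2)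
    {s : MachineState}
    (hn : s.nat 0 0 = n) (hb : s.nat 4 0 = b) (hst : s.nat 6 0 = t)
    (hh : ∀ j < t, s.nat 7 j = hist j) :
    Refines (fun s' S => Bits s' S ∧ (sample p).Frame s s') ((sample p).tree f s)
      (sampleTree hit b hist t) := by
  refine Refines.and_all ?_ (all_frame f _ _)
  rw [sample, tree_seq]
  refine Det.refines_bind ((det_clear f hn).and_all (all_frame f _ _)) fun s1 h1 => ?_
  rw [tree_seq, tree_put, ret_bind]
  set s2 := s1.tick.writeNat 10 0 ((NatExpr.lit 0).eval s1) with hs2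
  have hw : ∀ a, a < 8 → (whenever (.natLe (.add (var 10) (.lit 1)) (var 6))
      (touchStep p)).writesNat a = false := by
    intro a ha
    have h8 : p.writesNat a = false := hp.writesNat_eq a (by omega)
    have h : ∀ c, 8 ≤ c → (c == a) = false := fun c hc => by simp; omega
    simp [writesNat, touchStep, bernoulli, forEach, put, whenever, h8, h]
  have e2 : ∀ a, a < 8 → s2.nat a = s.nat a := by
    intro a ha
    have h9 : (a == 9) = false := by simp; omega
    have : a ≠ 10 := by omega
    rw [hs2]
    simp only [writeNat_nat, this, if_false, tick_nat]
    refine h1.2.1 a ?_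
    have h : ∀ c, 8 ≤ c → (c == a) = false := fun c hc => by simp; omega
    simp [forEach, writesNat, put, h]
  have key := refines_litLoop f (β := ℕ × Finset (Fin n)) (s₀ := s2)
    (A := guarded (fun j => touch hit b (hist j)) t)
    (R := fun s x => s.nat 10 0 = x.1 ∧ Bits s x.2) (hw 0 (by decide))
    (by rw [e2 0 (by decide)]; exact hn) (fun s y h => h) (fun s3 y hF h => ?_) 4 2 (y := (0, ∅))
    ⟨by simp [hs2, NatExpr.eval], h1.1.congr (by simp [hs2])⟩
  · rw [forTree_guarded, Nat.min_eq_right ht] at key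
    exact key.of_bind_ret.mono fun _ _ h => h.2
  · have e3 : ∀ a, a < 8 → s3.nat a = s.nat a := fun a ha => by rw [hF.1 a (hw a ha), e2 a ha]
    have h6 : s3.nat 6 0 = t := by rw [e3 6 (by decide)]; exact hst
    obtain ⟨hy, hyS⟩ := h
    rw [guarded]
    by_cases hlt : y.1 < t
    · rw [tree_whenever_pos f _ (by simp only [TestExpr.Holds, NatExpr.eval]; omega), if_pos hlt,
        ← bind_ret ((touchStep p).tree f s3.tick)]
      refine (refines_touchStep f hp (s := s3.tick) (j := y.1) (by simpa [e3 0] using hn)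
        (by simpa [e3 4] using hb) (by simpa using hy) (by simpa [e3 7] using hh _ hlt) hyS).bind
        fun s4 S4 h4 => ?_
      exact h4
    · rw [tree_whenever_neg f _ (by simp only [TestExpr.Holds, NatExpr.eval]; omega), if_neg hlt]
      exact ⟨hy, hyS⟩

/-! ### Extending the history -/

/-- Toggle the membership of `u` in `S`. -/
def toggle (u : Fin n) (S : Finset (Fin n)) : Finset (Fin n) := symmDiff S {u}

theorem mem_toggle {u v : Fin n} {S : Finset (Fin n)} :
    v ∈ toggle u S ↔ if v = u then v ∉ S else v ∈ S := by
  by_cases h : v = u <;> simp [toggle, Finset.mem_symmDiff, h]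

theorem toggle_toggle (u : Fin n) (S : Finset (Fin n)) : toggle u (toggle u S) = S := by
  ext v
  by_cases h : v = u <;> simp [mem_toggle, h]

theorem bits_toggleBit {s : MachineState} {S : Finset (Fin n)} (hS : Bits s S) {u : Fin n}
    (hu : s.nat 9 0 = u) : (toggleBit.tree f s).Det fun s' => Bits s' (toggle u S) := by
  simp only [toggleBit, tree_setNat, det_ret]
  intro v
  by_cases hv : v = u
  · subst hv
    simp only [NatExpr.eval, writeNat_nat, hu, if_true, Function.update_self, mem_toggle, hS v]
    by_cases h : v ∈ S <;> simp [h]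
  · have : (v : ℕ) ≠ u := fun h => hv (Fin.ext h)
    simp [NatExpr.eval, hu, this, mem_toggle, hv, hS v]

theorem det_accumulate {s : MachineState} {S : Finset (Fin n)} {W : Fin n → ℝ}
    (hn : s.nat 0 0 = n) (hS : Bits s S) (hW : ∀ u : Fin n, s.real 0 u = W u) :
    (accumulate.tree f s).Det fun s' =>
      ∀ u : Fin n, s'.real 0 u = W u + (f (toggle u S) - f S) := by
  rw [accumulate, tree_seq, tree_query, ret_bind]
  refine (det_forEach f (R := fun j s => (Bits s S ∧ s.real 1 0 = f S) ∧ ∀ u : Fin n,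
    s.real 0 u = if u < j then W u + (f (toggle u S) - f S) else W u) (by simpa using hn) rfl
    (by decide) ?_ ?_ ?_).mono fun s' h u => ?_
  · intro j s s' h h' hs
    refine ⟨⟨hs.1.1.congr (h 8 (by decide)), ?_⟩, ?_⟩
    · rw [h']; exact hs.1.2
    · rw [h']; exact hs.2
  · exact ⟨⟨hS.congr (by simp), by simp [NatExpr.eval, hS.readSet_eq]⟩, by simpa using hW⟩
  · rintro j hj s1 - hs1 ⟨⟨hS1, h1⟩, hW1⟩
    have hj1 : s1.nat 9 0 = ((⟨j, hj⟩ : Fin n) : ℕ) := hs1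
    rw [tree_seq]
    refine Det.bind ((bits_toggleBit f hS1 hj1).and_all (all_frame f _ _)) fun s2 h2 => ?_
    rw [tree_seq, tree_query, ret_bind, tree_seq, tree_setReal, ret_bind]
    have e9 : s2.nat 9 = s1.nat 9 := h2.2.1 9 rfl
    have er : s2.real = s1.real := funext fun a => h2.2.2 a rfl
    refine ((bits_toggleBit f (S := toggle ⟨j, hj⟩ S) (h2.1.congr (by simp))
      (u := ⟨j, hj⟩) (by simp [e9, hs1])).and_all (all_frame f _ _)).mono fun s3 h3 => ?_
    have er3 : ∀ a, s3.real a = _ := fun a => h3.2.2 a rfl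
    refine ⟨⟨by simpa [toggle_toggle] using h3.1, ?_⟩, ?_⟩
    · rw [er3]; simp [er, h1]
    · intro u
      rw [er3]
      by_cases hu : (u : ℕ) = j
      · have hu' : (⟨j, hj⟩ : Fin n) = u := Fin.ext hu.symm
        simp [RealExpr.eval, NatExpr.eval, er, e9, hs1, hu, h1, h2.1.readSet_eq, hu']
        rw [← hu, hW1 u]
        simp [hu]
      · have h1 : (u : ℕ) < j + 1 ↔ (u : ℕ) < j := by omega
        simp [RealExpr.eval, NatExpr.eval, er, e9, hs1, hu, hW1 u, h1]
  · simpa using h.1.2 u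

/-- The last position of a maximum of `W` among the first `j` elements. -/
noncomputable def argmaxUpTo [NeZero n] (W : Fin n → ℝ) : ℕ → Fin n
  | 0 => 0
  | j + 1 => if h : j < n then
      if W (argmaxUpTo W j) ≤ W ⟨j, h⟩ then ⟨j, h⟩ else argmaxUpTo W j
    else argmaxUpTo W j

/-- The last position of a maximum of `W`. -/
noncomputable def argmax [NeZero n] (W : Fin n → ℝ) : Fin n := argmaxUpTo W n

theorem le_argmax [NeZero n] (W : Fin n → ℝ) (u : Fin n) : W u ≤ W (argmax W) := by
  have key : ∀ j ≤ n, ∀ u : Fin n, (u : ℕ) < j → W u ≤ W (argmaxUpTo W j) := by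
    intro j
    induction j with
    | zero => intro _ u hu; omega
    | succ j ih =>
      intro hj u hu
      have hjn : j < n := by omega
      simp only [argmaxUpTo, hjn, dif_pos]
      by_cases h : (u : ℕ) = j
      · have hu' : u = ⟨j, hjn⟩ := Fin.ext h
        split_ifs with h'
        · rw [hu']
        · rw [hu']; exact (not_le.mp h').le
      · have := ih (by omega) u (by omega)
        split_ifs with h'
        · exact this.trans h'
        · exact this
  exact key n le_rfl u u.2

theorem det_findMax [NeZero n] {s : MachineState} {W : Fin n → ℝ} (hn : s.nat 0 0 = n)
    (hW : ∀ u : Fin n, s.real 0 u = W u) :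
    (findMax.tree f s).Det fun s' => s'.nat 13 0 = argmax W ∧ findMax.Frame s s' := by
  refine Det.and_all ?_ (all_frame f _ _)
  rw [findMax, tree_seq, tree_put, ret_bind]
  refine (det_forEach f (R := fun j s => s.nat 13 0 = argmaxUpTo W j) (by simpa using hn) rfl
    (by decide) (fun j s s' h _ hs => by rw [h 13 (by decide)]; exact hs)
    (by simp [NatExpr.eval, argmaxUpTo]) ?_).mono fun s' h => h.1
  intro j hj s1 hF hj1 h1
  have er : s1.real 0 = s.real 0 := hF.2 0 rfl
  have hWj := hW ⟨j, hj⟩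
  simp only at hWj
  simp only [argmaxUpTo, hj, dif_pos]
  by_cases h : W (argmaxUpTo W j) ≤ W ⟨j, hj⟩
  · rw [tree_whenever_pos f _ (by
      simpa [TestExpr.Holds, NatExpr.eval, RealExpr.eval, er, h1, hW, hj1, hWj] using h),
      if_pos h]
    simp [NatExpr.eval, hj1]
  · rw [tree_whenever_neg f _ (by
      simpa [TestExpr.Holds, NatExpr.eval, RealExpr.eval, er, h1, hW, hj1, hWj] using h),
      if_neg h]
    simpa using h1

/-- The sums of the changes of `f`, under the toggling of every element, over `m` samples. -/
noncomputable def estimateTree (b : ℕ) (hist : ℕ → Fin n) (t m : ℕ) : CoinTree (Fin n → ℝ) :=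
  forTree (fun _ W => (sampleTree coinHit b hist t).bind fun S =>
    ret fun u => W u + (f (toggle u S) - f S)) m 0

/-- Append to the history, which has length `t`, an element whose estimated effect is largest. -/
noncomputable def extendTree [NeZero n] (b t : ℕ) (hist : ℕ → Fin n) : CoinTree (ℕ → Fin n) :=
  (estimateTree f b hist t (n ^ 8)).bind fun W => ret (Function.update hist t (argmax W))

theorem refines_extendHistory [NeZero n] {b t : ℕ} {hist : ℕ → Fin n} (ht : t ≤ 4 * n ^ 2)
    {s : MachineState} (hn : s.nat 0 0 = n) (hb : s.nat 4 0 = b) (hst : s.nat 6 0 = t)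
    (hh : ∀ j < t, s.nat 7 j = hist j) :
    Refines (fun s' hist' => s'.nat 6 0 = t + 1 ∧ ∀ j < t + 1, s'.nat 7 j = (hist' j : ℕ))
      (extendHistory.tree f s) (extendTree f b t hist) := by
  rw [extendHistory, tree_seq]
  have hclear : ((forEach 9 (.setReal 0 (var 9) (.ofNat (.lit 0)))).tree f s).Det fun s' =>
      ∀ u : Fin n, s'.real 0 u = (0 : Fin n → ℝ) u := by
    refine (det_forEach f (R := fun j s => ∀ u < j, s.real 0 u = 0) hn rfl (by decide)
      (fun j s s' _ h hs => by rw [h]; exact hs) (by simp) ?_).mono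
      fun s' h u => by simpa using h.1 u u.2
    intro j hj s' _ hj' hs
    simp only [tree_setReal, det_ret]
    intro u hu
    by_cases h : u = j
    · simp [NatExpr.eval, RealExpr.eval, hj', h]
    · simp [NatExpr.eval, hj', h, hs u (by omega)]
  refine Det.refines_bind (hclear.and_all (all_frame f _ _)) fun s1 h1 => ?_
  have e1 : ∀ a, a < 8 → s1.nat a = s.nat a := fun a ha => h1.2.1 a (by
    have h : ∀ c, 8 ≤ c → (c == a) = false := fun c hc => by simp; omega
    simp [forEach, writesNat, put, h])
  have hw : ∀ a, a < 8 → (Program.seq (sample hitCoin) accumulate).writesNat a = false := by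
    intro a ha
    have h : ∀ c, 8 ≤ c → (c == a) = false := fun c hc => by simp; omega
    simp [writesNat, (implements_hitCoin f).sample_writesNat f (a := a) (by omega), accumulate,
      forEach, put, toggleBit, h]
  rw [tree_seq, extendTree]
  have key := refines_powLoop f (s₀ := s1)
    (R := fun s (W : Fin n → ℝ) => ∀ u : Fin n, s.real 0 u = W u)
    (A := fun W => (sampleTree coinHit b hist t).bind fun S =>
      ret fun u => W u + (f (toggle u S) - f S)) (hw 0 (by decide))
    (by rw [e1 0 (by decide)]; exact hn) (fun s y h => h) (fun s2 W hF h2 => ?_) 8 s1 0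
    (Frame.refl _ _) h1.1
  · refine Refines.bind (key.and_all (all_frame f _ _)) fun s2 W h2 => ?_
    have e2 : ∀ a, a < 8 → s2.nat a = s.nat a := fun a ha => by
      rw [h2.2.1 a (by rw [writesNat_powLoop]; exact hw a ha), e1 a ha]
    rw [tree_seq]
    refine Det.refines_bind (det_findMax f (by rw [e2 0 (by decide)]; exact hn) h2.1)
      fun s3 h3 => ?_
    have e3 : ∀ a, a < 8 → s3.nat a = s.nat a := fun a ha => by
      rw [h3.2.1 a (by
        have h : ∀ c, 8 ≤ c → (c == a) = false := fun c hc => by simp; omega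
        simp [findMax, forEach, writesNat, put, whenever, h]), e2 a ha]
    rw [tree_seq, tree_setNat, ret_bind, tree_put]
    refine ⟨by simp [NatExpr.eval, e3 6, hst], fun j hj => ?_⟩
    by_cases h : j = t
    · simp [NatExpr.eval, e3 6, hst, h, h3.1]
    · simp [NatExpr.eval, e3 6, e3 7, hst, h, hh j (by omega)]
  · have e2 : ∀ a, a < 8 → s2.nat a = s.nat a := fun a ha => by
      rw [hF.1 a (hw a ha), e1 a ha]
    rw [tree_seq, ← bind_ret ((sampleTree _ _ _ _).bind _), bind_assoc]
    refine (refines_sample f (implements_hitCoin f) ht (by rw [e2 0 (by decide)]; exact hn)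
      (by rw [e2 4 (by decide)]; exact hb) (by rw [e2 6 (by decide)]; exact hst)
      (by rw [e2 7 (by decide)]; exact hh)).bind fun s3 S h3 => ?_
    refine (det_accumulate f (W := W) ?_ h3.1 ?_).refines_ret fun _ h => h
    · rw [h3.2.1 0 rfl, e2 0 (by decide)]; exact hn
    · rw [h3.2.2 0 rfl]; exact h2

/-- The history of length `t`. -/
noncomputable def historyTree [NeZero n] (b t : ℕ) : CoinTree (ℕ → Fin n) :=
  forTree (extendTree f b) t fun _ => 0

theorem refines_buildHistory [NeZero n] {b : ℕ} {lim : ℝ} (ht : ⌈lim⌉₊ ≤ 4 * n ^ 2)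
    {s : MachineState} (hn : s.nat 0 0 = n) (hb : s.nat 4 0 = b) (hst : s.nat 6 0 = 0)
    (hlim : s.real 3 0 = lim) :
    Refines (fun s' hist => (s'.nat 6 0 = ⌈lim⌉₊ ∧ ∀ j < ⌈lim⌉₊, s'.nat 7 j = (hist j : ℕ)) ∧
      buildHistory.Frame s s') (buildHistory.tree f s) (historyTree f b ⌈lim⌉₊) := by
  refine Refines.and_all ?_ (all_frame f _ _)
  rw [buildHistory]
  have key := refines_litLoop f (β := ℕ × (ℕ → Fin n)) (s₀ := s)
    (p := whenever (.not (.realLe (.cell 3 (.lit 0)) (.ofNat (var 6)))) extendHistory)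
    (A := guarded (extendTree f b) ⌈lim⌉₊)
    (R := fun s x => s.nat 6 0 = x.1 ∧ ∀ j < x.1, s.nat 7 j = (x.2 j : ℕ)) rfl
    hn (fun s y h => h) (fun s3 y hF h => ?_) 4 2 (y := (0, fun _ => 0)) ⟨hst, by simp⟩
  · rw [forTree_guarded, Nat.min_eq_right ht] at key
    exact key.of_bind_ret
  · obtain ⟨hy, hyh⟩ := h
    have hl : s3.real 3 0 = lim := by rw [hF.2 3 rfl]; exact hlim
    rw [guarded]
    by_cases hlt : y.1 < ⌈lim⌉₊
    · have hlt' := Nat.lt_ceil.mp hlt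
      rw [tree_whenever_pos f _ (by
        simpa [TestExpr.Holds, NatExpr.eval, RealExpr.eval, hl, hy] using hlt'),
        if_pos hlt, ← bind_ret (extendHistory.tree f s3.tick)]
      refine (refines_extendHistory f (s := s3.tick) (t := y.1) (by omega)
        (by rw [tick_nat, hF.1 0 rfl]; exact hn)
        (by rw [tick_nat, hF.1 4 rfl]; exact hb) hy hyh).bind fun s4 S4 h4 => ?_
      exact h4
    · have hlt' : ¬ ((y.1 : ℝ) < lim) := fun h => hlt (Nat.lt_ceil.mpr h)
      rw [tree_whenever_neg f _ (by
        simpa [TestExpr.Holds, NatExpr.eval, RealExpr.eval, hl, hy] using hlt'),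
        if_neg hlt]
      exact ⟨hy, hyh⟩

end CardinalityMax

namespace CardinalityMax

open Program MachineState

variable {n : ℕ} (f : Finset (Fin n) → ℝ)

/-! ### Rounding and output -/

theorem det_count {s : MachineState} {S : Finset (Fin n)} (hn : s.nat 0 0 = n) (hS : Bits s S) :
    (count.tree f s).Det fun s' => s'.nat 14 0 = S.card ∧ count.Frame s s' := by
  refine Det.and_all ?_ (all_frame f _ _)
  rw [count, tree_seq, tree_put, ret_bind]
  refine (det_forEach f (R := fun j s' => s'.nat 14 0 = ∑ i ∈ Finset.range j, s.nat 8 i)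
    (by simpa using hn) rfl (by decide)
    (fun j s s' h _ hs => by rw [h 14 (by decide)]; exact hs) (by simp [NatExpr.eval]) ?_).mono
    fun s' h => ?_
  · intro j hj s1 hF hj1 h1
    have e8 : s1.nat 8 = s.nat 8 := hF.1 8 rfl
    simp [NatExpr.eval, h1, hj1, e8, Finset.sum_range_succ]
  · rw [h.1, Finset.sum_range]
    simp [hS _]

/-- Add the elements `0`, …, `j - 1`, in turn, as long as there are fewer than `2 * k` elements. -/
def fillUpTo (k : ℕ) (T : Finset (Fin n)) : ℕ → Finset (Fin n)
  | 0 => T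
  | j + 1 => if h : j < n then
      if (fillUpTo k T j).card + 1 ≤ k + k then insert ⟨j, h⟩ (fillUpTo k T j) else fillUpTo k T j
    else fillUpTo k T j

theorem det_fill {k : ℕ} {s : MachineState} {T : Finset (Fin n)} (hn : s.nat 0 0 = n)
    (hk : s.nat 3 0 = k) (hT : Bits s T) :
    (fill.tree f s).Det fun s' => Bits s' (fillUpTo k T n) ∧ fill.Frame s s' := by
  refine (det_forEach f (R := fun j s' => Bits s' (fillUpTo k T j)) hn rfl (by decide)
    (fun j s s' h _ hs => hs.congr (h 8 (by decide))) hT ?_)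
  intro j hj s1 hF hj1 h1
  rw [tree_seq]
  have hn1 : s1.nat 0 0 = n := by rw [hF.1 0 rfl]; exact hn
  refine (det_count f hn1 h1).bind fun s2 h2 => ?_
  have hk2 : s2.nat 3 0 = k := by rw [h2.2.1 3 rfl, hF.1 3 rfl]; exact hk
  have h12 : Bits s2 (fillUpTo k T j) := h1.congr (h2.2.1 8 rfl)
  have hj2 : s2.nat 9 0 = j := by rw [h2.2.1 9 rfl]; exact hj1
  simp only [fillUpTo, hj, dif_pos]
  by_cases h : (fillUpTo k T j).card + 1 ≤ k + k
  · rw [tree_whenever_pos f _ (by simpa [TestExpr.Holds, NatExpr.eval, h2.1, hk2] using h),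
      if_pos h, tree_setNat, det_ret]
    exact h12.insert _ (by simp [NatExpr.eval, hj2])
  · rw [tree_whenever_neg f _ (by simpa [TestExpr.Holds, NatExpr.eval, h2.1, hk2] using h),
      if_neg h, det_ret]
    exact h12

/-- Process the element `u`: if it is in the set and starts a new pair, a coin decides whether it
stays; if it completes a pair, it stays exactly if its partner did not. The second component is the
outcome of the coin of an incomplete pair. -/
def pairStep (u : Fin n) (x : Finset (Fin n) × Option Bool) :
    CoinTree (Finset (Fin n) × Option Bool) :=
  if u ∈ x.1 then
    match x.2 with
    | none => flip (ret (x.1.erase u, some false)) (ret (x.1, some true))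
    | some true => ret (x.1.erase u, none)
    | some false => ret (x.1, none)
  else ret x

/-- Choose one random element of each pair. -/
def pairTree (T : Finset (Fin n)) : CoinTree (Finset (Fin n) × Option Bool) :=
  forTree (fun j x => if h : j < n then pairStep ⟨j, h⟩ x else ret x) n (T, none)

theorem refines_choosePairs {s : MachineState} {T : Finset (Fin n)} (hn : s.nat 0 0 = n)
    (hT : Bits s T) :
    Refines (fun s' x => Bits s' x.1 ∧ choosePairs.Frame s s') (choosePairs.tree f s)
      (pairTree T) := by
  refine Refines.and_all ?_ (all_frame f _ _)
  rw [choosePairs, tree_seq, tree_put, ret_bind]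
  refine (refines_forEach f (β := Finset (Fin n) × Option Bool)
    (R := fun _ s x => Bits s x.1 ∧ (x.2 = none → s.nat 15 0 = 0) ∧
      ∀ c, x.2 = some c → s.nat 15 0 = 1 ∧ s.nat 12 0 = c.toNat) (by simpa using hn) rfl (by decide)
    (fun _ s s' y h _ hs => by
      simp only [h 15 (by decide), h 12 (by decide)]
      exact ⟨hs.1.congr (h 8 (by decide)), hs.2⟩)
    ⟨hT.congr (by simp), by simp [NatExpr.eval], by simp⟩ ?_).mono fun _ _ h => h.1.1
  rintro j hj s1 ⟨S, pend⟩ hF hj1 ⟨h1, hnone, hsome⟩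
  rw [dif_pos hj]
  have h8 := h1 ⟨j, hj⟩
  simp only at h8
  rw [pairStep]
  have self : ∀ {s' : MachineState}, (⟨j, hj⟩ : Fin n) ∈ S →
      s'.nat 8 = Function.update (s1.nat 8) j 1 → Bits s' S := by
    intro s' hS h
    have := Bits.insert (s' := s') h1 ⟨j, hj⟩ h
    rwa [Finset.insert_eq_of_mem hS] at this
  by_cases hS : (⟨j, hj⟩ : Fin n) ∈ S
  · rw [if_pos hS] at h8
    rw [tree_whenever_pos f _ (by simp [TestExpr.Holds, NatExpr.eval, hj1, h8]), if_pos hS]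
    cases pend with
    | none =>
      rw [tree_ite_pos f _ _ (by simp [TestExpr.Holds, NatExpr.eval, hnone])]
      simp only [tree_seq, tree_flip, flip_bind, ret_bind, tree_put, tree_setNat]
      constructor
      · refine ⟨h1.erase _ (by simp [NatExpr.eval, hj1]), by simp, ?_⟩
        simp [NatExpr.eval]
      · refine ⟨self hS (by simp [NatExpr.eval, hj1]), by simp, ?_⟩
        simp [NatExpr.eval]
    | some c =>
      have hc := hsome c rfl
      rw [tree_ite_neg f _ _ (by simp [TestExpr.Holds, NatExpr.eval, hc.1])]
      simp only [tree_seq, ret_bind, tree_put, tree_setNat]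
      cases c with
      | true =>
        refine ⟨h1.erase _ (by simp [NatExpr.eval, hj1, hc.2]), by simp [NatExpr.eval], by simp⟩
      | false =>
        refine ⟨self hS (by simp [NatExpr.eval, hj1, hc.2]), by simp [NatExpr.eval], by simp⟩
  · rw [if_neg hS] at h8
    rw [tree_whenever_neg f _ (by simp [TestExpr.Holds, NatExpr.eval, hj1, h8]), if_neg hS]
    exact ⟨h1, hnone, hsome⟩

/-- If `S` has more than `k` elements, remove one whose removal leaves the largest value. -/
noncomputable def trimStep [NeZero n] (k : ℕ) (S : Finset (Fin n)) : Finset (Fin n) :=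
  if k + 1 ≤ S.card then S.erase (argmax fun u => if u ∈ S then f (S.erase u) else -1) else S

theorem det_removalValues {s : MachineState} {S : Finset (Fin n)} (hn : s.nat 0 0 = n)
    (hS : Bits s S) :
    (removalValues.tree f s).Det fun s' => ((Bits s' S ∧
      ∀ u : Fin n, s'.real 0 u = if u ∈ S then f (S.erase u) else -1) ∧
        removalValues.Frame s s') := by
  refine ((det_forEach f (R := fun j s => Bits s S ∧ ∀ u : Fin n, u < j →
    s.real 0 u = if u ∈ S then f (S.erase u) else -1) hn rfl (by decide) ?_ ⟨hS, by simp⟩ ?_).mono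
    fun s' h => ⟨⟨h.1.1, fun u => h.1.2 u u.2⟩, h.2⟩)
  · intro j s s' h h' hs
    rw [h']
    exact ⟨hs.1.congr (h 8 (by decide)), hs.2⟩
  · rintro j hj s1 hF hj1 ⟨h1, hW⟩
    have h8 := h1 ⟨j, hj⟩
    simp only at h8
    by_cases hjS : (⟨j, hj⟩ : Fin n) ∈ S
    · rw [if_pos hjS] at h8
      rw [tree_ite_pos f _ _ (by simp [TestExpr.Holds, NatExpr.eval, hj1, h8])]
      simp only [tree_seq, ret_bind, tree_setNat, tree_query, det_ret]
      have he : (s1.tick.tick.writeNat 8 ((var 9).eval s1.tick)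
          ((NatExpr.lit 0).eval s1.tick)).readSet n 8
          = S.erase ⟨j, hj⟩ :=
        (h1.erase ⟨j, hj⟩ (by simp [NatExpr.eval, hj1])).readSet_eq
      refine ⟨?_, fun u hu => ?_⟩
      · rw [← Finset.insert_eq_of_mem hjS]
        exact h1.insert ⟨j, hj⟩ (by simp [NatExpr.eval, hj1])
      · rw [he]
        by_cases huj : (u : ℕ) = j
        · have hu' : u = ⟨j, hj⟩ := Fin.ext huj
          simp [NatExpr.eval, hj1, hu', hjS]
        · simp [NatExpr.eval, hj1, huj, hW u (by omega)]
    · rw [if_neg hjS] at h8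
      rw [tree_ite_neg f _ _ (by simp [TestExpr.Holds, NatExpr.eval, hj1, h8])]
      simp only [tree_setReal, det_ret]
      refine ⟨h1.congr (by simp), fun u hu => ?_⟩
      by_cases huj : (u : ℕ) = j
      · have hu' : u = ⟨j, hj⟩ := Fin.ext huj
        simp [NatExpr.eval, RealExpr.eval, hj1, hu', hjS]
      · simp [NatExpr.eval, hj1, huj, hW u (by omega)]

theorem det_trim [NeZero n] {k : ℕ} {s : MachineState} {S : Finset (Fin n)} (hn : s.nat 0 0 = n)
    (hk : s.nat 3 0 = k) (hS : Bits s S) :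
    (trim.tree f s).Det fun s' => Bits s' ((trimStep f k)^[n] S) ∧ trim.Frame s s' := by
  refine Det.and_all ?_ (all_frame f _ _)
  rw [trim]
  simp only [Program.tree]
  have e : (var 0).eval s = n := hn
  rw [e]
  have := refines_iter (m := n) (s := s.tick) (x := ())
    (step := fun s => (Program.seq count (whenever (.natLe (.add (var 3) (.lit 1)) (var 14))
      (.seq removalValues (.seq findMax (.setNat 8 (var 13) (.lit 0)))))).tree f s.tick)
    (R := fun j s _ => (s.nat 0 0 = n ∧ s.nat 3 0 = k) ∧ Bits s ((trimStep f k)^[j] S))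
    (A := fun _ => ret) ⟨⟨hn, hk⟩, hS⟩ ?_
  · rw [forTree_ret] at this
    exact Det.mono this fun s' h => h.2
  · rintro j - s1 ⟨⟩ ⟨⟨hn1, hk1⟩, h1⟩
    rw [tree_seq]
    refine (det_count f (s := s1.tick) hn1 h1).bind fun s2 h2 => ?_
    have hn2 : s2.nat 0 0 = n := by rw [h2.2.1 0 rfl]; exact hn1
    have hk2 : s2.nat 3 0 = k := by rw [h2.2.1 3 rfl]; exact hk1
    have hb2 := h1.congr (h2.2.1 8 rfl)
    rw [Function.iterate_succ_apply']
    set S' := (trimStep f k)^[j] S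
    rw [trimStep]
    by_cases h : k + 1 ≤ S'.card
    · rw [tree_whenever_pos f _ (by simpa [TestExpr.Holds, NatExpr.eval, h2.1, hk2] using h),
        if_pos h, tree_seq]
      refine (det_removalValues f (s := s2.tick) hn2 hb2).bind fun s3 h3 => ?_
      have hn3 : s3.nat 0 0 = n := by rw [h3.2.1 0 rfl]; exact hn2
      have hk3 : s3.nat 3 0 = k := by rw [h3.2.1 3 rfl]; exact hk2
      rw [tree_seq]
      refine (det_findMax f hn3 h3.1.2).bind fun s4 h4 => ?_
      have hn4 : s4.nat 0 0 = n := by rw [h4.2.1 0 rfl]; exact hn3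
      have hk4 : s4.nat 3 0 = k := by rw [h4.2.1 3 rfl]; exact hk3
      rw [tree_setNat, det_ret]
      exact ⟨⟨by simpa using hn4, by simpa using hk4⟩,
        Bits.erase (h3.1.1.congr (h4.2.1 8 rfl)) _ (by simp [NatExpr.eval, h4.1])⟩
    · rw [tree_whenever_neg f _ (by simpa [TestExpr.Holds, NatExpr.eval, h2.1, hk2] using h),
        if_neg h, det_ret]
      exact ⟨⟨hn2, hk2⟩, hb2⟩

/-- The set itself or its complement. -/
def orCompl (c : Bool) (S : Finset (Fin n)) : Finset (Fin n) := if c then Sᶜ else S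

theorem det_writeOutput {c : Bool} {s : MachineState} {S : Finset (Fin n)} (hn : s.nat 0 0 = n)
    (hc : s.nat 16 0 = c.toNat) (hS : Bits s S) :
    (writeOutput.tree f s).Det fun s' => s'.readSet n 2 = orCompl c S := by
  refine (det_forEach f (R := fun j s => ∀ u : Fin n, u < j → (s.nat 2 u ≠ 0 ↔ u ∈ orCompl c S))
    hn rfl (by decide) (fun j s s' h _ hs => by rw [h 2 (by decide)]; exact hs) (by simp)
    ?_).mono fun s' h => ?_
  · intro j hj s1 hF hj1 h1
    have hc1 : s1.nat 16 0 = c.toNat := by rw [hF.1 16 rfl]; exact hc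
    have h8 := hS ⟨j, hj⟩
    rw [← hF.1 8 rfl] at h8
    simp only at h8
    cases c with
    | true =>
      rw [tree_ite_pos f _ _ (by simp [TestExpr.Holds, NatExpr.eval, hc1]), tree_setNat, det_ret]
      intro u hu
      by_cases huj : (u : ℕ) = j
      · have hu' : u = ⟨j, hj⟩ := Fin.ext huj
        by_cases hm : (⟨j, hj⟩ : Fin n) ∈ S <;>
          simp [NatExpr.eval, hj1, hu', h8, orCompl, hm]
      · simpa [NatExpr.eval, hj1, huj] using h1 u (by omega)
    | false =>
      rw [tree_ite_neg f _ _ (by simp [TestExpr.Holds, NatExpr.eval, hc1]), tree_setNat, det_ret]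
      intro u hu
      by_cases huj : (u : ℕ) = j
      · have hu' : u = ⟨j, hj⟩ := Fin.ext huj
        by_cases hm : (⟨j, hj⟩ : Fin n) ∈ S <;>
          simp [NatExpr.eval, hj1, hu', h8, orCompl, hm]
      · simpa [NatExpr.eval, hj1, huj] using h1 u (by omega)
  · ext u
    rw [← h.1 u u.2]
    simp [readSet]

/-! ### The whole algorithm -/

/-- Round the set `T` of touched elements to a set of cardinality `k`. -/
noncomputable def roundTree [NeZero n] (k : ℕ) (T : Finset (Fin n)) : CoinTree (Finset (Fin n)) :=
  (pairTree (fillUpTo k T n)).bind fun x => ret ((trimStep f k)^[n] x.1)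

/-- The set found by the algorithm, before the possible complementation: `b` determines the
probability `2 ^ (-b)`, and `t` is the length of the history. -/
noncomputable def resultTree [NeZero n] (b t k : ℕ) : CoinTree (Finset (Fin n)) :=
  (historyTree f b t).bind fun hist => (sampleTree insertHit b hist t).bind (roundTree f k)

/-- The probability `2 ^ (-b)` and the limit for the length of the history: if `2 * k ^ 2 < n`, then
every element of the history counts with probability `1`, and there are `2 * k` of them. -/
structure Parameters (n k b : ℕ) (lim : ℝ) : Prop where
  small : 2 * k * k < n → b = 0 ∧ lim = 2 * k
  large : n ≤ 2 * k * k → n ≤ 2 ^ b ∧ 2 ^ b ≤ 2 * n ∧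
    lim = (2 : ℝ) ^ b * (2 * k * (n + k)) / n

theorem Parameters.ceil_le {k b : ℕ} {lim : ℝ} (h : Parameters n k b lim) (hk : 2 * k ≤ n) :
    ⌈lim⌉₊ ≤ 4 * n ^ 2 := by
  rw [Nat.ceil_le]
  have hk' : (2 : ℝ) * k ≤ n := by exact_mod_cast hk
  have hk0 : (0 : ℝ) ≤ k := by positivity
  rcases lt_or_ge (2 * k * k) n with h1 | h1
  · rw [(h.small h1).2]
    have h2 : 2 * k ≤ 4 * n ^ 2 := by nlinarith
    exact_mod_cast h2
  · obtain ⟨-, h2, h3⟩ := h.large h1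
    rw [h3]
    rcases Nat.eq_zero_or_pos n with rfl | hn
    · simp
    have hn' : (0 : ℝ) < n := by exact_mod_cast hn
    rw [div_le_iff₀ hn']
    have h2' : (2 : ℝ) ^ b ≤ 2 * n := by exact_mod_cast h2
    calc (2 : ℝ) ^ b * (2 * k * (n + k)) ≤ (2 * n) * (n * (n + n)) := by
          gcongr; linarith
      _ = _ := by push_cast; ring

theorem det_chooseSide {k : ℕ} {s : MachineState} (hn : s.nat 0 0 = n) (hk : s.nat 1 0 = k) :
    (chooseSide.tree f s).Det fun s' =>
      (s'.nat 3 0 = (if 2 * k ≤ n then k else n - k) ∧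
        s'.nat 16 0 = (decide (n < 2 * k)).toNat) ∧ chooseSide.Frame s s' := by
  refine Det.and_all ?_ (all_frame f _ _)
  rw [chooseSide]
  by_cases h : 2 * k ≤ n
  · rw [tree_ite_pos f _ _ (by simp only [TestExpr.Holds, NatExpr.eval]; omega)]
    simp [NatExpr.eval, hk, h, not_lt.mpr h]
  · rw [tree_ite_neg f _ _ (by simp only [TestExpr.Holds, NatExpr.eval]; omega)]
    have h' : n < 2 * k := by omega
    simp [NatExpr.eval, hk, hn, h']

theorem det_findScale {s : MachineState} (hn : s.nat 0 0 = n) :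
    (findScale.tree f s).Det fun s' => (n ≤ 2 ^ s'.nat 4 0 ∧ (n ≠ 0 → 2 ^ s'.nat 4 0 ≤ 2 * n) ∧
      s'.nat 5 0 = 2 ^ s'.nat 4 0) ∧ findScale.Frame s s' := by
  refine Det.and_all ?_ (all_frame f _ _)
  rw [findScale]
  simp only [tree_seq, tree_put, ret_bind]
  refine (det_forEach f (R := fun j s => (n ≠ 0 → 2 ^ s.nat 4 0 ≤ 2 * n) ∧
    s.nat 5 0 = 2 ^ s.nat 4 0 ∧ (n ≤ 2 ^ s.nat 4 0 ∨ s.nat 4 0 = j)) (by simpa using hn) rfl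
    (by decide) (fun j s s' h _ hs => by rw [h 4 (by decide), h 5 (by decide)]; exact hs)
    ?_ ?_).mono fun s' h => ⟨?_, h.1.1, h.1.2.1⟩
  · refine ⟨?_, ?_, ?_⟩
    · simp [NatExpr.eval]; omega
    · simp [NatExpr.eval]
    · simp [NatExpr.eval]
  · rintro j hj s1 hF hj1 ⟨h1, h2, h3⟩
    have hn1 : s1.nat 0 0 = n := by rw [hF.1 0 rfl]; simpa using hn
    by_cases h : 2 ^ s1.nat 4 0 < n
    · rw [tree_whenever_pos f _ (by simp only [TestExpr.Holds, NatExpr.eval]; omega)]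
      simp only [tree_seq, tree_put, ret_bind, det_ret]
      have hb : s1.nat 4 0 = j := by omega
      refine ⟨?_, ?_, ?_⟩
      · simp [NatExpr.eval, pow_succ]; omega
      · simp [NatExpr.eval, pow_succ, h2]; omega
      · simp [NatExpr.eval, hb]
    · rw [tree_whenever_neg f _ (by simp only [TestExpr.Holds, NatExpr.eval]; omega)]
      exact ⟨h1, h2, Or.inl (not_lt.mp h)⟩
  · rcases h.1.2.2 with h | h
    · exact h
    · rw [h]; exact Nat.lt_two_pow_self.le

theorem det_chooseLimit {k : ℕ} {s : MachineState} (hn0 : n ≠ 0) (hn : s.nat 0 0 = n)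
    (hk : s.nat 3 0 = k) :
    (chooseLimit.tree f s).Det fun s' =>
      Parameters n k (s'.nat 4 0) (s'.real 3 0) ∧ chooseLimit.Frame s s' := by
  refine Det.and_all ?_ (all_frame f _ _)
  rw [chooseLimit]
  by_cases h : n ≤ 2 * k * k
  · rw [tree_ite_pos f _ _ ?_]
    · rw [tree_seq]
      refine (det_findScale f (s := s.tick) hn).bind fun s1 h1 => ?_
      have hn1 : s1.nat 0 0 = n := by rw [h1.2.1 0 rfl]; exact hn
      have hk1 : s1.nat 3 0 = k := by rw [h1.2.1 3 rfl]; exact hk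
      rw [tree_setReal, det_ret]
      refine ⟨fun h' => by omega, fun _ => ⟨h1.1.1, h1.1.2.1 hn0, ?_⟩⟩
      simp [RealExpr.eval, NatExpr.eval, twiceCard, hn1, hk1, h1.1.2.2]
      ring
    · simp only [TestExpr.Holds, RealExpr.eval, NatExpr.eval, twiceCard, hn, hk]
      have : n ≤ (k + k) * k := by linarith
      exact_mod_cast this
  · rw [tree_ite_neg f _ _ ?_]
    · simp only [tree_seq, tree_put, ret_bind, tree_setReal, det_ret]
      refine ⟨fun _ => ?_, fun h' => by omega⟩
      simp [RealExpr.eval, NatExpr.eval, twiceCard, hk]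
      ring
    · simp only [TestExpr.Holds, RealExpr.eval, NatExpr.eval, twiceCard, hn, hk]
      have : ¬ n ≤ (k + k) * k := by intro h'; exact h (by linarith)
      exact_mod_cast this

theorem exists_refines_algorithm [NeZero n] (k : ℕ) :
    ∃ b lim, Parameters n (if 2 * k ≤ n then k else n - k) b lim ∧
      Refines (fun s S => s.readSet n 2 = orCompl (decide (n < 2 * k)) S)
        (algorithm.tree f (MachineState.initial n k))
        (resultTree f b ⌈lim⌉₊ (if 2 * k ≤ n then k else n - k)) := by
  set k' := if 2 * k ≤ n then k else n - k with hk'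
  have hk2 : 2 * k' ≤ n := by rw [hk']; split_ifs <;> omega
  -- the parameters are the ones computed by the deterministic first part of the program
  have hsetup : ((Program.seq chooseSide chooseLimit).tree f (MachineState.initial n k)).Det
      fun s => (Parameters n k' (s.nat 4 0) (s.real 3 0) ∧
        s.nat 16 0 = (decide (n < 2 * k)).toNat ∧ s.nat 3 0 = k') ∧
        (Program.seq chooseSide chooseLimit).Frame (MachineState.initial n k) s := by
    refine Det.and_all ?_ (all_frame f _ _)
    rw [tree_seq]
    refine (det_chooseSide f (k := k) (by simp [MachineState.initial])
      (by simp [MachineState.initial])).bind fun s1 h1 => ?_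
    refine (det_chooseLimit f (k := k') (NeZero.ne n)
      (by rw [h1.2.1 0 rfl]; simp [MachineState.initial]) h1.1.1).mono fun s2 h2 => ⟨h2.1, ?_, ?_⟩
    · rw [h2.2.1 16 rfl]; exact h1.1.2
    · rw [h2.2.1 3 rfl]; exact h1.1.1
  have hex : ∃ s0, (Program.seq chooseSide chooseLimit).tree f (MachineState.initial n k) = ret s0 ∧
      (Parameters n k' (s0.nat 4 0) (s0.real 3 0) ∧
        s0.nat 16 0 = (decide (n < 2 * k)).toNat ∧ s0.nat 3 0 = k') ∧
        (Program.seq chooseSide chooseLimit).Frame (MachineState.initial n k) s0 := by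
    revert hsetup
    cases (Program.seq chooseSide chooseLimit).tree f (MachineState.initial n k) with
    | ret a => exact fun h => ⟨a, rfl, h⟩
    | flip l r => exact fun h => h.elim
  obtain ⟨s0, hs0, ⟨hpar, hflag, hk0⟩, hF0⟩ := hex
  refine ⟨s0.nat 4 0, s0.real 3 0, hpar, ?_⟩
  have ht := hpar.ceil_le hk2
  have e : algorithm.tree f (MachineState.initial n k) =
      (Program.seq buildHistory (.seq (sample hitInsert)
        (.seq fill (.seq choosePairs (.seq trim writeOutput))))).tree f s0 := by
    rw [← ret_bind s0 ((Program.seq buildHistory _).tree f), ← hs0, tree_seq, bind_assoc]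
    rfl
  rw [e, tree_seq, resultTree]
  have hn0 : s0.nat 0 0 = n := by rw [hF0.1 0 rfl]; simp [MachineState.initial]
  refine (refines_buildHistory f ht hn0 rfl
    (by rw [hF0.1 6 rfl]; simp [MachineState.initial]) rfl).bind fun s1 hist h1 => ?_
  have hn1 : s1.nat 0 0 = n := by rw [h1.2.1 0 rfl]; exact hn0
  rw [tree_seq]
  refine (refines_sample f (implements_hitInsert f) ht hn1 (h1.2.1 4 rfl ▸ rfl) h1.1.1
    h1.1.2).bind fun s2 T h2 => ?_
  have hn2 : s2.nat 0 0 = n := by rw [h2.2.1 0 rfl]; exact hn1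
  rw [tree_seq]
  refine (det_fill f (k := k') hn2 (by rw [h2.2.1 3 rfl, h1.2.1 3 rfl]; exact hk0)
    h2.1).refines_bind fun s3 h3 => ?_
  have hn3 : s3.nat 0 0 = n := by rw [h3.2.1 0 rfl]; exact hn2
  rw [tree_seq, roundTree]
  refine (refines_choosePairs f hn3 h3.1).bind fun s4 x h4 => ?_
  have hn4 : s4.nat 0 0 = n := by rw [h4.2.1 0 rfl]; exact hn3
  rw [tree_seq]
  refine (det_trim f (k := k') hn4
    (by rw [h4.2.1 3 rfl, h3.2.1 3 rfl, h2.2.1 3 rfl, h1.2.1 3 rfl]; exact hk0)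
    h4.1).refines_bind fun s5 h5 => ?_
  refine (det_writeOutput f (c := decide (n < 2 * k)) (by rw [h5.2.1 0 rfl]; exact hn4) ?_
    h5.1).refines_ret fun s h => h
  rw [h5.2.1 16 rfl, h4.2.1 16 rfl, h3.2.1 16 rfl, h2.2.1 16 rfl, h1.2.1 16 rfl]
  exact hflag

end CardinalityMax

namespace CardinalityMax

/-! ### Symmetric submodular functions -/

section SetFunction

variable {α : Type*} [DecidableEq α] {f : Finset α → ℝ}

theorem union_sub_le (hsub : IsSubmodular f) (S X : Finset α) (h : Disjoint X S) :
    f (S ∪ X) - f S ≤ ∑ u ∈ X, (f (insert u S) - f S) := by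
  induction X using Finset.induction_on with
  | empty => simp
  | insert a X ha ih =>
    rw [Finset.disjoint_insert_left] at h
    have h1 := hsub (S ∪ X) (insert a S)
    have e1 : S ∪ X ∪ insert a S = S ∪ insert a X := by ext; simp; tauto
    have e2 : (S ∪ X) ∩ insert a S = S := by
      ext v
      simp only [Finset.mem_inter, Finset.mem_union, Finset.mem_insert]
      constructor
      · rintro ⟨h1 | h1, rfl | h2⟩ <;> tauto
      · tauto
    rw [e1, e2] at h1
    rw [Finset.sum_insert ha]
    have := ih h.2
    linarith

theorem sdiff_sub_le [Fintype α] (hsym : IsSymmetricFn f) (hsub : IsSubmodular f) (S X : Finset α)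
    (h : X ⊆ S) : f (S \ X) - f S ≤ ∑ u ∈ X, (f (S.erase u) - f S) := by
  have h1 := union_sub_le hsub Sᶜ X
    (Finset.disjoint_left.mpr fun a ha h' => (Finset.mem_compl.mp h') (h ha))
  have e1 : Sᶜ ∪ X = (S \ X)ᶜ := by ext; simp; tauto
  rw [e1, hsym, hsym S] at h1
  refine h1.trans (Finset.sum_le_sum fun u _ => ?_)
  have e2 : insert u Sᶜ = (S.erase u)ᶜ := by ext; simp
  rw [e2, hsym]

/-- Reaching the union with and the difference from an optimal set by single toggles: on average,
toggling an element of `O` makes up for a fixed fraction of the distance to half of `f O`. -/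
theorem sub_le_sum_toggle {n : ℕ} {f : Finset (Fin n) → ℝ} (hf : ∀ S, 0 ≤ f S)
    (hsym : IsSymmetricFn f) (hsub : IsSubmodular f) (S O : Finset (Fin n)) :
    f O - 2 * f S ≤ ∑ u ∈ O, (f (toggle u S) - f S) := by
  have hsplit : ∑ u ∈ O, (f (toggle u S) - f S) =
      ∑ u ∈ O \ S, (f (insert u S) - f S) + ∑ u ∈ O ∩ S, (f (S.erase u) - f S) := by
    rw [← Finset.sum_sdiff (Finset.inter_subset_left : O ∩ S ⊆ O), Finset.sdiff_inter_self_left]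
    refine congrArg₂ _ (Finset.sum_congr rfl fun u hu => ?_) (Finset.sum_congr rfl fun u hu => ?_)
    · have : toggle u S = insert u S := by
        ext v
        simp only [Finset.mem_sdiff] at hu
        by_cases h : v = u <;> simp [mem_toggle, h, hu.2]
      rw [this]
    · have : toggle u S = S.erase u := by
        ext v
        simp only [Finset.mem_inter] at hu
        by_cases h : v = u <;> simp [mem_toggle, h, hu.2]
      rw [this]
  have h1 := union_sub_le hsub S (O \ S) Finset.sdiff_disjoint
  have h2 := sdiff_sub_le hsym hsub S (O ∩ S) Finset.inter_subset_right
  have h3 := hsub (S ∪ (O \ S)) (S \ (O ∩ S))ᶜ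
  have e2 : (S ∪ (O \ S)) ∩ (S \ (O ∩ S))ᶜ = O := by ext; simp; tauto
  rw [e2, hsym] at h3
  have h4 := hf (S ∪ (O \ S) ∪ (S \ (O ∩ S))ᶜ)
  rw [hsplit]
  linarith

theorem le_sum_singleton (hf : ∀ S, 0 ≤ f S) (hsub : IsSubmodular f) (S : Finset α) :
    f S ≤ f ∅ + ∑ u ∈ S, f {u} := by
  have := union_sub_le hsub ∅ S (Finset.disjoint_empty_right S)
  rw [Finset.empty_union] at this
  have h2 : ∑ u ∈ S, (f (insert u ∅) - f ∅) ≤ ∑ u ∈ S, f {u} :=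
    Finset.sum_le_sum fun u _ => by
      have := hf ∅
      simp only [insert_empty_eq]
      linarith
  linarith

/-- Every value is at most `2 (n + 1)` times the largest value at a set of cardinality `k`. -/
theorem le_of_forall_card_eq [Fintype α] (hf : ∀ S, 0 ≤ f S) (hsub : IsSubmodular f)
    {k : ℕ} (hk : 1 ≤ k)
    (hkn : 2 * k ≤ Fintype.card α) {c : ℝ} (hc : ∀ A : Finset α, A.card = k → f A ≤ c)
    (S : Finset α) : f S ≤ 2 * (Fintype.card α + 1) * c := by
  have key : ∀ X : Finset α, X.card ≤ 1 → f X ≤ 2 * c := by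
    intro X hX
    obtain ⟨A, hXA, -, hA⟩ := Finset.exists_subsuperset_card_eq (Finset.subset_univ X)
      (hX.trans hk) (by rw [Finset.card_univ]; omega)
    have h1 : k - X.card ≤ (Aᶜ).card := by rw [Finset.card_compl]; omega
    obtain ⟨Y, hY, hYc⟩ := Finset.exists_subset_card_eq h1
    have hd : Disjoint Y A := Finset.disjoint_left.mpr fun a ha h' =>
      (Finset.mem_compl.mp (hY ha)) h'
    have hB : (Y ∪ X).card = k := by
      rw [Finset.card_union_of_disjoint (hd.mono_right hXA)]; omega
    have h2 := hsub A (Y ∪ X)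
    have e : A ∩ (Y ∪ X) = X := by
      ext v
      simp only [Finset.mem_inter, Finset.mem_union]
      constructor
      · rintro ⟨h1, h2 | h2⟩
        · exact (Finset.disjoint_left.mp hd h2 h1).elim
        · exact h2
      · exact fun h => ⟨hXA h, Or.inr h⟩
    rw [e] at h2
    have := hc A hA
    have := hc _ hB
    have := hf (A ∪ (Y ∪ X))
    linarith
  have hc0 : 0 ≤ c := by
    have := (hf ∅).trans (key ∅ (by simp)); linarith
  refine (le_sum_singleton hf hsub S).trans ?_
  have h1 : ∑ u ∈ S, f {u} ≤ ∑ _u ∈ S, 2 * c := Finset.sum_le_sum fun u _ => key {u} (by simp)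
  rw [Finset.sum_const, nsmul_eq_mul] at h1
  have h2 : (S.card : ℝ) ≤ Fintype.card α := by exact_mod_cast Finset.card_le_univ S
  have h3 := key ∅ (by simp)
  have h4 : (S.card : ℝ) * (2 * c) ≤ Fintype.card α * (2 * c) := by gcongr
  linarith

end SetFunction

/-! ### Expected values under sampling -/

variable {n : ℕ}

theorem expect_bernoulliTree {b : ℕ} (hb : b ≤ n) (φ : Bool → ℝ) :
    (bernoulliTree n b).expect φ = (1 / 2) ^ b * φ true + (1 - (1 / 2) ^ b) * φ false := by
  have key : ∀ m, ∀ φ : Bool → ℝ,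
      (forTree (fun i x => if i < b then flip (ret false) (ret x) else ret x) m true).expect φ =
        (1 / 2) ^ min b m * φ true + (1 - (1 / 2) ^ min b m) * φ false := by
    intro m
    induction m with
    | zero => intro φ; simp [forTree]
    | succ m ih =>
      intro φ
      rw [forTree, expect_bind, ih]
      by_cases h : m < b
      · have e1 : min b m = m := by omega
        have e2 : min b (m + 1) = m + 1 := by omega
        simp only [h, if_true, expect_flip, expect_ret, e1, e2, pow_succ]
        ring
      · have e1 : min b m = b := by omega
        have e2 : min b (m + 1) = b := by omega
        simp only [h, if_false, expect_ret, e1, e2]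
  rw [bernoulliTree, key, Nat.min_eq_left hb]

theorem expect_touch {b : ℕ} (hb : b ≤ n)
    (hit : Fin n → Finset (Fin n) → CoinTree (Finset (Fin n))) (u : Fin n) (S : Finset (Fin n))
    (φ : Finset (Fin n) → ℝ) :
    (touch hit b u S).expect φ =
      (1 / 2) ^ b * (hit u S).expect φ + (1 - (1 / 2) ^ b) * φ S := by
  rw [touch, expect_bind, expect_bernoulliTree hb]
  simp

theorem expect_coinHit (u : Fin n) (S : Finset (Fin n)) (φ : Finset (Fin n) → ℝ) :
    (coinHit u S).expect φ = (φ S + φ (toggle u S)) / 2 := by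
  rw [coinHit, expect_flip, expect_ret, expect_ret]
  by_cases h : u ∈ S
  · have e1 : toggle u S = S.erase u := by
      ext v; by_cases hv : v = u <;> simp [mem_toggle, hv, h]
    rw [e1, Finset.insert_eq_of_mem h, add_comm]
  · have e1 : toggle u S = insert u S := by
      ext v; by_cases hv : v = u <;> simp [mem_toggle, hv, h]
    rw [e1, Finset.erase_eq_of_notMem h]

theorem expect_touch_coinHit {b : ℕ} (hb : b ≤ n) (u : Fin n) (S : Finset (Fin n))
    (φ : Finset (Fin n) → ℝ) :
    (touch coinHit b u S).expect φ = φ S + (1 / 2) ^ b / 2 * (φ (toggle u S) - φ S) := by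
  rw [expect_touch hb, expect_coinHit]
  ring

theorem sampleTree_succ (hit : Fin n → Finset (Fin n) → CoinTree (Finset (Fin n))) (b t : ℕ)
    (hist : ℕ → Fin n) : sampleTree hit b hist (t + 1) =
      (sampleTree hit b hist t).bind (touch hit b (hist t)) := rfl

theorem sampleTree_update (hit : Fin n → Finset (Fin n) → CoinTree (Finset (Fin n))) (b t : ℕ)
    (hist : ℕ → Fin n) (u : Fin n) :
    sampleTree hit b (Function.update hist t u) (t + 1) =
      (sampleTree hit b hist t).bind (touch hit b u) := by
  rw [sampleTree, forTree, Function.update_self, sampleTree]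
  congr 1
  exact forTree_congr (fun j hj => by rw [Function.update_of_ne hj.ne]) _

/-! ### Progress of the history -/

section Progress

variable (f : Finset (Fin n) → ℝ)

/-- The expected change of `f` when `u` is toggled in a sample. -/
noncomputable def effect (b : ℕ) (hist : ℕ → Fin n) (t : ℕ) (u : Fin n) : ℝ :=
  (sampleTree coinHit b hist t).expect fun S => f (toggle u S) - f S

/-- The variance of a sum of independent samples. -/
theorem expect_estimateTree_sq_le {C : ℝ} (hf : ∀ S, 0 ≤ f S) (hC : ∀ S, f S ≤ C) (b : ℕ)
    (hist : ℕ → Fin n) (t m : ℕ) (u : Fin n) :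
    ((estimateTree f b hist t m).expect fun W => (W u - m * effect f b hist t u) ^ 2)
      ≤ m * C ^ 2 := by
  induction m with
  | zero => simp [estimateTree, forTree]
  | succ m ih =>
    rw [estimateTree, forTree, expect_bind]
    rw [estimateTree] at ih
    set w := effect f b hist t u with hw
    have step : ∀ W : Fin n → ℝ,
        (((sampleTree coinHit b hist t).bind fun S =>
          ret fun u => W u + (f (toggle u S) - f S)).expect fun W =>
            (W u - ((m + 1 : ℕ) : ℝ) * w) ^ 2) ≤ (W u - m * w) ^ 2 + C ^ 2 := by
      intro W
      rw [expect_bind]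
      have e : ∀ S : Finset (Fin n),
          (ret fun u => W u + (f (toggle u S) - f S) : CoinTree (Fin n → ℝ)).expect
            (fun W => (W u - ((m + 1 : ℕ) : ℝ) * w) ^ 2) =
          ((W u - m * w) ^ 2 + w ^ 2 - 2 * (W u - m * w) * w) +
            (2 * (W u - m * w) - 2 * w) * (f (toggle u S) - f S) +
              (f (toggle u S) - f S) ^ 2 := by
        intro S
        rw [expect_ret]
        push_cast
        ring
      simp only [e]
      rw [expect_add, expect_add, expect_const, expect_mul]
      have h1 : ((sampleTree coinHit b hist t).expect fun S => f (toggle u S) - f S) = w := rfl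
      have h2 : ((sampleTree coinHit b hist t).expect fun S => (f (toggle u S) - f S) ^ 2)
          ≤ C ^ 2 := by
        refine (expect_mono _ (ψ := fun _ => C ^ 2) fun S => ?_).trans (expect_const _ _).le
        have a1 := hf S
        have a2 := hC S
        have a3 := hf (toggle u S)
        have a4 := hC (toggle u S)
        exact sq_le_sq' (by linarith) (by linarith)
      rw [h1]
      nlinarith [sq_nonneg w]
    refine (expect_mono _ step).trans ?_
    rw [expect_add, expect_const]
    push_cast
    linarith

/-- The accuracy of the estimates from `n ^ 8` samples. -/
theorem expect_sum_abs_le [NeZero n] {C : ℝ} (hf : ∀ S, 0 ≤ f S) (hC : ∀ S, f S ≤ C) (hC0 : 0 < C)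
    (b : ℕ) (hist : ℕ → Fin n) (t : ℕ) :
    ((estimateTree f b hist t (n ^ 8)).expect fun W =>
      ∑ u, |W u / (n : ℝ) ^ 8 - effect f b hist t u|) ≤ C / (n : ℝ) ^ 3 := by
  have hn : (0 : ℝ) < n := by exact_mod_cast Nat.pos_of_ne_zero (NeZero.ne n)
  rw [expect_sum]
  have key : ∀ u : Fin n, ((estimateTree f b hist t (n ^ 8)).expect fun W =>
      |W u / (n : ℝ) ^ 8 - effect f b hist t u|) ≤ C / (n : ℝ) ^ 4 := by
    intro u
    set w := effect f b hist t u
    -- `|x| ≤ x ^ 2 / (2 d) + d / 2` with the standard deviation `d = C / n ^ 4`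
    have h1 : ∀ W : Fin n → ℝ, |W u / (n : ℝ) ^ 8 - w| ≤
        1 / (2 * C * (n : ℝ) ^ 12) * (W u - ((n ^ 8 : ℕ) : ℝ) * w) ^ 2 + C / (n : ℝ) ^ 4 / 2 := by
      intro W
      set x := |W u / (n : ℝ) ^ 8 - w| with hx
      have hsq : (W u - ((n ^ 8 : ℕ) : ℝ) * w) ^ 2 = (n : ℝ) ^ 16 * x ^ 2 := by
        rw [hx, sq_abs]
        push_cast
        field_simp
      rw [hsq]
      have e : 1 / (2 * C * (n : ℝ) ^ 12) * ((n : ℝ) ^ 16 * x ^ 2) + C / (n : ℝ) ^ 4 / 2 - x =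
          (n : ℝ) ^ 4 / (2 * C) * (x - C / (n : ℝ) ^ 4) ^ 2 := by
        field_simp
        ring
      have : 0 ≤ (n : ℝ) ^ 4 / (2 * C) * (x - C / (n : ℝ) ^ 4) ^ 2 := by positivity
      linarith
    refine (expect_mono _ h1).trans ?_
    rw [expect_add, expect_mul, expect_const]
    have h2 := expect_estimateTree_sq_le f hf hC b hist t (n ^ 8) u
    have h3 : 1 / (2 * C * (n : ℝ) ^ 12) *
        ((estimateTree f b hist t (n ^ 8)).expect fun W => (W u - ((n ^ 8 : ℕ) : ℝ) * w) ^ 2) ≤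
        1 / (2 * C * (n : ℝ) ^ 12) * (((n ^ 8 : ℕ) : ℝ) * C ^ 2) := by gcongr
    have e : 1 / (2 * C * (n : ℝ) ^ 12) * (((n ^ 8 : ℕ) : ℝ) * C ^ 2) = C / (n : ℝ) ^ 4 / 2 := by
      push_cast
      field_simp
    linarith
  refine (Finset.sum_le_sum fun u _ => key u).trans ?_
  rw [Finset.sum_const, Finset.card_univ, Fintype.card_fin, nsmul_eq_mul]
  have : (n : ℝ) * (C / (n : ℝ) ^ 4) = C / (n : ℝ) ^ 3 := by field_simp
  exact this.le

theorem expect_extendTree [NeZero n] {C : ℝ} (hf : ∀ S, 0 ≤ f S) (hsym : IsSymmetricFn f)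
    (hsub : IsSubmodular f) (hC : ∀ S, f S ≤ C) (hC0 : 0 < C) {b : ℕ} (hb : b ≤ n)
    (O : Finset (Fin n)) (hO : 0 < O.card) (t : ℕ) (hist : ℕ → Fin n) :
    (sampleTree coinHit b hist t).expect f + (1 / 2) ^ b / 2 *
        ((f O - 2 * (sampleTree coinHit b hist t).expect f) / O.card - C / (n : ℝ) ^ 3) ≤
      (extendTree f b t hist).expect fun hist' =>
        (sampleTree coinHit b hist' (t + 1)).expect f := by
  set Φ := (sampleTree coinHit b hist t).expect f with hΦ
  set w := effect f b hist t with hw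
  have hO' : (0 : ℝ) < O.card := by exact_mod_cast hO
  have hn8 : (0 : ℝ) < (n : ℝ) ^ 8 := by
    have : (0 : ℝ) < n := by exact_mod_cast Nat.pos_of_ne_zero (NeZero.ne n)
    positivity
  rw [extendTree, expect_bind]
  simp only [expect_ret, sampleTree_update]
  have e1 : ∀ u, ((sampleTree coinHit b hist t).bind (touch coinHit b u)).expect f =
      Φ + (1 / 2) ^ b / 2 * w u := by
    intro u
    rw [expect_bind]
    simp only [expect_touch_coinHit hb]
    rw [expect_add, expect_mul]
    rfl
  simp only [e1]
  have hgain : f O - 2 * Φ ≤ ∑ u ∈ O, w u := by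
    have h1 := expect_mono (sampleTree coinHit b hist t)
      (fun S => sub_le_sum_toggle hf hsym hsub S O)
    rw [expect_sum, expect_sub, expect_const, expect_mul] at h1
    exact h1
  have hbest : ∀ W : Fin n → ℝ, (f O - 2 * Φ) / O.card -
      ∑ u, |W u / (n : ℝ) ^ 8 - w u| ≤ w (argmax W) := by
    intro W
    set a := argmax W with ha
    have hv : ∀ v, w v ≤ w a + ∑ u, |W u / (n : ℝ) ^ 8 - w u| := by
      intro v
      by_cases hva : v = a
      · rw [hva]
        have : 0 ≤ ∑ u, |W u / (n : ℝ) ^ 8 - w u| := Finset.sum_nonneg fun _ _ => abs_nonneg _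
        linarith
      · have h1 : |W v / (n : ℝ) ^ 8 - w v| + |W a / (n : ℝ) ^ 8 - w a| ≤
            ∑ u, |W u / (n : ℝ) ^ 8 - w u| := by
          rw [← Finset.sum_pair (f := fun u => |W u / (n : ℝ) ^ 8 - w u|) hva]
          exact Finset.sum_le_sum_of_subset_of_nonneg (Finset.subset_univ _)
            fun _ _ _ => abs_nonneg _
        have h2 : W v / (n : ℝ) ^ 8 ≤ W a / (n : ℝ) ^ 8 := by
          gcongr
          exact le_argmax W v
        have h3 := neg_abs_le (W v / (n : ℝ) ^ 8 - w v)
        have h4 := le_abs_self (W a / (n : ℝ) ^ 8 - w a)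
        linarith
    have h5 : ∑ u ∈ O, w u ≤ O.card * (w a + ∑ u, |W u / (n : ℝ) ^ 8 - w u|) := by
      rw [← nsmul_eq_mul, ← Finset.sum_const]
      exact Finset.sum_le_sum fun u _ => hv u
    have h6 : (f O - 2 * Φ) / O.card ≤ w a + ∑ u, |W u / (n : ℝ) ^ 8 - w u| := by
      rw [div_le_iff₀ hO']
      linarith
    linarith
  have h7 := expect_mono (estimateTree f b hist t (n ^ 8)) hbest
  rw [expect_sub, expect_const] at h7
  have h8 := expect_sum_abs_le f hf hC hC0 b hist t
  rw [expect_add, expect_const, expect_mul]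
  have h9 : (0 : ℝ) ≤ (1 / 2) ^ b / 2 := by positivity
  have h10 : (f O - 2 * Φ) / O.card - C / (n : ℝ) ^ 3 ≤
      (estimateTree f b hist t (n ^ 8)).expect fun W => w (argmax W) := by linarith
  gcongr

theorem expect_historyTree [NeZero n] {C : ℝ} (hf : ∀ S, 0 ≤ f S) (hsym : IsSymmetricFn f)
    (hsub : IsSubmodular f) (hC : ∀ S, f S ≤ C) (hC0 : 0 < C) {b : ℕ} (hb : b ≤ n)
    (O : Finset (Fin n)) (hO : 0 < O.card) (t : ℕ) :
    f O / 2 * (1 - (1 - (1 / 2) ^ b / O.card) ^ t) - t * ((1 / 2) ^ b / 2 * (C / (n : ℝ) ^ 3)) ≤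
      (historyTree f b t).expect fun hist => (sampleTree coinHit b hist t).expect f := by
  have hO' : (0 : ℝ) < O.card := by exact_mod_cast hO
  have hO1 : (1 : ℝ) ≤ O.card := by exact_mod_cast hO
  set ε : ℝ := (1 / 2) ^ b with hε
  have hε0 : 0 ≤ ε := by positivity
  have hε1 : ε ≤ 1 := pow_le_one₀ (by norm_num) (by norm_num)
  have hδ : 0 ≤ C / (n : ℝ) ^ 3 := by positivity
  have hq0 : 0 ≤ ε / O.card := by positivity
  have hq1 : ε / O.card ≤ 1 := by rw [div_le_one hO']; linarith
  induction t with
  | zero => simpa [historyTree, forTree, sampleTree] using hf ∅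
  | succ t ih =>
    rw [historyTree, forTree, expect_bind]
    rw [historyTree] at ih
    refine le_trans ?_ (expect_mono _
      fun hist => expect_extendTree f hf hsym hsub hC hC0 hb O hO t hist)
    set A := (forTree (extendTree f b) t fun _ => 0).expect fun hist =>
      (sampleTree coinHit b hist t).expect f with hA
    have e : ((forTree (extendTree f b) t fun _ => 0).expect fun hist =>
        (sampleTree coinHit b hist t).expect f + (1 / 2) ^ b / 2 *
        ((f O - 2 * (sampleTree coinHit b hist t).expect f) / O.card - C / (n : ℝ) ^ 3)) =
        (1 - ε / O.card) * A + ε / 2 * (f O / O.card - C / (n : ℝ) ^ 3) := by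
      rw [hA, ← expect_mul, ← expect_const (forTree (extendTree f b) t fun _ => 0)
        (ε / 2 * (f O / O.card - C / (n : ℝ) ^ 3)), ← expect_add]
      congr 1
      funext hist
      rw [← hε]
      field_simp
      ring
    rw [e]
    have h1 := mul_le_mul_of_nonneg_left ih (sub_nonneg.mpr hq1)
    have h2 : 0 ≤ ε / O.card * (t * (ε / 2 * (C / (n : ℝ) ^ 3))) := by positivity
    refine le_trans ?_ (add_le_add_left h1 _)
    have e2 : ε / 2 * (f O / O.card) = ε / O.card * (f O / 2) := by field_simp
    rw [mul_sub (ε / 2), e2]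
    push_cast
    rw [pow_succ]
    nlinarith [h2]

end Progress

end CardinalityMax

namespace CardinalityMax

variable {n : ℕ}

/-! ### The mean over the subsets of a set -/

/-- The mean of `φ` over the subsets of `T`, as a mean over the traces on `T` of all sets. -/
noncomputable def halfMean (φ : Finset (Fin n) → ℝ) (T : Finset (Fin n)) : ℝ :=
  (∑ R : Finset (Fin n), φ (T ∩ R)) / 2 ^ n

theorem sum_toggle (u : Fin n) (F : Finset (Fin n) → ℝ) : ∑ R, F (toggle u R) = ∑ R, F R :=
  Equiv.sum_comp (Function.Involutive.toPerm (toggle u) (toggle_toggle u)) F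

theorem sum_compl (F : Finset (Fin n) → ℝ) : ∑ R, F Rᶜ = ∑ R, F R :=
  Equiv.sum_comp (Function.Involutive.toPerm compl compl_compl) F

theorem halfMean_insert (φ : Finset (Fin n) → ℝ) (u : Fin n) (T : Finset (Fin n)) :
    halfMean φ (insert u T) = halfMean (fun S => (φ S + φ (toggle u S)) / 2) T := by
  have h1 : ∑ R, φ (insert u T ∩ R) =
      ∑ R, (φ (insert u T ∩ R) + φ (insert u T ∩ toggle u R)) / 2 := by
    rw [← Finset.sum_div, Finset.sum_add_distrib, sum_toggle u fun R => φ (insert u T ∩ R)]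
    ring
  rw [halfMean, halfMean, h1]
  congr 1
  refine Finset.sum_congr rfl fun R _ => ?_
  by_cases h : u ∈ T ↔ u ∈ R
  · by_cases hR : u ∈ R
    · have hT := h.mpr hR
      have e1 : insert u T ∩ R = T ∩ R := by rw [Finset.insert_eq_of_mem hT]
      have e2 : insert u T ∩ toggle u R = toggle u (T ∩ R) := by
        ext v; by_cases hv : v = u <;> simp [mem_toggle, hv, hR, hT]
      rw [e1, e2]
    · have hT : u ∉ T := fun hT => hR (h.mp hT)
      have e1 : insert u T ∩ R = T ∩ R := by
        ext v; by_cases hv : v = u <;> simp [hv, hR]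
      have e2 : insert u T ∩ toggle u R = toggle u (T ∩ R) := by
        ext v; by_cases hv : v = u <;> simp [mem_toggle, hv, hR]
      rw [e1, e2]
  · by_cases hR : u ∈ R
    · have hT : u ∉ T := by tauto
      have e1 : insert u T ∩ R = toggle u (T ∩ R) := by
        ext v; by_cases hv : v = u <;> simp [mem_toggle, hv, hR, hT]
      have e2 : insert u T ∩ toggle u R = T ∩ R := by
        ext v; by_cases hv : v = u <;> simp [mem_toggle, hv, hR, hT]
      rw [e1, e2, add_comm]
    · have hT : u ∈ T := by tauto
      have e1 : insert u T ∩ R = T ∩ R := by rw [Finset.insert_eq_of_mem hT]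
      have e2 : insert u T ∩ toggle u R = toggle u (T ∩ R) := by
        ext v; by_cases hv : v = u <;> simp [mem_toggle, hv, hR]
      rw [e1, e2]

/-- A sample is a uniformly random subset of the set of touched elements. -/
theorem expect_sampleTree_coinHit {b : ℕ} (hb : b ≤ n) (hist : ℕ → Fin n) (t : ℕ)
    (φ : Finset (Fin n) → ℝ) :
    (sampleTree coinHit b hist t).expect φ =
      (sampleTree insertHit b hist t).expect (halfMean φ) := by
  induction t generalizing φ with
  | zero =>
    simp only [sampleTree, forTree, expect_ret, halfMean, Finset.empty_inter, Finset.sum_const,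
      Finset.card_univ, Fintype.card_finset, Fintype.card_fin, nsmul_eq_mul]
    push_cast
    field_simp
  | succ t ih =>
    rw [sampleTree_succ, expect_bind, ih, sampleTree_succ, expect_bind]
    congr 1
    funext T
    rw [expect_touch hb, insertHit, expect_ret, halfMean_insert]
    simp only [halfMean, expect_touch hb, expect_coinHit, Finset.sum_add_distrib, ← Finset.mul_sum]
    ring

/-- For a symmetric submodular function, the mean over the subsets of a set is monotone in the set:
the marginal values of `u` at two disjoint sets have a non-negative sum. -/
theorem halfMean_le_insert {f : Finset (Fin n) → ℝ} (hsym : IsSymmetricFn f)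
    (hsub : IsSubmodular f) (u : Fin n) (T : Finset (Fin n)) :
    halfMean f T ≤ halfMean f (insert u T) := by
  by_cases hu : u ∈ T
  · rw [Finset.insert_eq_of_mem hu]
  rw [halfMean_insert]
  refine div_le_div_of_nonneg_right ?_ (by positivity)
  have h1 : ∑ R, f (T ∩ R) ≤ ∑ R, f (toggle u (T ∩ R)) := by
    have h2 : ∑ R, (f (T ∩ R) + f (T ∩ Rᶜ)) ≤
        ∑ R, (f (toggle u (T ∩ R)) + f (toggle u (T ∩ Rᶜ))) := by
      refine Finset.sum_le_sum fun R _ => ?_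
      have h3 := hsub (toggle u (T ∩ R)) (toggle u (T ∩ Rᶜ))ᶜ
      have e1 : toggle u (T ∩ R) ∪ (toggle u (T ∩ Rᶜ))ᶜ = (T ∩ Rᶜ)ᶜ := by
        ext v
        by_cases hv : v = u
        · simp [mem_toggle, hv, hu]
        · simp [mem_toggle, hv]
          tauto
      have e2 : toggle u (T ∩ R) ∩ (toggle u (T ∩ Rᶜ))ᶜ = T ∩ R := by
        ext v
        by_cases hv : v = u
        · simp [mem_toggle, hv, hu]
        · simp [mem_toggle, hv]
          tauto
      rw [e1, e2, hsym, hsym] at h3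
      linarith
    rw [Finset.sum_add_distrib, Finset.sum_add_distrib, sum_compl fun R => f (T ∩ R),
      sum_compl fun R => f (toggle u (T ∩ R))] at h2
    linarith
  rw [← Finset.sum_div, Finset.sum_add_distrib]
  linarith

theorem halfMean_le_fillUpTo {f : Finset (Fin n) → ℝ} (hsym : IsSymmetricFn f)
    (hsub : IsSubmodular f) (k : ℕ) (T : Finset (Fin n)) (j : ℕ) :
    halfMean f T ≤ halfMean f (fillUpTo k T j) := by
  induction j with
  | zero => rfl
  | succ j ih =>
    rw [fillUpTo]
    split_ifs
    · exact ih.trans (halfMean_le_insert hsym hsub _ _)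
    · exact ih
    · exact ih

theorem card_fillUpTo {k : ℕ} (hk : 2 * k ≤ n) (T : Finset (Fin n)) :
    (fillUpTo k T n).card = max T.card (2 * k) := by
  have key : ∀ j ≤ n, T.card ≤ (fillUpTo k T j).card ∧
      (fillUpTo k T j).card ≤ max T.card (2 * k) ∧
      ((fillUpTo k T j).card < 2 * k → ∀ u : Fin n, (u : ℕ) < j → u ∈ fillUpTo k T j) := by
    intro j
    induction j with
    | zero => intro _; exact ⟨le_rfl, le_max_left _ _, by simp⟩
    | succ j ih =>
      intro hj
      obtain ⟨h1, h2, h3⟩ := ih (by omega)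
      have hjn : j < n := by omega
      simp only [fillUpTo, hjn, dif_pos]
      split_ifs with h
      · have h4 := Finset.card_insert_le (⟨j, hjn⟩ : Fin n) (fillUpTo k T j)
        refine ⟨h1.trans (Finset.card_le_card (Finset.subset_insert _ _)), ?_, ?_⟩
        · have := le_max_right T.card (2 * k)
          omega
        · intro _ u hu
          rw [Finset.mem_insert]
          by_cases huj : (u : ℕ) = j
          · exact Or.inl (Fin.ext huj)
          · exact Or.inr (h3 (by omega) u (by omega))
      · exact ⟨h1, h2, fun h' => by omega⟩
  obtain ⟨h1, h2, h3⟩ := key n le_rfl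
  refine le_antisymm h2 (max_le h1 ?_)
  by_contra! h
  have : fillUpTo k T n = Finset.univ := Finset.eq_univ_of_forall fun u => h3 h u u.2
  rw [this, Finset.card_univ, Fintype.card_fin] at h
  omega

/-! ### Pairing -/

/-- The mean of `f` when each of the last `r` elements of the ground set is removed from `S` with
probability `1 / 2`. -/
noncomputable def suffixMean (f : Finset (Fin n) → ℝ) (r : ℕ) (S : Finset (Fin n)) : ℝ :=
  (∑ R : Finset (Fin n), f (S \ R.filter fun v : Fin n => n ≤ v + r)) / 2 ^ n

theorem suffixMean_zero (f : Finset (Fin n) → ℝ) (S : Finset (Fin n)) :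
    suffixMean f 0 S = f S := by
  have : ∀ R : Finset (Fin n), (R.filter fun v : Fin n => n ≤ v + 0) = ∅ := by
    intro R
    ext v
    have := v.2
    simp
  simp only [suffixMean, this, Finset.sdiff_empty, Finset.sum_const, Finset.card_univ,
    Fintype.card_finset, Fintype.card_fin, nsmul_eq_mul]
  push_cast
  field_simp

theorem suffixMean_self (f : Finset (Fin n) → ℝ) (S : Finset (Fin n)) :
    suffixMean f n S = halfMean f S := by
  rw [suffixMean, halfMean, ← sum_compl]
  congr 1
  refine Finset.sum_congr rfl fun R _ => ?_
  congr 1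
  ext v
  simp

theorem suffixMean_succ (f : Finset (Fin n) → ℝ) {r : ℕ} (hr : r < n) (S : Finset (Fin n)) :
    suffixMean f (r + 1) S =
      (suffixMean f r S + suffixMean f r (S.erase ⟨n - (r + 1), by omega⟩)) / 2 := by
  set u : Fin n := ⟨n - (r + 1), by omega⟩ with hu
  have hur : ∀ v : Fin n, n ≤ v + (r + 1) ↔ v = u ∨ n ≤ v + r := by
    intro v
    rw [Fin.ext_iff]
    simp only [hu]
    omega
  have hun : ¬ (n ≤ (u : ℕ) + r) := by simp only [hu]; omega
  have h1 : ∑ R : Finset (Fin n), f (S \ R.filter fun v : Fin n => n ≤ v + (r + 1)) =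
      ∑ R : Finset (Fin n), (f (S \ R.filter fun v : Fin n => n ≤ v + (r + 1)) +
        f (S \ (toggle u R).filter fun v : Fin n => n ≤ v + (r + 1))) / 2 := by
    rw [← Finset.sum_div, Finset.sum_add_distrib,
      sum_toggle u fun R => f (S \ R.filter fun v : Fin n => n ≤ v + (r + 1))]
    ring
  simp only [suffixMean]
  rw [h1, ← add_div, ← Finset.sum_add_distrib, ← Finset.sum_div]
  rw [div_right_comm]
  congr 2
  refine Finset.sum_congr rfl fun R _ => ?_
  by_cases hR : u ∈ R
  · rw [add_comm]
    congr 2 <;>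
    · ext v
      by_cases hv : v = u
      · subst hv; simp [mem_toggle, hur, hR, hun]
      · simp [mem_toggle, hur, hv]
  · congr 2 <;>
    · ext v
      by_cases hv : v = u
      · subst hv; simp [mem_toggle, hur, hR, hun]
      · simp [mem_toggle, hur, hv]

theorem isSubmodular_suffixMean {f : Finset (Fin n) → ℝ} (hsub : IsSubmodular f) (r : ℕ) :
    IsSubmodular (suffixMean f r) := by
  intro A B
  rw [suffixMean, suffixMean, suffixMean, suffixMean, ← add_div, ← add_div,
    ← Finset.sum_add_distrib, ← Finset.sum_add_distrib]
  refine div_le_div_of_nonneg_right (Finset.sum_le_sum fun R _ => ?_) (by positivity)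
  have := hsub (A \ R.filter fun v : Fin n => n ≤ v + r) (B \ R.filter fun v : Fin n => n ≤ v + r)
  have e : ∀ X : Finset (Fin n), (A \ X) ∩ (B \ X) = (A ∩ B) \ X := by
    intro X; ext; simp; tauto
  rwa [← Finset.union_sdiff_distrib, e] at this

/-- The expected value of `f` at the end, when the last `r` elements are still to be paired. -/
noncomputable def pairValue (f : Finset (Fin n) → ℝ) : ℕ → Finset (Fin n) × Option Bool → ℝ
  | 0, x => f x.1
  | r + 1, x => if h : n - (r + 1) < n then
      (pairStep ⟨n - (r + 1), h⟩ x).expect (pairValue f r) else pairValue f r x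

theorem expect_pairTree (f : Finset (Fin n) → ℝ) (T : Finset (Fin n)) :
    ((pairTree T).expect fun x => f x.1) = pairValue f n (T, none) := by
  have key : ∀ m ≤ n, (forTree (fun j x => if h : j < n then pairStep ⟨j, h⟩ x else ret x) m
      (T, none)).expect (pairValue f (n - m)) = pairValue f n (T, none) := by
    intro m
    induction m with
    | zero => intro _; rfl
    | succ m ih =>
      intro hm
      rw [← ih (by omega), forTree, expect_bind]
      congr 1
      funext x
      have hm' : m < n := by omega
      obtain ⟨r, hr⟩ : ∃ r, n - m = r + 1 := ⟨n - m - 1, by omega⟩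
      have h1 : n - (m + 1) = r := by omega
      have h2 : n - (r + 1) = m := by omega
      rw [h1, hr, pairValue]
      simp only [h2, hm', dif_pos]
  have := key n le_rfl
  rwa [Nat.sub_self] at this

/-- Keeping exactly one element of each pair is at least as good as independent choices: if `A` is
the set of the other choices, then `f (A ∪ {u}) + f (A ∪ {v}) ≥ f (A ∪ {u, v}) + f A`. -/
theorem suffixMean_le_pairValue {f : Finset (Fin n) → ℝ} (hsub : IsSubmodular f) (r : ℕ)
    (hr : r ≤ n) (S : Finset (Fin n)) :
    suffixMean f r S ≤ pairValue f r (S, none) ∧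
      ∀ a : Fin n, (a : ℕ) + r < n → suffixMean f r S + suffixMean f r (S.erase a) ≤
        pairValue f r (S.erase a, some false) + pairValue f r (S, some true) := by
  induction r generalizing S with
  | zero => simp [suffixMean_zero, pairValue]; intros; linarith
  | succ r ih =>
    have hr' : r < n := by omega
    have ih := ih hr'.le
    have hlt : n - (r + 1) < n := by omega
    set u : Fin n := ⟨n - (r + 1), hlt⟩ with hu
    have hus : ∀ S, suffixMean f (r + 1) S =
        (suffixMean f r S + suffixMean f r (S.erase u)) / 2 := suffixMean_succ f hr'
    have hpv : ∀ x, pairValue f (r + 1) x = (pairStep u x).expect (pairValue f r) := by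
      intro x
      rw [pairValue, dif_pos hlt]
    have hur : (u : ℕ) + r < n := by simp only [hu]; omega
    simp only [hus, hpv]
    by_cases hS : u ∈ S
    · refine ⟨?_, fun a ha => ?_⟩
      · have := (ih S).2 u hur
        simp only [pairStep, hS, if_true, expect_flip, expect_ret]
        linarith
      · have hau : u ≠ a := by
          intro h
          rw [← h] at ha
          simp only [hu] at ha
          omega
        have hS' : u ∈ S.erase a := Finset.mem_erase.mpr ⟨hau, hS⟩
        simp only [pairStep, hS, hS', if_true, expect_ret]
        have h1 := (ih (S.erase a)).1
        have h2 := (ih (S.erase u)).1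
        have h3 := isSubmodular_suffixMean hsub r (S.erase a) (S.erase u)
        have e1 : S.erase a ∪ S.erase u = S := by
          ext v
          simp only [Finset.mem_union, Finset.mem_erase]
          constructor
          · tauto
          · intro hv
            by_cases h : v = a
            · exact Or.inr ⟨fun h' => hau (h' ▸ h), hv⟩
            · exact Or.inl ⟨h, hv⟩
        have e2 : S.erase a ∩ S.erase u = (S.erase a).erase u := by
          ext v
          simp only [Finset.mem_inter, Finset.mem_erase]
          tauto
        rw [e1, e2] at h3
        linarith
    · rw [Finset.erase_eq_of_notMem hS]
      refine ⟨?_, fun a ha => ?_⟩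
      · have := (ih S).1
        simp only [pairStep, hS, if_false, expect_ret]
        linarith
      · have hS' : u ∉ S.erase a := fun h => hS (Finset.mem_of_mem_erase h)
        rw [Finset.erase_eq_of_notMem hS']
        have := (ih S).2 a (by omega)
        simp only [pairStep, hS, hS', if_false, expect_ret]
        linarith

theorem halfMean_le_expect_pairTree {f : Finset (Fin n) → ℝ} (hsub : IsSubmodular f)
    (T : Finset (Fin n)) : halfMean f T ≤ (pairTree T).expect fun x => f x.1 := by
  rw [expect_pairTree, ← suffixMean_self]
  exact (suffixMean_le_pairValue hsub n le_rfl T).1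

theorem all_card_pairTree (T : Finset (Fin n)) :
    (pairTree T).All fun x => T.card ≤ 2 * x.1.card + 1 ∧ 2 * x.1.card ≤ T.card + 1 := by
  have key := all_forTree (m := n) (s := (T, none))
    (A := fun j x => if h : j < n then pairStep (n := n) ⟨j, h⟩ x else ret x)
    (P := fun j x => (∀ v : Fin n, j ≤ v → (v ∈ x.1 ↔ v ∈ T)) ∧
      (x.2 = none → 2 * x.1.card = T.card + (T.filter fun v : Fin n => j ≤ v).card) ∧
      (x.2 = some true → 2 * x.1.card = T.card + (T.filter fun v : Fin n => j ≤ v).card + 1) ∧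
      (x.2 = some false → 2 * x.1.card + 1 = T.card + (T.filter fun v : Fin n => j ≤ v).card))
    ?_ ?_
  · refine key.mono ?_
    rintro ⟨S, p⟩ ⟨-, h1, h2, h3⟩
    have e : (T.filter fun v : Fin n => n ≤ v).card = 0 := by
      rw [Finset.card_eq_zero]
      ext v
      have := v.2
      simp
    rw [e] at h1 h2 h3
    rcases p with _ | _ | _
    · have := h1 rfl; simp only at this ⊢; omega
    · have := h3 rfl; simp only at this ⊢; omega
    · have := h2 rfl; simp only at this ⊢; omega
  · simp; omega
  · rintro j hj ⟨S, p⟩ ⟨h0, h1, h2, h3⟩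
    simp only [hj, dif_pos, pairStep]
    simp only at h0 h1 h2 h3
    set u : Fin n := ⟨j, hj⟩ with hu
    have huT : u ∈ S ↔ u ∈ T := h0 u le_rfl
    have hv : ∀ v : Fin n, j + 1 ≤ v → v ≠ u ∧ j ≤ v := by
      intro v hv
      refine ⟨fun h => ?_, by omega⟩
      rw [h] at hv
      simp [hu] at hv
    have hcard : (T.filter fun v : Fin n => j ≤ v).card =
        (T.filter fun v : Fin n => j + 1 ≤ v).card + if u ∈ T then 1 else 0 := by
      by_cases h : u ∈ T
      · have e : (T.filter fun v : Fin n => j ≤ v) =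
            insert u (T.filter fun v : Fin n => j + 1 ≤ v) := by
          ext v
          simp only [Finset.mem_filter, Finset.mem_insert]
          by_cases hvu : v = u
          · rw [hvu]; simp [hu]; exact h
          · have : (v : ℕ) ≠ j := fun h => hvu (Fin.ext h)
            simp only [hvu, false_or]
            constructor <;> rintro ⟨h1, h2⟩ <;> exact ⟨h1, by omega⟩
        rw [e, Finset.card_insert_of_notMem (by simp [hu]), if_pos h]
      · have e : (T.filter fun v : Fin n => j ≤ v) = T.filter fun v : Fin n => j + 1 ≤ v := by
          ext v
          simp only [Finset.mem_filter]
          constructor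
          · rintro ⟨h1, h2⟩
            have : (v : ℕ) ≠ j := fun h' => h (by rwa [show u = v from Fin.ext h'.symm])
            exact ⟨h1, by omega⟩
          · rintro ⟨h1, h2⟩
            exact ⟨h1, by omega⟩
        rw [e, if_neg h, add_zero]
    have h0' : ∀ v : Fin n, j + 1 ≤ v → (v ∈ S ↔ v ∈ T) := fun v h => h0 v (hv v h).2
    have h0'' : ∀ v : Fin n, j + 1 ≤ v → (v ∈ S.erase u ↔ v ∈ T) := fun v h => by
      rw [Finset.mem_erase, h0' v h]
      exact and_iff_right (hv v h).1
    by_cases hS : u ∈ S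
    · rw [if_pos (huT.mp hS)] at hcard
      have hpos : 0 < S.card := Finset.card_pos.mpr ⟨u, hS⟩
      have he := Finset.card_erase_of_mem hS
      rw [if_pos hS]
      rcases p with _ | _ | _
      · have := h1 rfl
        refine ⟨⟨h0'', by simp, by simp, fun _ => ?_⟩, h0', by simp, fun _ => ?_, by simp⟩
        · change 2 * (S.erase u).card + 1 = _
          omega
        · change 2 * S.card = _
          omega
      · have := h3 rfl
        refine ⟨h0', fun _ => ?_, by simp, by simp⟩
        change 2 * S.card = _
        omega
      · have := h2 rfl
        refine ⟨h0'', fun _ => ?_, by simp, by simp⟩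
        change 2 * (S.erase u).card = _
        omega
    · rw [if_neg fun h => hS (huT.mpr h), add_zero] at hcard
      rw [if_neg hS]
      rw [hcard] at h1 h2 h3
      exact ⟨h0', h1, h2, h3⟩

/-! ### Trimming -/

theorem trimStep_card [NeZero n] {f : Finset (Fin n) → ℝ} (hf : ∀ S, 0 ≤ f S) {k : ℕ}
    {S : Finset (Fin n)} (h : k + 1 ≤ S.card) : (trimStep f k S).card = S.card - 1 ∧
      ∀ v ∈ S, f (S.erase v) ≤ f (trimStep f k S) := by
  set W : Fin n → ℝ := fun u => if u ∈ S then f (S.erase u) else -1 with hW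
  have hmem : argmax W ∈ S := by
    by_contra hn
    obtain ⟨v, hv⟩ := Finset.card_pos.mp (show 0 < S.card by omega)
    have h1 := le_argmax W v
    have h2 : W v = f (S.erase v) := if_pos hv
    have h3 : W (argmax W) = -1 := if_neg hn
    have h4 := hf (S.erase v)
    linarith
  have e : trimStep f k S = S.erase (argmax W) := if_pos h
  rw [e]
  refine ⟨Finset.card_erase_of_mem hmem, fun v hv => ?_⟩
  have h1 := le_argmax W v
  have h2 : W v = f (S.erase v) := if_pos hv
  have h3 : W (argmax W) = f (S.erase (argmax W)) := if_pos hmem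
  linarith

theorem mul_le_trimStep [NeZero n] {f : Finset (Fin n) → ℝ} (hf : ∀ S, 0 ≤ f S)
    (hsym : IsSymmetricFn f) (hsub : IsSubmodular f) {k : ℕ} {S : Finset (Fin n)}
    (h : k + 1 ≤ S.card) : f S * (S.card - 1) ≤ f (trimStep f k S) * S.card := by
  have h1 := sdiff_sub_le hsym hsub S S (Finset.Subset.refl S)
  rw [Finset.sum_sub_distrib, Finset.sum_const, nsmul_eq_mul, Finset.sdiff_self] at h1
  have h2 := hf ∅
  have h3 := Finset.sum_le_sum (trimStep_card hf h).2
  rw [Finset.sum_const, nsmul_eq_mul] at h3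
  linarith

theorem iterate_trimStep [NeZero n] {f : Finset (Fin n) → ℝ} (hf : ∀ S, 0 ≤ f S)
    (hsym : IsSymmetricFn f) (hsub : IsSubmodular f) {k : ℕ} {S : Finset (Fin n)}
    (h : k ≤ S.card) (j : ℕ) : ((trimStep f k)^[j] S).card = max (S.card - j) k ∧
      f S * ((trimStep f k)^[j] S).card ≤ f ((trimStep f k)^[j] S) * S.card := by
  induction j with
  | zero => simp [h]
  | succ j ih =>
    rw [Function.iterate_succ_apply']
    set S' := (trimStep f k)^[j] S
    by_cases hk : k + 1 ≤ S'.card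
    · have h1 := (trimStep_card hf hk).1
      have h2 := mul_le_trimStep hf hsym hsub hk
      refine ⟨by omega, ?_⟩
      have hpos : (0 : ℝ) < S'.card := by
        have : 0 < S'.card := by omega
        exact_mod_cast this
      have h1' : ((trimStep f k S').card : ℝ) = S'.card - 1 := by
        rw [h1, Nat.cast_sub (by omega), Nat.cast_one]
      rw [h1']
      have hc : (0 : ℝ) ≤ S'.card - 1 := by
        have : 1 ≤ S'.card := by omega
        have : (1 : ℝ) ≤ S'.card := by exact_mod_cast this
        linarith
      have h3 := mul_le_mul_of_nonneg_right ih.2 hc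
      have h4 := mul_le_mul_of_nonneg_right h2 (Nat.cast_nonneg (α := ℝ) S.card)
      refine le_of_mul_le_mul_right ?_ hpos
      linarith
    · have e : trimStep f k S' = S' := if_neg hk
      rw [e]
      exact ⟨by omega, ih.2⟩

/-! ### Rounding the set of touched elements -/

theorem all_card_roundTree [NeZero n] {f : Finset (Fin n) → ℝ} (hf : ∀ S, 0 ≤ f S)
    (hsym : IsSymmetricFn f) (hsub : IsSubmodular f) {k : ℕ} (hk : 2 * k ≤ n)
    (T : Finset (Fin n)) : (roundTree f k T).All fun S => S.card = k := by
  refine (all_card_pairTree _).bind fun x hx => ?_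
  rw [card_fillUpTo hk] at hx
  have hS := (iterate_trimStep hf hsym hsub (k := k) (S := x.1) (by omega) n).1
  have := Finset.card_le_univ x.1
  rw [Fintype.card_fin] at this
  change ((trimStep f k)^[n] x.1).card = k
  omega

/-- Rounding loses only through the elements in excess of `2 * k`. -/
theorem halfMean_sub_le_expect_roundTree [NeZero n] {f : Finset (Fin n) → ℝ}
    (hf : ∀ S, 0 ≤ f S) (hsym : IsSymmetricFn f) (hsub : IsSubmodular f) {k : ℕ} (hk0 : 1 ≤ k)
    (hk : 2 * k ≤ n) {c : ℝ} (hc : ∀ A : Finset (Fin n), A.card = k → f A ≤ c)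
    (T : Finset (Fin n)) :
    halfMean f T - c / k * ((T.card - 2 * k : ℕ) : ℝ) ≤ (roundTree f k T).expect f := by
  have hk' : (0 : ℝ) < k := by exact_mod_cast hk0
  have h1 := (halfMean_le_fillUpTo hsym hsub k T n).trans
    (halfMean_le_expect_pairTree hsub (fillUpTo k T n))
  rw [roundTree, expect_bind]
  simp only [expect_ret]
  have h2 := expect_le_of_all (all_card_pairTree (fillUpTo k T n))
    (φ := fun x => f x.1 - c / k * ((T.card - 2 * k : ℕ) : ℝ))
    (ψ := fun x => f ((trimStep f k)^[n] x.1)) ?_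
  · rw [expect_sub, expect_const] at h2
    linarith
  · rintro ⟨S, p⟩ hS
    rw [card_fillUpTo hk] at hS
    simp only at hS ⊢
    obtain ⟨hcard, hval⟩ := iterate_trimStep hf hsym hsub (k := k) (S := S) (by omega) n
    have := Finset.card_le_univ S
    rw [Fintype.card_fin] at this
    have hcard' : ((trimStep f k)^[n] S).card = k := by omega
    rw [hcard'] at hval
    set v := f ((trimStep f k)^[n] S) with hv
    have hvc : v ≤ c := hc _ hcard'
    have hv0 : 0 ≤ v := hf _
    have hd : (S.card : ℝ) ≤ k + ((T.card - 2 * k : ℕ) : ℝ) := by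
      have : S.card ≤ k + (T.card - 2 * k) := by omega
      exact_mod_cast this
    set d := ((T.card - 2 * k : ℕ) : ℝ) with hd'
    have hd0 : 0 ≤ d := Nat.cast_nonneg _
    have h3 : f S * k ≤ (v + c / k * d) * k := by
      have e : (v + c / k * d) * k = v * k + c * d := by field_simp
      rw [e]
      nlinarith
    have := le_of_mul_le_mul_right h3 hk'
    linarith

/-! ### The number of touched elements -/

theorem all_card_sampleTree_insertHit (b : ℕ) (hist : ℕ → Fin n) (t : ℕ) :
    (sampleTree insertHit b hist t).All fun T => T.card ≤ t := by
  refine all_forTree (P := fun t (T : Finset (Fin n)) => T.card ≤ t) (by simp) fun j _ T hT => ?_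
  rw [touch]
  refine (all_of_forall (P := fun _ => True) (fun _ => trivial) _).bind fun x _ => ?_
  cases x
  · exact hT.trans (Nat.le_succ j)
  · exact (Finset.card_insert_le _ _).trans (by omega)

/-- The probability that `i` is not touched, if every occurrence in the history counts with
probability `ε`. -/
noncomputable def missProb (ε : ℝ) (hist : ℕ → Fin n) (t : ℕ) (i : Fin n) : ℝ :=
  ∏ j ∈ Finset.range t, if hist j = i then 1 - ε else 1

theorem expect_miss {b : ℕ} (hb : b ≤ n) (hist : ℕ → Fin n) (t : ℕ) (i : Fin n) :
    ((sampleTree insertHit b hist t).expect fun T => if i ∈ T then (0 : ℝ) else 1) =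
      missProb ((1 / 2) ^ b) hist t i := by
  induction t with
  | zero => simp [sampleTree, forTree, missProb]
  | succ t ih =>
    rw [sampleTree_succ, expect_bind, missProb, Finset.prod_range_succ, ← missProb, ← ih,
      mul_comm, ← expect_mul]
    congr 1
    funext T
    rw [expect_touch hb, insertHit, expect_ret]
    by_cases h1 : i = hist t
    · subst h1
      by_cases h2 : hist t ∈ T <;> simp [h2]
    · by_cases h2 : i ∈ T <;> simp [h1, h2, Ne.symm h1]

theorem expect_miss_mul_miss {b : ℕ} (hb : b ≤ n) (hist : ℕ → Fin n) (t : ℕ) {i j : Fin n}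
    (hij : i ≠ j) :
    ((sampleTree insertHit b hist t).expect fun T =>
      (if i ∈ T then (0 : ℝ) else 1) * if j ∈ T then (0 : ℝ) else 1) =
      missProb ((1 / 2) ^ b) hist t i * missProb ((1 / 2) ^ b) hist t j := by
  induction t with
  | zero => simp [sampleTree, forTree, missProb]
  | succ t ih =>
    have e : ∀ i, missProb ((1 / 2) ^ b) hist (t + 1) i =
        missProb ((1 / 2) ^ b) hist t i * if hist t = i then 1 - (1 / 2) ^ b else 1 :=
      fun i => Finset.prod_range_succ _ _
    rw [e, e, mul_mul_mul_comm, ← ih, sampleTree_succ, expect_bind, mul_comm, ← expect_mul]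
    congr 1
    funext T
    rw [expect_touch hb, insertHit, expect_ret]
    by_cases h1 : hist t = i
    · have h2 : hist t ≠ j := fun h => hij (h1.symm.trans h)
      by_cases h3 : i ∈ T <;> by_cases h4 : j ∈ T <;> simp [h1, hij, hij.symm, h3, h4]
    · by_cases h2 : hist t = j
      · by_cases h3 : i ∈ T <;> by_cases h4 : j ∈ T <;> simp [h2, hij, hij.symm, h3, h4]
      · by_cases h3 : i ∈ T <;> by_cases h4 : j ∈ T <;>
          simp [h1, h2, h3, h4, Ne.symm h1, Ne.symm h2]

/-- Different elements are touched independently, so the variance of the number of touched elements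
is at most its mean. -/
theorem expect_card_sub_sq_le {b : ℕ} (hb : b ≤ n) (hist : ℕ → Fin n) (t : ℕ) :
    ((sampleTree insertHit b hist t).expect fun T =>
      ((T.card : ℝ) - ∑ i, (1 - missProb ((1 / 2) ^ b) hist t i)) ^ 2) ≤
      ∑ i, (1 - missProb ((1 / 2) ^ b) hist t i) := by
  set P := missProb ((1 / 2) ^ b) hist t with hP
  have e : ∀ T : Finset (Fin n), ((T.card : ℝ) - ∑ i, (1 - P i)) ^ 2 =
      ∑ i, ∑ j, (P i - if i ∈ T then (0 : ℝ) else 1) * (P j - if j ∈ T then (0 : ℝ) else 1) := by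
    intro T
    have h1 : (T.card : ℝ) = ∑ i : Fin n, (1 - if i ∈ T then (0 : ℝ) else 1) := by
      have : ∀ i : Fin n, (1 - if i ∈ T then (0 : ℝ) else 1) = if i ∈ T then 1 else 0 := by
        intro i; split_ifs <;> simp
      simp [this]
    rw [h1, ← Finset.sum_sub_distrib, sq, Finset.sum_mul_sum]
    refine Finset.sum_congr rfl fun i _ => Finset.sum_congr rfl fun j _ => ?_
    ring
  simp only [e]
  rw [expect_sum]
  refine Finset.sum_le_sum fun i _ => ?_
  rw [expect_sum, Finset.sum_eq_single i]
  · have h1 : ∀ T : Finset (Fin n), (P i - if i ∈ T then (0 : ℝ) else 1) *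
        (P i - if i ∈ T then (0 : ℝ) else 1) =
        P i ^ 2 + (1 - 2 * P i) * if i ∈ T then (0 : ℝ) else 1 := by
      intro T
      split_ifs <;> ring
    simp only [h1]
    rw [expect_add, expect_const, expect_mul, expect_miss hb, ← hP]
    nlinarith [sq_nonneg (1 - P i)]
  · intro j _ hji
    have h1 : ∀ T : Finset (Fin n), (P i - if i ∈ T then (0 : ℝ) else 1) *
        (P j - if j ∈ T then (0 : ℝ) else 1) =
        P i * P j - P i * (if j ∈ T then (0 : ℝ) else 1) - P j * (if i ∈ T then (0 : ℝ) else 1) +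
          (if i ∈ T then (0 : ℝ) else 1) * (if j ∈ T then (0 : ℝ) else 1) := by
      intro T
      ring
    simp only [h1]
    rw [expect_add, expect_sub, expect_sub, expect_const, expect_mul, expect_mul, expect_miss hb,
      expect_miss hb, expect_miss_mul_miss hb _ _ hji.symm, ← hP]
    ring
  · simp

/-- By convexity, the expected number of touched elements is largest if all elements are equally
frequent in the history. -/
theorem sum_one_sub_missProb_le {l : ℝ} (hist : ℕ → Fin n) (t : ℕ) :
    ∑ i, (1 - missProb (1 - Real.exp (-l)) hist t i) ≤ n * (1 - Real.exp (-(l * t / n))) := by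
  rcases Nat.eq_zero_or_pos n with rfl | hn
  · simp
  have hn' : (0 : ℝ) < n := by exact_mod_cast hn
  set c : Fin n → ℝ := fun i => ∑ j ∈ Finset.range t, if hist j = i then 1 else 0 with hc
  have hP : ∀ i, missProb (1 - Real.exp (-l)) hist t i = Real.exp (-(l * c i)) := by
    intro i
    rw [missProb, hc, Finset.mul_sum, ← Finset.sum_neg_distrib, Real.exp_sum]
    refine Finset.prod_congr rfl fun j _ => ?_
    split_ifs <;> simp
  have hcs : ∑ i, c i = t := by
    rw [hc, Finset.sum_comm]
    simp
  have h1 : ∀ i, Real.exp (-(l * t / n)) * (1 - l * (c i - t / n)) ≤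
      missProb (1 - Real.exp (-l)) hist t i := by
    intro i
    rw [hP]
    have h2 := Real.add_one_le_exp (-(l * (c i - t / n)))
    calc Real.exp (-(l * t / n)) * (1 - l * (c i - t / n))
        ≤ Real.exp (-(l * t / n)) * Real.exp (-(l * (c i - t / n))) := by gcongr; linarith
      _ = Real.exp (-(l * c i)) := by rw [← Real.exp_add]; congr 1; ring
  have h2 := Finset.sum_le_sum fun i (_ : i ∈ Finset.univ) => h1 i
  rw [← Finset.mul_sum] at h2
  have h3 : ∑ i, (1 - l * (c i - t / n)) = n := by
    rw [Finset.sum_sub_distrib, ← Finset.mul_sum, Finset.sum_sub_distrib, hcs]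
    have h4 : (n : ℝ) * (t / n) = t := by field_simp
    simp [h4]
  rw [h3] at h2
  rw [Finset.sum_sub_distrib]
  simp
  linarith

end CardinalityMax

namespace CardinalityMax

/-! ### Numerical estimates -/

theorem exp_neg_le_one_sub {p : ℝ} (hp0 : 0 ≤ p) (hp : p ≤ 1 / 2) :
    Real.exp (-(p + p ^ 2)) ≤ 1 - p := by
  have h1 := Real.quadratic_le_exp_of_nonneg (show 0 ≤ p + p ^ 2 by positivity)
  rw [Real.exp_neg, inv_le_comm₀ (Real.exp_pos _) (by linarith), inv_eq_one_div,
    div_le_iff₀ (by linarith)]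
  have h2 : 1 ≤ (1 + (p + p ^ 2) + (p + p ^ 2) ^ 2 / 2) * (1 - p) := by
    have e : (1 + (p + p ^ 2) + (p + p ^ 2) ^ 2 / 2) * (1 - p) =
        1 + p ^ 2 / 2 * (1 - p - p ^ 2 - p ^ 3) := by ring
    have h3 : p ^ 2 ≤ 1 / 4 := by nlinarith
    have h4 : p ^ 3 ≤ 1 / 8 := by nlinarith
    have h5 : 0 ≤ p ^ 2 / 2 * (1 - p - p ^ 2 - p ^ 3) :=
      mul_nonneg (by positivity) (by linarith)
    linarith
  exact h2.trans (mul_le_mul_of_nonneg_right h1 (by linarith))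

theorem one_sub_le_exp_neg {z : ℝ} (hz0 : 0 ≤ z) (hz : z ≤ 1) :
    1 - z ≤ Real.exp (-(z + z ^ 2 / 2)) := by
  rcases hz.eq_or_lt with rfl | hz1
  · have := Real.exp_pos (-(1 + 1 ^ 2 / 2 : ℝ))
    linarith
  · have h := sum_le_hasSum (Finset.range 2) (fun i _ => by positivity)
      (Real.hasSum_pow_div_log_of_abs_lt_one (abs_lt.mpr ⟨by linarith, hz1⟩))
    simp [Finset.sum_range_succ] at h
    rw [← Real.exp_log (show 0 < 1 - z by linarith)]
    apply Real.exp_le_exp.mpr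
    norm_num at h
    linarith

/-- `(1 - k / n) ^ (2 * n / k)` is at least `exp (-2 - 2 * k / n)`. -/
theorem exp_le_rpow {n k : ℕ} (hk : 1 ≤ k) (hkn : 2 * k ≤ n) :
    Real.exp (-(2 + 2 * (k / n : ℝ))) ≤ (1 - (k : ℝ) / n) ^ (2 * (n : ℝ) / k) := by
  have hk' : (0 : ℝ) < k := by exact_mod_cast hk
  have hn' : (0 : ℝ) < n := by exact_mod_cast (show 0 < n by omega)
  have hkn' : 2 * (k : ℝ) ≤ n := by exact_mod_cast hkn
  have hp : (k : ℝ) / n ≤ 1 / 2 := by rw [div_le_iff₀ hn']; linarith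
  have h1 := exp_neg_le_one_sub (p := (k : ℝ) / n) (by positivity) hp
  have h2 := Real.rpow_le_rpow (Real.exp_nonneg _) h1 (show 0 ≤ 2 * (n : ℝ) / k by positivity)
  refine le_trans (le_of_eq ?_) h2
  rw [← Real.exp_mul]
  congr 1
  field_simp

theorem Parameters.le {n k b : ℕ} {lim : ℝ} (h : Parameters n k b lim) (hn : 1 ≤ n) : b ≤ n := by
  rcases lt_or_ge (2 * k * k) n with h1 | h1
  · rw [(h.small h1).1]; omega
  · obtain ⟨-, h2, -⟩ := h.large h1
    have h3 : 2 ^ b < 2 ^ (n + 1) := by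
      have := Nat.lt_two_pow_self (n := n)
      rw [pow_succ]
      omega
    exact Nat.lt_succ_iff.mp ((Nat.pow_lt_pow_iff_right (by norm_num)).mp h3)

/-- The total probability weight of the history, up to the rounding of the length: `2 * k` or
`2 * k + 2 * k ^ 2 / n`. -/
theorem Parameters.weight {n k b : ℕ} {lim : ℝ} (h : Parameters n k b lim) (hk : 1 ≤ k)
    (hkn : 2 * k ≤ n) :
    (2 * k ≤ lim * (1 / 2) ^ b ∧ lim * (1 / 2) ^ b ≤ 3 * k ∧ 0 ≤ lim) ∧
    (n ≤ 2 * k * k → lim * (1 / 2) ^ b = 2 * k + 2 * k ^ 2 / n) := by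
  have hk' : (0 : ℝ) < k := by exact_mod_cast hk
  have hn' : (0 : ℝ) < n := by exact_mod_cast (show 0 < n by omega)
  have hkn' : 2 * (k : ℝ) ≤ n := by exact_mod_cast hkn
  rcases lt_or_ge (2 * k * k) n with h1 | h1
  · obtain ⟨rfl, rfl⟩ := h.small h1
    refine ⟨⟨by simp, ?_, by positivity⟩, fun h' => by omega⟩
    simp
    linarith
  · obtain ⟨-, -, rfl⟩ := h.large h1
    have e : (2 : ℝ) ^ b * (2 * k * (n + k)) / n * (1 / 2) ^ b = 2 * k + 2 * k ^ 2 / n := by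
      rw [one_div, inv_pow]
      field_simp
    rw [e]
    have h2 : 2 * (k : ℝ) ^ 2 / n ≤ k := by
      rw [div_le_iff₀ hn']
      nlinarith
    have h3 : 0 ≤ 2 * (k : ℝ) ^ 2 / n := by positivity
    exact ⟨⟨by linarith, by linarith, by positivity⟩, fun _ => rfl⟩

/-- The error term is proportional to `n ^ (-1 / 4)`. -/
noncomputable def errorTerm (n : ℕ) : ℝ := 30 / Real.sqrt (Real.sqrt n)

theorem tendsto_errorTerm : Filter.Tendsto errorTerm Filter.atTop (nhds 0) := by
  refine Filter.Tendsto.const_div_atTop ?_ 30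
  exact Real.tendsto_sqrt_atTop.comp (Real.tendsto_sqrt_atTop.comp tendsto_natCast_atTop_atTop)

/-! ### The approximation guarantee -/

variable {n : ℕ}

theorem neg_log_one_sub_le {ε : ℝ} (h : ε ≤ 1 / 2) :
    -Real.log (1 - ε) ≤ ε * (1 + 2 * ε) := by
  have h2 := Real.one_sub_inv_le_log_of_pos (show 0 < 1 - ε by linarith)
  have h3 : (1 - ε)⁻¹ ≤ 1 + ε * (1 + 2 * ε) := by
    rw [inv_eq_one_div, div_le_iff₀ (by linarith)]
    have e : (1 + ε * (1 + 2 * ε)) * (1 - ε) = 1 + ε ^ 2 * (1 - 2 * ε) := by ring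
    have := mul_nonneg (sq_nonneg ε) (show 0 ≤ 1 - 2 * ε by linarith)
    linarith
  linarith

theorem one_sub_sub_le_exp_neg {p q x : ℝ} (hp : 0 ≤ p) (hp2 : p ≤ 1 / 2) (hq : 0 ≤ q)
    (hx : x ≤ 2 * p + 2 * p ^ 2 + q) : 1 - 2 * p - q ≤ Real.exp (-x) := by
  have h4 := one_sub_le_exp_neg (z := 2 * p) (by positivity) (by linarith)
  have e3 : 2 * p + (2 * p) ^ 2 / 2 = 2 * p + 2 * p ^ 2 := by ring
  rw [e3] at h4
  set a := Real.exp (-(2 * p + 2 * p ^ 2)) with ha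
  have h5 : a * Real.exp (-q) ≤ Real.exp (-x) := by
    rw [ha, ← Real.exp_add]
    apply Real.exp_le_exp.mpr
    linarith
  have h6 := Real.add_one_le_exp (-q)
  have h7 : a ≤ 1 := Real.exp_le_one_iff.mpr (by linarith [sq_nonneg p])
  have h9 : 0 ≤ a := Real.exp_nonneg _
  have h10 := mul_le_mul_of_nonneg_left h6 h9
  have h11 := mul_le_mul_of_nonneg_right h7 hq
  linarith

/-- The expected number of touched elements is at most `2 * k + 5` unless `2 * k ^ 2 < n`. -/
theorem sum_one_sub_missProb_le_two_mul {k b : ℕ} {lim : ℝ} (h : Parameters n k b lim)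
    (hk : 1 ≤ k) (hkn : 2 * k ≤ n) (h1 : n ≤ 2 * k * k) (hist : ℕ → Fin n) :
    ∑ i, (1 - missProb ((1 / 2) ^ b) hist ⌈lim⌉₊ i) ≤ 2 * (k : ℝ) + 5 := by
  have hk' : (0 : ℝ) < k := by exact_mod_cast hk
  have hn2 : 2 ≤ n := by omega
  have hn' : (0 : ℝ) < n := by exact_mod_cast (show 0 < n by omega)
  have hn2' : (2 : ℝ) ≤ n := by exact_mod_cast hn2
  have hkn' : 2 * (k : ℝ) ≤ n := by exact_mod_cast hkn
  obtain ⟨⟨-, hw3, hlim0⟩, hw⟩ := h.weight hk hkn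
  replace hw := hw h1
  set t := ⌈lim⌉₊ with ht
  set ε : ℝ := (1 / 2) ^ b with hε
  obtain ⟨hL, -, -⟩ := h.large h1
  have hε0 : 0 < ε := by positivity
  have hεn : ε * n ≤ 1 := by
    have hL' : (n : ℝ) ≤ 2 ^ b := by exact_mod_cast hL
    have e : ε * 2 ^ b = 1 := by rw [hε, ← mul_pow]; norm_num
    calc ε * n ≤ ε * 2 ^ b := by gcongr
      _ = 1 := e
  have hε2 : ε ≤ 1 / 2 := by
    have := mul_le_mul_of_nonneg_left hn2' hε0.le
    linarith
  -- the rate `l` for which a single occurrence is missed with probability `exp (-l)`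
  set l : ℝ := -Real.log (1 - ε) with hl
  have hexp : Real.exp (-l) = 1 - ε := by rw [hl, neg_neg, Real.exp_log (by linarith)]
  have hl1 : l ≤ ε * (1 + 2 * ε) := neg_log_one_sub_le hε2
  have htε : t * ε ≤ 2 * k + 2 * k ^ 2 / n + ε := by
    have h2 := (Nat.ceil_lt_add_one hlim0).le
    rw [← ht] at h2
    have h3 := mul_le_mul_of_nonneg_right h2 hε0.le
    linarith
  set p : ℝ := k / n with hp
  have hp0 : 0 ≤ p := by positivity
  have hp2 : p ≤ 1 / 2 := by rw [hp, div_le_iff₀ hn']; linarith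
  have hkp : (k : ℝ) = p * n := by rw [hp]; field_simp
  have htn : l * t / n ≤ 2 * p + 2 * p ^ 2 + 5 / n := by
    set a := 2 * p + 2 * p ^ 2 with ha
    have ha0 : 0 ≤ a := by positivity
    have ha1 : a ≤ 3 / 2 := by
      have := mul_le_mul hp2 hp2 hp0 (by norm_num)
      linarith [sq p]
    have e1 : 2 * (k : ℝ) + 2 * k ^ 2 / n = a * n := by
      rw [hkp, ha]; field_simp
    rw [e1] at htε
    have h2 : l * t ≤ (1 + 2 * ε) * (t * ε) := by
      have := mul_le_mul_of_nonneg_right hl1 (Nat.cast_nonneg (α := ℝ) t)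
      linarith
    have h3 : (1 + 2 * ε) * (t * ε) ≤ (1 + 2 * ε) * (a * n + ε) := by gcongr
    have h5 : a * (ε * n) ≤ 3 / 2 := by
      have := mul_le_mul ha1 hεn (by positivity) (by norm_num)
      linarith
    have h6 : ε * ε ≤ 1 / 4 := by
      have := mul_le_mul hε2 hε2 hε0.le (by norm_num)
      linarith
    rw [div_le_iff₀ hn']
    have e2 : (a + 5 / n) * n = a * n + 5 := by field_simp
    have e3 : (1 + 2 * ε) * (a * n + ε) = a * n + 2 * (a * (ε * n)) + ε + 2 * (ε * ε) := by ring
    linarith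
  have h2 := sum_one_sub_missProb_le (l := l) hist t
  rw [hexp, sub_sub_cancel] at h2
  have h3 := one_sub_sub_le_exp_neg hp0 hp2 (show 0 ≤ 5 / (n : ℝ) by positivity) htn
  have h4 : (n : ℝ) * (1 - Real.exp (-(l * t / n))) ≤ n * (2 * p + 5 / n) := by
    gcongr; linarith
  have e4 : (n : ℝ) * (2 * p + 5 / n) = 2 * k + 5 := by rw [hkp]; field_simp
  linarith

/-- The expected number of touched elements exceeds `2 * k` by `O(√k)`, and by nothing if
`2 * k ^ 2 < n`. -/
theorem expect_excess_le {k b : ℕ} {lim : ℝ} (h : Parameters n k b lim) (hk : 1 ≤ k)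
    (hkn : 2 * k ≤ n) (hist : ℕ → Fin n) :
    ((sampleTree insertHit b hist ⌈lim⌉₊).expect fun T => ((T.card - 2 * k : ℕ) : ℝ)) / k ≤
      20 / Real.sqrt (Real.sqrt n) := by
  have hk' : (0 : ℝ) < k := by exact_mod_cast hk
  have hk1 : (1 : ℝ) ≤ k := by exact_mod_cast hk
  have hn2 : 2 ≤ n := by omega
  have hn' : (0 : ℝ) < n := by exact_mod_cast (show 0 < n by omega)
  have hn2' : (2 : ℝ) ≤ n := by exact_mod_cast hn2
  have hkn' : 2 * (k : ℝ) ≤ n := by exact_mod_cast hkn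
  rcases lt_or_ge (2 * k * k) n with h1 | h1
  · obtain ⟨-, hlim⟩ := h.small h1
    have hceil : ⌈lim⌉₊ = 2 * k := by
      rw [hlim]; exact_mod_cast Nat.ceil_natCast (2 * k)
    have h2 : ((sampleTree insertHit b hist ⌈lim⌉₊).expect
        fun T => ((T.card - 2 * k : ℕ) : ℝ)) ≤ 0 := by
      rw [hceil, ← expect_const (sampleTree insertHit b hist (2 * k)) 0]
      refine expect_le_of_all (all_card_sampleTree_insertHit b hist (2 * k)) fun T hT => ?_
      rw [Nat.sub_eq_zero_of_le hT, Nat.cast_zero]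
    exact (div_nonpos_of_nonpos_of_nonneg h2 hk'.le).trans (by positivity)
  · set t := ⌈lim⌉₊ with ht
    set ε : ℝ := (1 / 2) ^ b with hε
    have hb := h.le (by omega)
    set μ := ∑ i, (1 - missProb ε hist t i) with hμ
    have hμ1 : μ ≤ 2 * k + 5 := sum_one_sub_missProb_le_two_mul h hk hkn h1 hist
    set s := Real.sqrt k with hs
    have hs1 : 1 ≤ s := Real.one_le_sqrt.mpr hk1
    have hss : s ^ 2 = k := Real.sq_sqrt hk'.le
    -- AM-GM bounds the excess by a quadratic, whose expectation is controlled by the variance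
    have hpoint : ∀ T : Finset (Fin n), ((T.card - 2 * k : ℕ) : ℝ) ≤
        1 / (2 * s) * ((T.card : ℝ) - μ) ^ 2 + (s / 2 + 5) := by
      intro T
      have h2 : (T.card : ℝ) - μ ≤ 1 / (2 * s) * ((T.card : ℝ) - μ) ^ 2 + s / 2 := by
        have e5 : 1 / (2 * s) * ((T.card : ℝ) - μ) ^ 2 + s / 2 - ((T.card : ℝ) - μ) =
            1 / (2 * s) * ((T.card : ℝ) - μ - s) ^ 2 := by field_simp; ring
        have : 0 ≤ 1 / (2 * s) * ((T.card : ℝ) - μ - s) ^ 2 := by positivity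
        linarith
      rcases le_total T.card (2 * k) with h3 | h3
      · rw [Nat.sub_eq_zero_of_le h3, Nat.cast_zero]
        positivity
      · rw [Nat.cast_sub h3]
        push_cast
        linarith
    have hE := expect_mono (sampleTree insertHit b hist t) hpoint
    rw [expect_add, expect_mul, expect_const] at hE
    have hvar := expect_card_sub_sq_le hb hist t
    rw [← hε, ← hμ] at hvar
    have h2 : 1 / (2 * s) * ((sampleTree insertHit b hist t).expect fun T =>
        ((T.card : ℝ) - μ) ^ 2) ≤ 1 / (2 * s) * (2 * s ^ 2 + 5) := by
      gcongr
      rw [hss]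
      exact hvar.trans hμ1
    have h3 : 1 / (2 * s) * (2 * s ^ 2 + 5) ≤ s + 5 / 2 := by
      rw [one_div, inv_mul_le_iff₀ (by positivity)]
      linarith [show 2 * s * (s + 5 / 2) = 2 * s ^ 2 + 5 * s by ring]
    have hE' : ((sampleTree insertHit b hist t).expect fun T => ((T.card - 2 * k : ℕ) : ℝ)) ≤
        10 * s := by linarith
    set r := Real.sqrt (Real.sqrt n) with hr
    have hr0 : 0 < r := Real.sqrt_pos.mpr (Real.sqrt_pos.mpr hn')
    have hr4 : r ^ 4 = n := by
      have e6 : r ^ 4 = (r ^ 2) ^ 2 := by ring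
      rw [e6, Real.sq_sqrt (Real.sqrt_nonneg _), Real.sq_sqrt hn'.le]
    have hrs : r ≤ 2 * s := by
      refine le_of_pow_le_pow_left₀ (n := 4) (by norm_num) (by positivity) ?_
      rw [hr4]
      have h4 : (n : ℝ) ≤ 2 * k * k := by exact_mod_cast h1
      have e7 : (2 * s) ^ 4 = 16 * (s ^ 2) ^ 2 := by ring
      rw [e7, hss]
      nlinarith
    rw [div_le_div_iff₀ hk' hr0, ← hss]
    nlinarith

theorem all_card_resultTree [NeZero n] {f : Finset (Fin n) → ℝ} (hf : ∀ S, 0 ≤ f S)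
    (hsym : IsSymmetricFn f) (hsub : IsSubmodular f) (b t : ℕ) {k : ℕ} (hkn : 2 * k ≤ n) :
    (resultTree f b t k).All fun S => S.card = k :=
  All.bind (P := fun _ => True) (all_of_forall (fun _ => trivial) _) fun _ _ =>
    All.bind (P := fun _ => True) (all_of_forall (fun _ => trivial) _) fun T _ =>
      all_card_roundTree hf hsym hsub hkn T

/-- The guarantee for `k ≤ n / 2`: of the constant `30` in the error term, `20` accounts for the
rounding, `4` for the estimates, and `1` for the exponential in the ratio. -/
theorem le_expect_resultTree [NeZero n] {f : Finset (Fin n) → ℝ} (hf : ∀ S, 0 ≤ f S)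
    (hsym : IsSymmetricFn f) (hsub : IsSubmodular f) {k b : ℕ} {lim : ℝ}
    (h : Parameters n k b lim) (hk : 1 ≤ k) (hkn : 2 * k ≤ n) {O : Finset (Fin n)}
    (hO : O.card = k) (hmax : ∀ A : Finset (Fin n), A.card = k → f A ≤ f O) :
    (symmetricRatio n k - errorTerm n) * f O ≤ (resultTree f b ⌈lim⌉₊ k).expect f := by
  have hk' : (0 : ℝ) < k := by exact_mod_cast hk
  have hk1 : (1 : ℝ) ≤ k := by exact_mod_cast hk
  have hn' : (0 : ℝ) < n := by exact_mod_cast (show 0 < n by omega)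
  have hn2' : (2 : ℝ) ≤ n := by exact_mod_cast (show 2 ≤ n by omega)
  have hkn' : 2 * (k : ℝ) ≤ n := by exact_mod_cast hkn
  have hb := h.le (show 1 ≤ n by omega)
  rcases (hf O).eq_or_lt with h0 | h0
  · rw [← h0, mul_zero, ← expect_const (resultTree f b ⌈lim⌉₊ k) 0]
    exact expect_mono _ hf
  set c := f O with hc
  set t := ⌈lim⌉₊ with ht
  set ε : ℝ := (1 / 2) ^ b with hε
  set r := Real.sqrt (Real.sqrt n) with hr
  have hr1 : 1 ≤ r := Real.one_le_sqrt.mpr (Real.one_le_sqrt.mpr (by linarith))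
  have hr2 : r ^ 2 = Real.sqrt n := Real.sq_sqrt (Real.sqrt_nonneg _)
  have hr4 : r ^ 4 = n := by
    have e6 : r ^ 4 = (r ^ 2) ^ 2 := by ring
    rw [e6, hr2, Real.sq_sqrt hn'.le]
  have hε0 : 0 < ε := by positivity
  have hε1 : ε ≤ 1 := pow_le_one₀ (by norm_num) (by norm_num)
  have hC : ∀ S, f S ≤ 2 * (n + 1) * c := by
    intro S
    have := le_of_forall_card_eq hf hsub hk (by simpa using hkn) hmax S
    simpa using this
  -- the loss in rounding is at most `c / k` times the expected excess over `2 * k`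
  have hround : ((historyTree f b t).expect fun hist => (sampleTree coinHit b hist t).expect f) -
      c * (20 / r) ≤ (resultTree f b t k).expect f := by
    rw [resultTree, expect_bind]
    rw [← expect_const (historyTree f b t) (c * (20 / r)), ← expect_sub]
    refine expect_mono _ fun hist => ?_
    rw [expect_bind, expect_sampleTree_coinHit hb]
    have h1 := expect_mono (sampleTree insertHit b hist t)
      (halfMean_sub_le_expect_roundTree hf hsym hsub hk hkn hmax)
    rw [expect_sub, expect_mul] at h1
    refine le_trans ?_ h1
    have h2 := mul_le_mul_of_nonneg_left (expect_excess_le h hk hkn hist) h0.le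
    rw [← hr, ← ht] at h2
    have e : ∀ x : ℝ, c / k * x = c * (x / k) := fun x => by ring
    rw [e]
    linarith
  -- a random subset of the touched elements is worth `c / 2 * (1 - (1 - ε / k) ^ t)`, up to the
  -- accumulated errors of the estimates
  have hprog := expect_historyTree f hf hsym hsub hC (by positivity) hb O (by omega) t
  rw [hO, ← hε, ← hc] at hprog
  obtain ⟨⟨hw1, hw2, hlim0⟩, hw⟩ := h.weight hk hkn
  rw [← hε] at hw1 hw2 hw
  have ht1 : lim ≤ t := Nat.le_ceil lim
  have ht2 : (t : ℝ) ≤ lim + 1 := (Nat.ceil_lt_add_one hlim0).le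
  have htε : lim * ε ≤ t * ε := by gcongr
  have htε2 : t * ε ≤ 2 * n := by
    have := mul_le_mul_of_nonneg_right ht2 hε0.le
    linarith
  have hest : t * (ε / 2 * (2 * (n + 1) * c / (n : ℝ) ^ 3)) ≤ c * (4 / r) := by
    have e : t * (ε / 2 * (2 * (n + 1) * c / (n : ℝ) ^ 3)) =
        (t * ε) * ((n + 1) * c / (n : ℝ) ^ 3) := by
      ring
    rw [e]
    calc (t * ε) * ((n + 1) * c / (n : ℝ) ^ 3) ≤ (2 * n) * ((2 * n) * c / (n : ℝ) ^ 3) := by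
          gcongr; linarith
      _ = c * (4 / n) := by field_simp; ring
      _ ≤ c * (4 / r) := by
          gcongr
          rw [← hr4]
          exact le_self_pow₀ hr1 (by norm_num)
  have hpow : (1 - ε / k) ^ t ≤ Real.exp (-(lim * ε / k)) := by
    have h1 : 1 - ε / k ≤ Real.exp (-(ε / k)) := by
      have := Real.add_one_le_exp (-(ε / k)); linarith
    have h2 : 0 ≤ 1 - ε / k := by
      rw [sub_nonneg, div_le_one hk']; linarith
    refine (pow_le_pow_left₀ h2 h1 t).trans ?_
    rw [← Real.exp_nat_mul]
    apply Real.exp_le_exp.mpr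
    have e : (t : ℝ) * -(ε / k) = -(t * ε / k) := by ring
    rw [e]
    gcongr
  have hrpow := exp_le_rpow hk hkn
  set ρ := (1 - (k : ℝ) / n) ^ (2 * (n : ℝ) / k) with hρ
  have hratio : Real.exp (-(lim * ε / k)) ≤ ρ + 2 / r := by
    rcases lt_or_ge (2 * k * k) n with h1 | h1
    · -- here `lim * ε / k` is only `2`, but `k / n ≤ 1 / √n`
      have h2 : -(lim * ε / k) ≤ -2 := by
        rw [neg_le_neg_iff, le_div_iff₀ hk']; linarith
      have h3 := Real.exp_le_exp.mpr h2
      have e : Real.exp (-(2 + 2 * (k / n : ℝ))) =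
          Real.exp (-2) * Real.exp (-(2 * (k / n : ℝ))) := by
        rw [← Real.exp_add]; congr 1; ring
      have h4 := Real.add_one_le_exp (-(2 * (k / n : ℝ)))
      have h5 : Real.exp (-2) ≤ 1 := Real.exp_le_one_iff.mpr (by norm_num)
      have h6 := Real.exp_pos (-2)
      have h7 : 0 ≤ 2 * (k / n : ℝ) := by positivity
      have h8 : 2 * (k / n : ℝ) ≤ 2 / r := by
        rw [← mul_div_assoc]
        rw [div_le_div_iff₀ hn' (by linarith)]
        have h9 : (k : ℝ) ≤ r ^ 2 := by
          refine le_of_pow_le_pow_left₀ (n := 2) (by norm_num) (by positivity) ?_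
          have h10 : 2 * (k : ℝ) * k < n := by exact_mod_cast h1
          have e2 : (r ^ 2) ^ 2 = n := by rw [← hr4]; ring
          rw [e2]
          nlinarith
        have h11 : (k : ℝ) * r ≤ r ^ 2 * r := by gcongr
        have h12 : r ^ 2 * r ≤ r ^ 4 := by
          have : r ^ 2 * r = r ^ 3 := by ring
          rw [this]
          exact pow_le_pow_right₀ hr1 (by norm_num)
        rw [hr4] at h12
        linarith
      rw [e] at hrpow
      nlinarith
    · have e : -(lim * ε / k) = -(2 + 2 * (k / n : ℝ)) := by
        rw [hw h1]; field_simp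
      rw [e]
      have : 0 ≤ 2 / r := by positivity
      linarith
  have hsr : symmetricRatio n k = 1 / 2 * (1 - ρ) := rfl
  have herr : errorTerm n = 30 / r := rfl
  rw [hsr, herr]
  have hmain : c / 2 * (1 - (ρ + 2 / r)) ≤ c / 2 * (1 - (1 - ε / k) ^ t) := by
    gcongr
    linarith
  have e30 : (1 / 2 * (1 - ρ) - 30 / r) * c =
      c / 2 * (1 - (ρ + 2 / r)) - c * (4 / r) - c * (20 / r) - c * (5 / r) := by ring
  have : 0 ≤ c * (5 / r) := by positivity
  linarith

/-! ### Assembly -/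

theorem exists_eq_maxValue (f : Finset (Fin n) → ℝ) {k : ℕ} (hk : k ≤ n) :
    ∃ O : Finset (Fin n), O.card = k ∧ maxValue f k = f O ∧
      ∀ A : Finset (Fin n), A.card = k → f A ≤ f O := by
  have hne : (f '' {S : Finset (Fin n) | S.card = k}).Nonempty := by
    obtain ⟨A, -, hA⟩ := Finset.exists_subset_card_eq (s := (Finset.univ : Finset (Fin n)))
      (n := k) (by simpa using hk)
    exact ⟨f A, A, hA, rfl⟩
  have hfin : (f '' {S : Finset (Fin n) | S.card = k}).Finite := Set.toFinite _
  obtain ⟨O, hO, hfO⟩ := hne.csSup_mem hfin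
  refine ⟨O, hO, hfO.symm, fun A hA => ?_⟩
  rw [hfO]
  exact le_csSup hfin.bddAbove ⟨A, hA, rfl⟩

theorem maxValue_sub {f : Finset (Fin n) → ℝ} (hsym : IsSymmetricFn f) {k : ℕ} (hk : k ≤ n) :
    maxValue f (n - k) = maxValue f k := by
  have : f '' {S : Finset (Fin n) | S.card = n - k} = f '' {S : Finset (Fin n) | S.card = k} := by
    ext x
    constructor
    · rintro ⟨S, hS, rfl⟩
      refine ⟨Sᶜ, ?_, hsym S⟩
      simp only [Set.mem_ofPred_eq] at hS ⊢
      rw [Finset.card_compl, Fintype.card_fin]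
      omega
    · rintro ⟨S, hS, rfl⟩
      refine ⟨Sᶜ, ?_, hsym S⟩
      simp only [Set.mem_ofPred_eq] at hS ⊢
      rw [Finset.card_compl, Fintype.card_fin]
      omega
  rw [maxValue, maxValue, this]

end CardinalityMax

open CardinalityMax in
theorem theorem2 :
    ∃ (P : Program) (T : Polynomial ℕ) (err : ℕ → ℝ),
      Filter.Tendsto err Filter.atTop (nhds 0) ∧
      ∀ (n k : ℕ) (f : Finset (Fin n) → ℝ),
        1 ≤ k → k ≤ n →
        (∀ S, 0 ≤ f S) → IsSymmetricFn f → IsSubmodular f →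
          -- the running time is polynomial in `n`, whatever the outcomes of the coins
          (∀ s ∈ (P.finalState f k).support, s.time ≤ T.eval n) ∧
          -- the output is always a feasible solution
          (∀ S ∈ (P.output f k).support, S.card = k) ∧
          -- the approximation guarantee
          (2 * k ≤ n →
            (symmetricRatio n k - err n) * maxValue f k ≤ P.expectedValue f k) ∧
          (n < 2 * k → k < n →
            (symmetricRatio n (n - k) - err n) * maxValue f k ≤ P.expectedValue f k) := by
  refine ⟨algorithm, algorithm.cost, errorTerm, tendsto_errorTerm, ?_⟩
  intro n k f hk hkn hf hsym hsub
  have : NeZero n := ⟨by omega⟩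
  obtain ⟨b, lim, hpar, href⟩ := exists_refines_algorithm f k
  set k' := if 2 * k ≤ n then k else n - k with hk'
  have hk'n : 2 * k' ≤ n := by rw [hk']; split_ifs <;> omega
  have hvalue : algorithm.expectedValue f k = (resultTree f b ⌈lim⌉₊ k').expect f := by
    rw [Program.expectedValue_eq]
    refine href.expect_eq fun s S hS => ?_
    rw [hS, orCompl]
    split_ifs
    · exact hsym S
    · rfl
  have hguar : 1 ≤ k' → (symmetricRatio n k' - errorTerm n) * maxValue f k' ≤
      algorithm.expectedValue f k := by
    intro h1
    obtain ⟨O, hO, hmax, hle⟩ := exists_eq_maxValue f (show k' ≤ n by omega)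
    rw [hvalue, hmax]
    exact le_expect_resultTree hf hsym hsub hpar h1 hk'n hO hle
  refine ⟨fun s hs => Program.time_le_of_mem_support f k algorithm_clocked hs, ?_, ?_, ?_⟩
  · intro S hS
    rw [Program.output, PMF.mem_support_map_iff] at hS
    obtain ⟨s, hs, rfl⟩ := hS
    rw [Program.finalState, Program.run_eq_toPMF_tree] at hs
    have hall : (algorithm.tree f (MachineState.initial n k)).All
        fun s => (s.readSet n 2).card = k := by
      refine href.all (all_card_resultTree hf hsym hsub b _ hk'n) fun s S hS hcard => ?_
      rw [hS, orCompl]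
      by_cases h : n < 2 * k
      · have h2 : ¬ 2 * k ≤ n := by omega
        rw [hk', if_neg h2] at hcard
        simp only [h, decide_true, if_true]
        rw [Finset.card_compl, Fintype.card_fin, hcard]
        omega
      · have h2 : 2 * k ≤ n := by omega
        rw [hk', if_pos h2] at hcard
        simp [h, hcard]
    exact hall.of_mem_support hs
  · intro h
    have e : k' = k := if_pos h
    rw [e] at hguar
    exact hguar hk
  · intro h h2
    have e : k' = n - k := if_neg (by omega)
    rw [e, maxValue_sub hsym hkn] at hguar
    exact hguar (by omega)
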